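/- **Conventions.** A dyadic number is a number $p/2^q$ with $p\in\mathbb Z$, $q\in\mathbb N$. A real $x$ is *computable* if an algorithm, given $n\in\mathbb N$, outputs a dyadic $d_n$ with $|x-d_n|<2^{-n}$; it is *left-computable* if an algorithm outputs an increasing sequence of dyadics converging to $x$. An oracle for $x$ is a sequence $\phi(n)$ of dyadics with $|\phi(n)-x|<2^{-n}$ for all $n$. A function $f:A\to\mathbb R$, $A\subseteq\mathbb R$, is *computable on $A$* if one oracle machine, for every $x\in A$ and every oracle for $x$, outputs on input $n$ a dyadic $d_n$ with $|f(x)-d_n|<2^{-n}$; it is *left-computable on $A$* if one oracle machine, for every $x\in A$ and every oracle for $x$, outputs an increasing sequence converging to $f(x)$. **The map.** Let $J_i=(\ell_i,r_i)$, $i=1,2,\dots$, be disjoint nonempty open intervals in $(0,1)$ with $\ell_1>\ell_2>\cdots$, let $S=\bigcup_i J_i$, $s_0=\inf S$, $s_1=\sup S$, and let $G:S\to(0,1)$ be $C^1$. Write $G_i=G|_{J_i}$. Assume: 1. $G(J_i)=(s_0,s_1)$ for every $i$. 2. $|G'|>1$ on $S$, and there are $\tau>1$, $\sigma>1$ and an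 integer $\kappa\ge1$ such that, with $\tau_{i,k}=\inf|(G^k)'|$ over the points of $J_i$ where $G^k$ is defined, $\tau_{i,1}^{-1}<\ell_i\sigma$ and $\tau_{i,\kappa}^{-1}<\ell_i\tau^{-1}$ for all $i$. 3. $G$ is decreasing on $J_1$. 4. With $\varphi$ the fixed point of $G_1$ and $\delta(N)=G_N^{-1}(\varphi)-G_{N+1}^{-1}(\varphi)$, there is $D$ with $\frac{r_{N+1}}{\ell_{N+1}}\cdot\frac{r_N-\ell_{N+1}}{\delta(N)}<D$ for all $N\ge1$. 5. There is $D$ with $\frac{r_i-\ell_i}{(\ell_i-s_0)^2}<D$ for all $i$. 6. $G$ is computable on $S$, and some algorithm, given $i$, outputs a dyadic number in $J_i$. 7. $\frac{r_i}{\ell_{i+1}}-1\to0$ as $i\to\infty$. Let $\Lambda$ be the set of points all of whose iterates under $G$ lie in $S$; write $x=[a_1,a_2,\dots]$ if $G^{j-1}(x)\in J_{a_j}$ for all $j\ge1$. **The weight.** Let $u:(s_0,s_1)\to(0,\infty)$ be $C^1$ with: $u(x)\to\infty$ as $x\to s_0^+$; if $s_1=1$, then $\liminf_{N\to\infty}\inf_{z,w\in(s_0,s_1)}\frac{u(G_1^{-1}(G_N^{-1}(z)))}{u(G_1^{-1}(G_N^{-1}(w)))}>0$;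 for some $C>0$, $|u'(x)|<C/(x-s_0)^2$ on $(s_0,s_1)$; $u$ is computable on the set of those $[a_1,a_2,\dots]\in\Lambda$ with $a_l=1$ for all large $l$; $u$ is left-computable on $\Lambda$. Let $\nu>0$ be a computable real, and for $x\in\Lambda$ let $$\Phi(x)=\sum_{i=1}^{\infty}\bigl(x\,G(x)\cdots G^{i-2}(x)\bigr)^{\nu}\,u(G^{i-1}(x))\in(0,\infty]$$ (the empty product for $i=1$ being $1$). **Statement.** Let $x_*\in\Lambda$ be computable with $y_*:=\Phi(x_*)<\infty$ (for example, a computable point at which $\Phi$ attains its minimum). Then: (a) for every left-computable $y\in[y_*,\infty)$ there is a computable $x\in\Lambda$ with $\Phi(x)=y$; (b) for every computable $x\in\Lambda$ with $\Phi(x)<\infty$, the value $\Phi(x)$ is left-computable; (c) there is a computable $x\in\Lambda$ with $y_*\le\Phi(x)<\infty$ such that $\Phi(x)$ is not computable. -/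

import Mathlib

open Set Filter Topology
open scoped ENNReal

noncomputable section

namespace Brjuno

/-! ### Computable reals and computable real functions -/

/-- The pair `(p, q)` is the finite object that names the dyadic rational `p / 2 ^ q`. -/
abbrev DyadicCode : Type := ℤ × ℕ

/-- The real number named by a dyadic code. -/
def dyadicVal (d : DyadicCode) : ℝ := (d.1 : ℝ) / 2 ^ d.2

/-- `x` is computable: an algorithm, given `n`, outputs a dyadic number at distance less
than `2 ^ (-n)` from `x`. -/
def ComputableReal (x : ℝ) : Prop :=
  ∃ d : ℕ → DyadicCode, Computable d ∧ ∀ n, |x - dyadicVal (d n)| < (1 / 2 : ℝ) ^ n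

/-- `y` is left-computable: an algorithm outputs an increasing sequence converging to `y`.
(Asking for strict monotonicity gives the same notion: replace `a n` by `a n - 2 ^ (-n)`.) -/
def LeftComputableReal (y : ℝ) : Prop :=
  ∃ a : ℕ → DyadicCode, Computable a ∧ Monotone (fun n => dyadicVal (a n)) ∧
    Tendsto (fun n => dyadicVal (a n)) atTop (𝓝 y)

/-- `φ` is an oracle for the real number `x`. -/
def IsOracle (φ : ℕ → DyadicCode) (x : ℝ) : Prop :=
  ∀ n, |dyadicVal (φ n) - x| < (1 / 2 : ℝ) ^ n

/-- An oracle machine with one input `n`. The oracle is a tape `φ 0, φ 1, φ 2, …` of dyadic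
numbers. Having read `φ 0, …, φ (k - 1)`, the machine on input `n` decides, by an algorithm,
whether to halt with an output (`some d`) or to go on and read `φ k` (`none`). -/
structure OracleMachine where
  /-- the action on an input and the part of the tape that has been read -/
  step : ℕ → List DyadicCode → Option DyadicCode
  computable_step : Computable₂ step

/-- With oracle `φ` and input `n` the machine halts with output `d`. -/
def OracleMachine.Outputs (M : OracleMachine) (φ : ℕ → DyadicCode) (n : ℕ)
    (d : DyadicCode) : Prop :=
  ∃ k, M.step n ((List.range k).map φ) = some d ∧
    ∀ j < k, M.step n ((List.range j).map φ) = none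

/-- `f` is (uniformly) computable on `A`: one oracle machine works for all `x ∈ A` and all
oracles for `x`. -/
def ComputableOn (f : ℝ → ℝ) (A : Set ℝ) : Prop :=
  ∃ M : OracleMachine, ∀ x ∈ A, ∀ φ, IsOracle φ x → ∀ n,
    ∃ d, M.Outputs φ n d ∧ |f x - dyadicVal d| < (1 / 2 : ℝ) ^ n

/-- `f` is (uniformly) left-computable on `A`: one oracle machine outputs, for all `x ∈ A` and
all oracles for `x`, an increasing sequence converging to `f x`. -/
def LeftComputableOn (f : ℝ → ℝ) (A : Set ℝ) : Prop :=
  ∃ M : OracleMachine, ∀ x ∈ A, ∀ φ, IsOracle φ x →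
    ∃ a : ℕ → DyadicCode, (∀ n, M.Outputs φ n (a n)) ∧
      Monotone (fun n => dyadicVal (a n)) ∧
      Tendsto (fun n => dyadicVal (a n)) atTop (𝓝 (f x))

/-! ### Piecewise defined maps with infinitely many full branches -/

/-- The data of a piecewise defined map: a function and the endpoints of its intervals.
Indices start at `0`: the interval `J_(i+1)` of the usual notation is `(ℓ i, r i)`.
Only the values of `G` on the union of the intervals are ever used. -/
structure BranchedMap where
  G : ℝ → ℝ
  ℓ : ℕ → ℝ
  r : ℕ → ℝ

namespace BranchedMap

variable (T : BranchedMap)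

/-- The interval number `i` (counted from `0`). -/
def J (i : ℕ) : Set ℝ := Ioo (T.ℓ i) (T.r i)

/-- The domain of the map. -/
def S : Set ℝ := ⋃ i, T.J i

def s₀ : ℝ := sInf T.S

def s₁ : ℝ := sSup T.S

/-- The inverse branch `(s₀, s₁) → J i`. -/
def inv (i : ℕ) (z : ℝ) : ℝ := Function.invFunOn T.G (T.J i) z

/-- The points of `J i` at which the `k`-th iterate of the map is defined. -/
def iterDom (i k : ℕ) : Set ℝ := {x ∈ T.J i | ∀ j < k, T.G^[j] x ∈ T.S}

/-- `τ_(i,k)`, the infimum of `|(G^k)'|` over the points of `J i` where `G^k` is defined. -/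
def minExp (i k : ℕ) : ℝ := sInf ((fun x => |deriv (T.G^[k]) x|) '' T.iterDom i k)

/-- The set of points all of whose iterates are defined. -/
def Lam : Set ℝ := {x | ∀ j : ℕ, T.G^[j] x ∈ T.S}

/-- The points `[a₁, a₂, …]` of `Λ` with `a_l = 1` for all large `l`. -/
def EventuallyOnes : Set ℝ := {x ∈ T.Lam | ∃ l₀ : ℕ, ∀ l, l₀ ≤ l → T.G^[l] x ∈ T.J 0}

/-- The standing assumptions on the map. -/
structure Admissible : Prop where
  lt : ∀ i, T.ℓ i < T.r i
  subset : T.S ⊆ Ioo 0 1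
  anti : StrictAnti T.ℓ
  disjoint : Pairwise fun i j => Disjoint (T.J i) (T.J j)
  contDiff : ContDiffOn ℝ 1 T.G T.S
  /-- every branch is full -/
  image : ∀ i, T.G '' T.J i = Ioo T.s₀ T.s₁
  /-- expansion -/
  one_lt : ∀ x ∈ T.S, 1 < |deriv T.G x|
  expansion : ∃ τ σ : ℝ, ∃ κ : ℕ, 1 < τ ∧ 1 < σ ∧ 1 ≤ κ ∧
    ∀ i, (T.minExp i 1)⁻¹ < T.ℓ i * σ ∧ (T.minExp i κ)⁻¹ < T.ℓ i * τ⁻¹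
  /-- the first branch is decreasing -/
  decreasing : StrictAntiOn T.G (T.J 0)
  /-- spacing of the preimages of the fixed point `p` of the first branch -/
  spacing : ∀ p ∈ T.J 0, T.G p = p → ∃ D : ℝ, ∀ N : ℕ,
    T.r (N + 1) / T.ℓ (N + 1) *
      ((T.r N - T.ℓ (N + 1)) / (T.inv N p - T.inv (N + 1) p)) < D
  /-- size of the intervals -/
  size : ∃ D : ℝ, ∀ i, (T.r i - T.ℓ i) / (T.ℓ i - T.s₀) ^ 2 < D
  /-- the map is computable on its domain -/
  computable : ComputableOn T.G T.S
  /-- the enumeration of the pieces is effective: an algorithm finds, given `i`, a point of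
  the interval number `i` -/
  effective : ∃ q : ℕ → DyadicCode, Computable q ∧ ∀ i, dyadicVal (q i) ∈ T.J i
  /-- ratios of endpoints -/
  ratio : Tendsto (fun i => T.r i / T.ℓ (i + 1) - 1) atTop (𝓝 0)

/-- The standing assumptions on the weight `u : (s₀, s₁) → (0, ∞)`. -/
structure Weight (u : ℝ → ℝ) : Prop where
  contDiff : ContDiffOn ℝ 1 u (Ioo T.s₀ T.s₁)
  pos : ∀ x ∈ Ioo T.s₀ T.s₁, 0 < u x
  tendsto : Tendsto u (𝓝[>] T.s₀) atTop
  /-- if `s₁ = 1`, then the lower limit as `N → ∞` of the infimum over `z, w` of the ratio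
  is positive -/
  ratio : T.s₁ = 1 → ∃ c : ℝ, 0 < c ∧ ∀ᶠ N in atTop,
    ∀ z ∈ Ioo T.s₀ T.s₁, ∀ w ∈ Ioo T.s₀ T.s₁,
      c ≤ u (T.inv 0 (T.inv N z)) / u (T.inv 0 (T.inv N w))
  deriv_lt : ∃ C : ℝ, 0 < C ∧ ∀ x ∈ Ioo T.s₀ T.s₁, |deriv u x| < C / (x - T.s₀) ^ 2
  computable : ComputableOn u T.EventuallyOnes
  leftComputable : LeftComputableOn u T.Lam

/-- The generalized Brjuno function
`Φ(x) = ∑_(i ≥ 0) (x · G(x) ⋯ G^(i-1)(x))^ν · u(G^i(x))`, with values in `[0, ∞]`.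
On `Λ` all terms are positive. -/
def Phi (u : ℝ → ℝ) (ν : ℝ) (x : ℝ) : ℝ≥0∞ :=
  ∑' i : ℕ, ENNReal.ofReal ((∏ j ∈ Finset.range i, T.G^[j] x) ^ ν * u (T.G^[i] x))

end BranchedMap

end Brjuno

end

/-!
The theorem is a prescribed-value construction in the space of digit sequences. Let `p` be the
fixed point of the first branch. The points `T.pt p w` whose digits are a finite word `w` followed
by the digit `0` for ever (the digits of `p`) play the role of finite approximations.

*Analysis.* The map contracts distances between points with many common digits and has bounded
distortion, and the weight has bounded oscillation on each interval `J i`. Hence the sum `Φ` is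
finite at every `T.pt p w`, and `Φ (T.pt p w) → Φ x` when `w` runs through the initial words of a
point `x` with `Φ x < ∞` (`tendsto_realPhi_pt`). Appending many digits `0` and then one large
digit `N` to `w` increases `Φ` by essentially one term, since `u` blows up at `s₀`. Changing the
number of digits `0` by one changes this term by a bounded factor, so the increase can be made
smaller than any bound `t` and larger than `c * t` for a constant `c` (`exists_increment`).
Repeating such steps, one reaches values of `Φ` arbitrarily close below any number above
`Φ (T.pt p w)` (`exists_realPhi_between`).

*Computability.* All algorithms are expressed by recursively enumerable relations. An oracle
machine reads only finitely much of its tape, so a computable function yields an enumerable set of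
certificates "`f` maps the points of `A` between `c` and `d` into `(a, b)`" (`Enclosure`), and a
left-computable function yields lower bounds only (`LowerEnclosure`). A computable number is one
with enumerable Dedekind cuts. Quantities defined by recursion, such as `T.pt p w`, `G^[j] x` and
`Φ`, get their cuts from reachability in an enumerable transition relation (`re_reach`).

*Conclusion.* For (a), start from a word `w` with `Φ (T.pt p w) < y`, which exists because `y` is
above a finite value of `Φ`, and search for prolongations that bring `Φ` just below members of the
sequence that increases to `y`; the search succeeds by `exists_realPhi_between`, the words have
a computable limit `x`, and `Φ x = y` (`exists_computableReal_realPhi_eq`). For (b), finitely many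
terms of the series certify a lower bound for `Φ x` (`lowerRE_realPhi`). For (c), apply (a) to a
left-computable number that is not computable, which the halting problem provides
(`exists_leftComputableReal_not_computableReal`).
-/

open Set Filter Topology
open scoped ENNReal

namespace Brjuno

/-! ### Recursively enumerable predicates -/

section RE

variable {α β γ σ : Type*} [Primcodable α] [Primcodable β] [Primcodable γ] [Primcodable σ]

/-- A computable function has a graph with primitive recursive witnesses: the witness is the
number of steps of a run of a program for the function. -/
theorem exists_primrec_graph {f : α → β} (hf : Computable f) :
    ∃ R : (α × β) × ℕ → Prop, PrimrecPred R ∧ ∀ a b, f a = b ↔ ∃ n, R ((a, b), n) := by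
  obtain ⟨c, hc⟩ := Nat.Partrec.Code.exists_code.1 hf
  refine ⟨fun p => Nat.Partrec.Code.evaln p.2 c (Encodable.encode p.1.1) =
    some (Encodable.encode p.1.2), ?_, fun a b => ?_⟩
  · refine PrimrecRel.comp Primrec.eq ?_ ?_
    · exact Nat.Partrec.Code.primrec_evaln.comp
        ((Primrec.snd.pair (Primrec.const c)).pair
          (Primrec.encode.comp (Primrec.fst.comp Primrec.fst)))
    · exact Primrec.option_some.comp (Primrec.encode.comp (Primrec.snd.comp Primrec.fst))
  · have h1 : Encodable.encode b ∈ Nat.Partrec.Code.eval c (Encodable.encode a) ↔ f a = b := by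
      rw [hc]
      simp [Encodable.encode_inj, eq_comm]
    rw [← h1, Nat.Partrec.Code.evaln_complete]
    rfl

/-- Normal form: a predicate is recursively enumerable iff it is the projection of a primitive
recursive one. -/
theorem rePred_iff {p : α → Prop} :
    REPred p ↔ ∃ R : α × ℕ → Prop, PrimrecPred R ∧ ∀ a, p a ↔ ∃ n, R (a, n) := by
  constructor
  · intro h
    obtain ⟨c, hc⟩ := Nat.Partrec.Code.exists_code.1 h
    refine ⟨fun q => (Nat.Partrec.Code.evaln q.2 c (Encodable.encode q.1)).isSome = true,
      ?_, fun a => ?_⟩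
    · refine PrimrecRel.comp Primrec.eq ?_ (Primrec.const true)
      exact Primrec.option_isSome.comp (Nat.Partrec.Code.primrec_evaln.comp
        ((Primrec.snd.pair (Primrec.const c)).pair (Primrec.encode.comp Primrec.fst)))
    · have h1 : (Nat.Partrec.Code.eval c (Encodable.encode a)).Dom ↔ p a := by
        rw [hc]
        simp [Part.assert]
      rw [← h1, Part.dom_iff_mem]
      simp only [Nat.Partrec.Code.evaln_complete, Option.isSome_iff_exists]
      exact ⟨fun ⟨y, k, h⟩ => ⟨k, y, h⟩, fun ⟨k, y, h⟩ => ⟨y, k, h⟩⟩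
  · rintro ⟨R, ⟨hd, hR⟩, h⟩
    have h1 : Partrec fun a => Nat.rfind fun n => (Part.some (decide (R (a, n))) : Part Bool) :=
      Partrec.rfind (hR.to_comp.partrec.to₂)
    refine h1.dom_re.of_eq fun a => ?_
    rw [h]
    refine Nat.rfind_dom'.trans ?_
    simp

theorem _root_.PrimrecPred.rePred {p : α → Prop} (h : PrimrecPred p) : REPred p :=
  h.computablePred.to_re

theorem re_comp {p : β → Prop} (hp : REPred p) {f : α → β} (hf : Computable f) :
    REPred fun a => p (f a) :=
  Partrec.comp hp hf

theorem re_comp₂ {r : β → γ → Prop} (hr : REPred fun x : β × γ => r x.1 x.2) {f : α → β}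
    {g : α → γ} (hf : Computable f) (hg : Computable g) : REPred fun a => r (f a) (g a) :=
  re_comp hr (f := fun a => (f a, g a)) (hf.pair hg)

theorem re_and {p q : α → Prop} (hp : REPred p) (hq : REPred q) : REPred fun a => p a ∧ q a := by
  obtain ⟨R, hR, h1⟩ := rePred_iff.1 hp
  obtain ⟨Q, hQ, h2⟩ := rePred_iff.1 hq
  refine rePred_iff.2 ⟨fun x => R (x.1, x.2.unpair.1) ∧ Q (x.1, x.2.unpair.2), ?_, fun a => ?_⟩
  · have hu := Primrec.unpair.comp (Primrec.snd (α := α))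
    exact (hR.comp (Primrec.fst.pair (Primrec.fst.comp hu))).and
      (hQ.comp (Primrec.fst.pair (Primrec.snd.comp hu)))
  · rw [h1, h2]
    constructor
    · rintro ⟨⟨m, hm⟩, ⟨n, hn⟩⟩
      exact ⟨Nat.pair m n, by simpa using ⟨hm, hn⟩⟩
    · rintro ⟨n, h, h'⟩
      exact ⟨⟨_, h⟩, ⟨_, h'⟩⟩

theorem re_exists {p : α × β → Prop} (hp : REPred p) : REPred fun a => ∃ b, p (a, b) := by
  obtain ⟨R, ⟨hd, hR⟩, h1⟩ := rePred_iff.1 hp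
  refine rePred_iff.2 ⟨fun x => ((Encodable.decode (α := β × ℕ) x.2).map
    fun y => decide (R ((x.1, y.1), y.2))) = some true, ?_, fun a => ?_⟩
  · refine PrimrecRel.comp Primrec.eq (Primrec.option_map (Primrec.decode.comp Primrec.snd) ?_)
      (Primrec.const _)
    exact hR.comp (((Primrec.fst.comp Primrec.fst).pair (Primrec.fst.comp Primrec.snd)).pair
      (Primrec.snd.comp Primrec.snd))
  · simp only [h1, Option.map_eq_some_iff, decide_eq_true_eq]
    constructor
    · rintro ⟨b, n, h⟩
      exact ⟨Encodable.encode (b, n), (b, n), Encodable.encodek _, h⟩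
    · rintro ⟨n, y, -, h⟩
      exact ⟨_, _, h⟩

theorem re_exists₂ {p : α → β → Prop} (hp : REPred fun x : α × β => p x.1 x.2) :
    REPred fun a => ∃ b, p a b := re_exists hp

theorem re_or {p q : α → Prop} (hp : REPred p) (hq : REPred q) : REPred fun a => p a ∨ q a := by
  obtain ⟨R, hR, h1⟩ := rePred_iff.1 hp
  obtain ⟨Q, hQ, h2⟩ := rePred_iff.1 hq
  refine rePred_iff.2 ⟨fun x => R x ∨ Q x, hR.or hQ, fun a => ?_⟩
  rw [h1, h2, exists_or]

theorem re_graph {f : α → β} (hf : Computable f) : REPred fun x : α × β => f x.1 = x.2 := by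
  obtain ⟨R, hR, h⟩ := exists_primrec_graph hf
  exact rePred_iff.2 ⟨R, hR, fun x => h x.1 x.2⟩

/-- Certificates for reachability: a list of states, the last one visited first, each with a
witness for its being an initial state or a successor of the state before it. -/
def chase (R : σ × ℕ → Prop) (Q : (σ × σ) × ℕ → Prop) [DecidablePred R] [DecidablePred Q]
    (l : List (σ × ℕ)) : Option σ :=
  l.foldr (fun x acc => Option.casesOn acc
    (bif decide (R x) then some x.1 else none)
    (fun s => bif decide (Q ((s, x.1), x.2)) then some x.1 else some s)) none

/-- The states reachable from a recursively enumerable set of initial states by recursively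
enumerable steps form a recursively enumerable set. -/
theorem re_reach {init : σ → Prop} {step : σ → σ → Prop} (hi : REPred init)
    (hs : REPred fun x : σ × σ => step x.1 x.2) :
    REPred fun s => ∃ s₀, init s₀ ∧ Relation.ReflTransGen step s₀ s := by
  obtain ⟨R, ⟨hdR, hR⟩, h1⟩ := rePred_iff.1 hi
  obtain ⟨Q, ⟨hdQ, hQ⟩, h2⟩ := rePred_iff.1 hs
  have key : Primrec (chase R Q) := by
    refine Primrec.list_foldr (h := fun _ (x : (σ × ℕ) × Option σ) => Option.casesOn x.2
      (bif decide (R x.1) then some x.1.1 else none)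
      (fun s => bif decide (Q ((s, x.1.1), x.1.2)) then some x.1.1 else some s))
      Primrec.id (Primrec.const none) ?_
    refine Primrec.option_casesOn (Primrec.snd.comp Primrec.snd) ?_ ?_
    · exact Primrec.cond (hR.comp (Primrec.fst.comp Primrec.snd))
        (Primrec.option_some.comp (Primrec.fst.comp (Primrec.fst.comp Primrec.snd)))
        (Primrec.const none)
    · have hx : Primrec fun y : (List (σ × ℕ) × (σ × ℕ) × Option σ) × σ => y.1.2.1 :=
        Primrec.fst.comp (Primrec.snd.comp Primrec.fst)
      exact Primrec.cond
        (hQ.comp ((Primrec.snd.pair (Primrec.fst.comp hx)).pair (Primrec.snd.comp hx)))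
        (Primrec.option_some.comp (Primrec.fst.comp hx)) (Primrec.option_some.comp Primrec.snd)
  have hre : REPred fun s => ∃ l, chase R Q l = some s := by
    refine re_exists₂ (PrimrecPred.rePred ?_)
    exact PrimrecRel.comp Primrec.eq (key.comp Primrec.snd) (Primrec.option_some.comp Primrec.fst)
  refine hre.of_eq fun s => ?_
  constructor
  · rintro ⟨l, hl⟩
    induction l generalizing s with
    | nil => simp [chase] at hl
    | cons x l ih =>
      have e : chase R Q (x :: l) = Option.casesOn (chase R Q l)
        (bif decide (R x) then some x.1 else none)
        (fun s => bif decide (Q ((s, x.1), x.2)) then some x.1 else some s) := rfl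
      rw [e] at hl
      cases hc : chase R Q l with
      | none =>
        rw [hc] at hl
        by_cases hRx : R x
        · simp only [hRx, decide_true, cond_true, Option.some.injEq] at hl
          subst hl
          exact ⟨x.1, (h1 _).2 ⟨x.2, hRx⟩, .refl⟩
        · simp [hRx] at hl
      | some s' =>
        rw [hc] at hl
        obtain ⟨s₀, hs₀, hr⟩ := ih s' hc
        by_cases hQx : Q ((s', x.1), x.2)
        · simp only [hQx, decide_true, cond_true, Option.some.injEq] at hl
          subst hl
          exact ⟨s₀, hs₀, hr.tail ((h2 (s', x.1)).2 ⟨x.2, hQx⟩)⟩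
        · simp only [hQx, decide_false, cond_false, Option.some.injEq] at hl
          subst hl
          exact ⟨s₀, hs₀, hr⟩
  · rintro ⟨s₀, hs₀, hr⟩
    induction hr with
    | refl =>
      obtain ⟨n, hn⟩ := (h1 _).1 hs₀
      exact ⟨[(s₀, n)], by simp [chase, hn]⟩
    | @tail b c _ hstep ih =>
      obtain ⟨l, hl⟩ := ih
      obtain ⟨n, hn⟩ := (h2 (b, c)).1 hstep
      refine ⟨(c, n) :: l, ?_⟩
      have e : chase R Q ((c, n) :: l) = Option.casesOn (chase R Q l)
        (bif decide (R (c, n)) then some c else none)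
        (fun s => bif decide (Q ((s, c), n)) then some c else some s) := rfl
      rw [e, hl]
      simp [hn]

/-- Dependent choice for recursively enumerable relations: the search for a suitable next state
can be done by an algorithm. -/
theorem exists_computable_seq {step : ℕ → σ → σ → Prop}
    (hs : REPred fun x : (ℕ × σ) × σ => step x.1.1 x.1.2 x.2) (good : σ → Prop)
    (s₀ : σ) (h₀ : good s₀) (hex : ∀ k s, good s → ∃ s', step k s s')
    (hgood : ∀ k s s', good s → step k s s' → good s') :
    ∃ W : ℕ → σ, Computable W ∧ W 0 = s₀ ∧ ∀ k, good (W k) ∧ step k (W k) (W (k + 1)) := by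
  obtain ⟨R, ⟨hd, hR⟩, h1⟩ := rePred_iff.1 hs
  let F : ℕ × σ → ℕ → Option σ := fun x n => (Encodable.decode (α := σ × ℕ) n).bind
    fun y => bif decide (R ((x, y.1), y.2)) then some y.1 else none
  have hF : Primrec₂ F := by
    refine Primrec.option_bind (Primrec.decode.comp Primrec.snd) ?_
    exact Primrec.cond (hR.comp (((Primrec.fst.comp Primrec.fst).pair
      (Primrec.fst.comp Primrec.snd)).pair (Primrec.snd.comp Primrec.snd)))
      (Primrec.option_some.comp (Primrec.fst.comp Primrec.snd)) (Primrec.const none)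
  have hFs : ∀ k s n s', s' ∈ F (k, s) n → step k s s' := by
    intro k s n s' h
    simp only [F, Option.mem_def, Option.bind_eq_some_iff] at h
    obtain ⟨y, -, hy⟩ := h
    by_cases hRy : R (((k, s), y.1), y.2)
    · simp only [hRy, decide_true, cond_true, Option.some.injEq] at hy
      subst hy
      exact (h1 ((k, s), y.1)).2 ⟨_, hRy⟩
    · simp [hRy] at hy
  let g : ℕ × σ →. σ := fun x => Nat.rfindOpt (F x)
  have hg : Partrec g := Partrec.rfindOpt hF.to_comp
  let h : ℕ →. σ := fun k => Nat.rec (Part.some s₀) (fun k ih => ih.bind fun s => g (k, s)) k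
  have hh : Partrec h := by
    have := Partrec.nat_rec (f := fun k : ℕ => k) (g := fun _ => Part.some s₀)
      (h := fun _ x => g x) Computable.id (Computable.const s₀) (hg.comp Computable.snd).to₂
    exact this
  have hdom : ∀ k, ∃ s, s ∈ h k ∧ good s := by
    intro k
    induction k with
    | zero => exact ⟨s₀, Part.mem_some _, h₀⟩
    | succ k ih =>
      obtain ⟨s, hsk, hgs⟩ := ih
      obtain ⟨s', hst⟩ := hex k s hgs
      obtain ⟨n, hn⟩ := (h1 ((k, s), s')).1 hst
      have : (g (k, s)).Dom := by
        refine Nat.rfindOpt_dom.2 ⟨Encodable.encode (s', n), s', ?_⟩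
        simp [F, hn]
      obtain ⟨t, ht⟩ := Part.dom_iff_mem.1 this
      refine ⟨t, Part.mem_bind hsk ht, ?_⟩
      obtain ⟨n, hn⟩ := Nat.rfindOpt_spec ht
      exact hgood k s t hgs (hFs _ _ _ _ hn)
  choose W hW hWg using hdom
  refine ⟨W, hh.of_eq_tot hW, ?_, fun k => ⟨hWg k, ?_⟩⟩
  · exact Part.mem_some_iff.1 (hW 0)
  · obtain ⟨s, hs1, hs2⟩ := Part.mem_bind_iff.1 (hW (k + 1))
    obtain rfl := Part.mem_unique hs1 (hW k)
    obtain ⟨n, hn⟩ := Nat.rfindOpt_spec hs2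
    exact hFs _ _ _ _ hn

/-- A recursively enumerable relation with nonempty sections contains the graph of a computable
function. -/
theorem exists_computable_choice {p : α → β → Prop} (hp : REPred fun x : α × β => p x.1 x.2)
    (hex : ∀ a, ∃ b, p a b) : ∃ f : α → β, Computable f ∧ ∀ a, p a (f a) := by
  obtain ⟨R, ⟨hd, hR⟩, h1⟩ := rePred_iff.1 hp
  let F : α → ℕ → Option β := fun x n => (Encodable.decode (α := β × ℕ) n).bind
    fun y => bif decide (R ((x, y.1), y.2)) then some y.1 else none
  have hF : Primrec₂ F := by
    refine Primrec.option_bind (Primrec.decode.comp Primrec.snd) ?_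
    exact Primrec.cond (hR.comp (((Primrec.fst.comp Primrec.fst).pair
      (Primrec.fst.comp Primrec.snd)).pair (Primrec.snd.comp Primrec.snd)))
      (Primrec.option_some.comp (Primrec.fst.comp Primrec.snd)) (Primrec.const none)
  have hg : Partrec fun a => Nat.rfindOpt (F a) := Partrec.rfindOpt hF.to_comp
  have hdom : ∀ a, ∃ b, b ∈ Nat.rfindOpt (F a) := by
    intro a
    obtain ⟨b, hb⟩ := hex a
    obtain ⟨n, hn⟩ := (h1 (a, b)).1 hb
    exact Part.dom_iff_mem.1 (Nat.rfindOpt_dom.2 ⟨Encodable.encode (b, n), b, by simp [F, hn]⟩)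
  choose f hf using hdom
  refine ⟨f, hg.of_eq_tot hf, fun a => ?_⟩
  obtain ⟨n, hn⟩ := Nat.rfindOpt_spec (hf a)
  simp only [F, Option.mem_def, Option.bind_eq_some_iff] at hn
  obtain ⟨y, -, hy⟩ := hn
  by_cases hRy : R ((a, y.1), y.2)
  · simp only [hRy, decide_true, cond_true, Option.some.injEq] at hy
    rw [← hy]
    exact (h1 (a, y.1)).2 ⟨_, hRy⟩
  · simp [hRy] at hy

end RE

/-! ### Arithmetic of dyadic numbers -/

theorem primrec_toNat : Primrec Int.toNat := by
  have h : Primrec fun z : ℤ => bif (Encodable.encode z).bodd then 0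
      else (Encodable.encode z).div2 :=
    Primrec.cond (Primrec.nat_bodd.comp Primrec.encode) (Primrec.const 0)
      (Primrec.nat_div2.comp Primrec.encode)
  refine h.of_eq fun z => ?_
  cases z with
  | ofNat n =>
    have : Encodable.encode (Int.ofNat n) = 2 * n := rfl
    rw [this]; simp
  | negSucc n =>
    have : Encodable.encode (Int.negSucc n) = 2 * n + 1 := rfl
    rw [this]; simp

theorem primrec_toNat_neg : Primrec fun z : ℤ => (-z).toNat := by
  have h : Primrec fun z : ℤ => bif (Encodable.encode z).bodd
      then (Encodable.encode z).div2 + 1 else 0 :=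
    Primrec.cond (Primrec.nat_bodd.comp Primrec.encode)
      (Primrec.succ.comp (Primrec.nat_div2.comp Primrec.encode)) (Primrec.const 0)
  refine h.of_eq fun z => ?_
  cases z with
  | ofNat n =>
    have : Encodable.encode (Int.ofNat n) = 2 * n := rfl
    rw [this]; simp
  | negSucc n =>
    have : Encodable.encode (Int.negSucc n) = 2 * n + 1 := rfl
    rw [this]; simp

theorem primrec_natCast_sub : Primrec₂ fun a b : ℕ => (a : ℤ) - b := by
  have h : Primrec fun x : ℕ × ℕ => if x.1 < x.2 then 2 * (x.2 - x.1 - 1) + 1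
      else 2 * (x.1 - x.2) := by
    refine Primrec.ite (Primrec.nat_lt.comp Primrec.fst Primrec.snd) ?_ ?_
    · exact Primrec.nat_double_succ.comp (Primrec.nat_sub.comp
        (Primrec.nat_sub.comp Primrec.snd Primrec.fst) (Primrec.const 1))
    · exact Primrec.nat_double.comp (Primrec.nat_sub.comp Primrec.fst Primrec.snd)
  refine Primrec.encode_iff.1 (h.of_eq fun x => ?_)
  obtain ⟨a, b⟩ := x
  dsimp only
  split_ifs with hab
  · obtain ⟨c, rfl⟩ : ∃ c, b = a + c + 1 := ⟨b - a - 1, by omega⟩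
    have e : (a : ℤ) - ((a + c + 1 : ℕ) : ℤ) = Int.negSucc c := by
      rw [Int.negSucc_eq]; push_cast; ring
    have e2 : Encodable.encode (Int.negSucc c) = 2 * c + 1 := rfl
    rw [e, e2]; congr 2; omega
  · obtain ⟨c, rfl⟩ : ∃ c, a = b + c := ⟨a - b, by omega⟩
    have e : ((b + c : ℕ) : ℤ) - (b : ℤ) = Int.ofNat c := by
      push_cast; simp
    have e2 : Encodable.encode (Int.ofNat c) = 2 * c := rfl
    rw [e, e2]; congr 1; omega

theorem primrec_int_add : Primrec₂ fun a b : ℤ => a + b := by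
  have h1 := primrec_toNat
  have h2 := primrec_toNat_neg
  refine Primrec.of_eq (f := fun x : ℤ × ℤ => ((x.1.toNat + x.2.toNat : ℕ) : ℤ) -
    (((-x.1).toNat + (-x.2).toNat : ℕ) : ℤ)) ?_ fun x => ?_
  · exact primrec_natCast_sub.comp
      (Primrec.nat_add.comp (h1.comp Primrec.fst) (h1.comp Primrec.snd))
      (Primrec.nat_add.comp (h2.comp Primrec.fst) (h2.comp Primrec.snd))
  · push_cast
    have := Int.toNat_sub_toNat_neg x.1
    have := Int.toNat_sub_toNat_neg x.2
    omega

theorem primrec_int_neg : Primrec fun a : ℤ => -a := by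
  refine Primrec.of_eq (f := fun x : ℤ => ((-x).toNat : ℤ) - (x.toNat : ℤ)) ?_ fun x => ?_
  · exact primrec_natCast_sub.comp primrec_toNat_neg primrec_toNat
  · omega

theorem primrec_int_mul : Primrec₂ fun a b : ℤ => a * b := by
  have h1 := primrec_toNat
  have h2 := primrec_toNat_neg
  refine Primrec.of_eq (f := fun x : ℤ × ℤ =>
    ((x.1.toNat * x.2.toNat + (-x.1).toNat * (-x.2).toNat : ℕ) : ℤ) -
    ((x.1.toNat * (-x.2).toNat + (-x.1).toNat * x.2.toNat : ℕ) : ℤ)) ?_ fun x => ?_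
  · have h (f g : ℤ → ℕ) (hf : Primrec f) (hg : Primrec g) :
        Primrec fun x : ℤ × ℤ => f x.1 * g x.2 :=
      Primrec.nat_mul.comp (hf.comp Primrec.fst) (hg.comp Primrec.snd)
    exact primrec_natCast_sub.comp (Primrec.nat_add.comp (h _ _ h1 h1) (h _ _ h2 h2))
      (Primrec.nat_add.comp (h _ _ h1 h2) (h _ _ h2 h1))
  · have e1 := Int.toNat_sub_toNat_neg x.1
    have e2 := Int.toNat_sub_toNat_neg x.2
    calc _ = ((x.1.toNat : ℤ) - ((-x.1).toNat : ℤ)) * ((x.2.toNat : ℤ) - ((-x.2).toNat : ℤ)) := by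
          push_cast; ring
      _ = _ := by rw [e1, e2]

theorem primrec_int_le : PrimrecRel fun a b : ℤ => a ≤ b := by
  have h1 := primrec_toNat
  have h2 := primrec_toNat_neg
  refine PrimrecPred.of_eq (p := fun x : ℤ × ℤ => x.1.toNat + (-x.2).toNat ≤
    x.2.toNat + (-x.1).toNat) ?_ fun x => by omega
  exact Primrec.nat_le.comp
      (Primrec.nat_add.comp (h1.comp Primrec.fst) (h2.comp Primrec.snd))
      (Primrec.nat_add.comp (h1.comp Primrec.snd) (h2.comp Primrec.fst))

theorem primrec_two_pow : Primrec fun n : ℕ => (2 : ℤ) ^ n := by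
  have h : Primrec fun n : ℕ => (2 ^ n : ℕ) := by
    refine (Primrec.nat_rec₁ (f := fun _ b => 2 * b) 1
      (Primrec.nat_double.comp Primrec.snd).to₂).of_eq fun n => ?_
    induction n with
    | zero => rfl
    | succ n ih => simp only [ih, pow_succ]; ring
  refine (primrec_natCast_sub.comp h (Primrec.const 0)).of_eq fun n => ?_
  push_cast; ring

/-- Addition of dyadic codes. -/
def dAdd (a b : DyadicCode) : DyadicCode := (a.1 * 2 ^ b.2 + b.1 * 2 ^ a.2, a.2 + b.2)

/-- Multiplication of dyadic codes. -/
def dMul (a b : DyadicCode) : DyadicCode := (a.1 * b.1, a.2 + b.2)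

/-- Negation of dyadic codes. -/
def dNeg (a : DyadicCode) : DyadicCode := (-a.1, a.2)

/-- Powers of dyadic codes. -/
def dPow (a : DyadicCode) (n : ℕ) : DyadicCode := Nat.rec ((1, 0) : DyadicCode) (fun _ x => dMul x a) n

/-- The code of `2 ^ (-n)`. -/
def dEps (n : ℕ) : DyadicCode := (1, n)

@[simp] theorem dyadicVal_dAdd (a b : DyadicCode) :
    dyadicVal (dAdd a b) = dyadicVal a + dyadicVal b := by
  simp only [dyadicVal, dAdd]; push_cast; field_simp; ring

@[simp] theorem dyadicVal_dMul (a b : DyadicCode) :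
    dyadicVal (dMul a b) = dyadicVal a * dyadicVal b := by
  simp only [dyadicVal, dMul]; push_cast; field_simp; ring

@[simp] theorem dyadicVal_dNeg (a : DyadicCode) : dyadicVal (dNeg a) = -dyadicVal a := by
  simp only [dyadicVal, dNeg]; push_cast; ring

@[simp] theorem dyadicVal_dPow (a : DyadicCode) (n : ℕ) :
    dyadicVal (dPow a n) = dyadicVal a ^ n := by
  induction n with
  | zero => simp [dPow, dyadicVal]
  | succ n ih =>
    have : dPow a (n + 1) = dMul (dPow a n) a := rfl
    rw [this, dyadicVal_dMul, ih, pow_succ]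

@[simp] theorem dyadicVal_dEps (n : ℕ) : dyadicVal (dEps n) = (1 / 2) ^ n := by
  simp [dyadicVal, dEps]

theorem primrec_dAdd : Primrec₂ dAdd := by
  refine Primrec.pair ?_ (Primrec.nat_add.comp (Primrec.snd.comp Primrec.fst)
    (Primrec.snd.comp Primrec.snd))
  exact primrec_int_add.comp
    (primrec_int_mul.comp (Primrec.fst.comp Primrec.fst)
      (primrec_two_pow.comp (Primrec.snd.comp Primrec.snd)))
    (primrec_int_mul.comp (Primrec.fst.comp Primrec.snd)
      (primrec_two_pow.comp (Primrec.snd.comp Primrec.fst)))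

theorem primrec_dMul : Primrec₂ dMul :=
  Primrec.pair (primrec_int_mul.comp (Primrec.fst.comp Primrec.fst) (Primrec.fst.comp Primrec.snd))
    (Primrec.nat_add.comp (Primrec.snd.comp Primrec.fst) (Primrec.snd.comp Primrec.snd))

theorem primrec_dNeg : Primrec dNeg :=
  Primrec.pair (primrec_int_neg.comp Primrec.fst) Primrec.snd

theorem primrec_dPow : Primrec₂ dPow :=
  Primrec.nat_rec (Primrec.const _)
    (primrec_dMul.comp (Primrec.snd.comp Primrec.snd) Primrec.fst).to₂

theorem primrec_dEps : Primrec dEps := Primrec.pair (Primrec.const 1) Primrec.id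

theorem primrec_dLe : PrimrecRel fun a b : DyadicCode => dyadicVal a ≤ dyadicVal b := by
  refine PrimrecPred.of_eq (p := fun x : DyadicCode × DyadicCode =>
    x.1.1 * 2 ^ x.2.2 ≤ x.2.1 * 2 ^ x.1.2) ?_ fun x => ?_
  · exact primrec_int_le.comp
      (primrec_int_mul.comp (Primrec.fst.comp Primrec.fst)
        (primrec_two_pow.comp (Primrec.snd.comp Primrec.snd)))
      (primrec_int_mul.comp (Primrec.fst.comp Primrec.snd)
        (primrec_two_pow.comp (Primrec.snd.comp Primrec.fst)))
  · change _ ↔ (x.1.1 : ℝ) / 2 ^ x.1.2 ≤ (x.2.1 : ℝ) / 2 ^ x.2.2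
    rw [div_le_div_iff₀ (by positivity) (by positivity)]
    exact_mod_cast Iff.rfl

theorem primrec_dLt : PrimrecRel fun a b : DyadicCode => dyadicVal a < dyadicVal b :=
  (PrimrecPred.not primrec_dLe.swap).of_eq fun _ => not_le

section

variable {α : Type*} [Primcodable α] {f g : α → DyadicCode}

theorem re_dLe (hf : Computable f) (hg : Computable g) :
    REPred fun a => dyadicVal (f a) ≤ dyadicVal (g a) :=
  re_comp₂ (r := fun a b : DyadicCode => dyadicVal a ≤ dyadicVal b) primrec_dLe.rePred hf hg

theorem re_dLt (hf : Computable f) (hg : Computable g) :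
    REPred fun a => dyadicVal (f a) < dyadicVal (g a) :=
  re_comp₂ (r := fun a b : DyadicCode => dyadicVal a < dyadicVal b) primrec_dLt.rePred hf hg

end

/-- The dyadic numbers are dense. -/
theorem exists_dyadic_between {x y : ℝ} (h : x < y) : ∃ d, x < dyadicVal d ∧ dyadicVal d < y := by
  obtain ⟨n, hn⟩ := exists_pow_lt_of_lt_one (sub_pos.2 h) (by norm_num : (1 / 2 : ℝ) < 1)
  refine ⟨(⌊x * 2 ^ n⌋ + 1, n), ?_, ?_⟩
  · rw [dyadicVal, lt_div_iff₀ (by positivity)]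
    push_cast
    exact Int.lt_floor_add_one _
  · rw [dyadicVal, div_lt_iff₀ (by positivity)]
    push_cast
    have h1 := Int.floor_le (x * 2 ^ n)
    have h2 : (1 / 2 : ℝ) ^ n * 2 ^ n = 1 := by rw [← mul_pow]; norm_num
    have h3 : (0 : ℝ) < 2 ^ n := by positivity
    nlinarith

/-! ### From oracle machines to enclosures -/

/-- The list `L` is an initial segment of an oracle for `x`. -/
def Fits (L : List DyadicCode) (x : ℝ) : Prop :=
  ∀ j < L.length, |dyadicVal (L.getD j (0, 0)) - x| < (1 / 2 : ℝ) ^ j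

/-- Every point strictly between `c` and `d` fits the list `L`. -/
def Inside (L : List DyadicCode) (c d : DyadicCode) : Prop :=
  ∀ j < L.length, dyadicVal (dAdd (L.getD j (0, 0)) (dNeg (dEps j))) ≤ dyadicVal c ∧
    dyadicVal d ≤ dyadicVal (dAdd (L.getD j (0, 0)) (dEps j))

/-- On input `n` the machine halts after reading exactly the list `L`, with output `o`. -/
def OracleMachine.Halts (M : OracleMachine) (n : ℕ) (L : List DyadicCode) (o : DyadicCode) :
    Prop :=
  M.step n L = some o ∧ ∀ j < L.length, M.step n (L.take j) = none

theorem Inside.fits {L : List DyadicCode} {c d : DyadicCode} (h : Inside L c d) {x : ℝ}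
    (hc : dyadicVal c < x) (hd : x < dyadicVal d) : Fits L x := by
  intro j hj
  have := h j hj
  simp only [dyadicVal_dAdd, dyadicVal_dNeg, dyadicVal_dEps] at this
  rw [abs_lt]
  constructor <;> linarith

theorem primrec_inside :
    PrimrecPred fun x : List DyadicCode × DyadicCode × DyadicCode => Inside x.1 x.2.1 x.2.2 := by
  have h : PrimrecRel fun (j : ℕ) (x : List DyadicCode × DyadicCode × DyadicCode) =>
      dyadicVal (dAdd (x.1.getD j (0, 0)) (dNeg (dEps j))) ≤ dyadicVal x.2.1 ∧
        dyadicVal x.2.2 ≤ dyadicVal (dAdd (x.1.getD j (0, 0)) (dEps j)) := by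
    have hg : Primrec fun y : ℕ × List DyadicCode × DyadicCode × DyadicCode =>
        y.2.1.getD y.1 (0, 0) :=
      (Primrec.list_getD _).comp (Primrec.fst.comp Primrec.snd) Primrec.fst
    have he : Primrec fun y : ℕ × List DyadicCode × DyadicCode × DyadicCode => dEps y.1 :=
      primrec_dEps.comp Primrec.fst
    exact PrimrecPred.and
      (primrec_dLe.comp (primrec_dAdd.comp hg (primrec_dNeg.comp he))
        (Primrec.fst.comp (Primrec.snd.comp Primrec.snd)))
      (primrec_dLe.comp (Primrec.snd.comp (Primrec.snd.comp Primrec.snd))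
        (primrec_dAdd.comp hg he))
  refine (h.forall_mem_list.comp
    (Primrec.list_range.comp (Primrec.list_length.comp Primrec.fst)) Primrec.id).of_eq fun x => ?_
  simp [Inside]

theorem re_halts (M : OracleMachine) :
    REPred fun x : (ℕ × List DyadicCode) × DyadicCode => M.Halts x.1.1 x.1.2 x.2 := by
  have hs : Computable fun x : ℕ × List DyadicCode => M.step x.1 x.2 := M.computable_step
  let F : ℕ × List DyadicCode → Option DyadicCode := fun x =>
    Nat.rec none (fun j acc => acc <|> M.step x.1 (x.2.take j)) x.2.length
  have hF : Computable F := by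
    refine Computable.nat_rec (Computable.list_length.comp Computable.snd) (Computable.const _)
      (h := fun x y => y.2 <|> M.step x.1 (x.2.take y.1)) ?_
    refine Primrec.option_orElse.to_comp.comp (Computable.snd.comp Computable.snd) ?_
    exact hs.comp ((Computable.fst.comp Computable.fst).pair
      (Primrec.list_take.to_comp.comp (Computable.fst.comp Computable.snd)
        (Computable.snd.comp Computable.fst)))
  have hF' : ∀ x : ℕ × List DyadicCode, F x = none ↔
      ∀ j < x.2.length, M.step x.1 (x.2.take j) = none := by
    intro x
    have : ∀ k, (Nat.rec none (fun j acc => acc <|> M.step x.1 (x.2.take j)) k :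
        Option DyadicCode) = none ↔ ∀ j < k, M.step x.1 (x.2.take j) = none := by
      intro k
      induction k with
      | zero => simp
      | succ k ih =>
        simp only [Option.orElse_eq_none, ih, Nat.lt_succ_iff_lt_or_eq]
        constructor
        · rintro ⟨h1, h2⟩ j (hj | rfl)
          · exact h1 j hj
          · exact h2
        · exact fun h => ⟨fun j hj => h j (.inl hj), h k (.inr rfl)⟩
    exact this _
  have h1 := re_comp (re_graph hs) (f := fun x : (ℕ × List DyadicCode) × DyadicCode =>
    (x.1, some x.2)) (Computable.fst.pair (Computable.option_some.comp Computable.snd))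
  have h2 := re_comp (re_graph hF) (f := fun x : (ℕ × List DyadicCode) × DyadicCode =>
    (x.1, (none : Option DyadicCode))) (Computable.fst.pair (Computable.const _))
  refine (re_and h1 h2).of_eq fun x => ?_
  rw [hF']
  rfl

theorem OracleMachine.Halts.exists_outputs {M : OracleMachine} {n : ℕ} {L : List DyadicCode}
    {o : DyadicCode} (h : M.Halts n L o) {x : ℝ} (hx : Fits L x) :
    ∃ φ, IsOracle φ x ∧ M.Outputs φ n o := by
  have hap : ∀ n : ℕ, ∃ d, |dyadicVal d - x| < (1 / 2 : ℝ) ^ n := by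
    intro n
    have hp : (0 : ℝ) < (1 / 2) ^ n := by positivity
    obtain ⟨d, h1, h2⟩ := exists_dyadic_between (show x < x + (1 / 2) ^ n by linarith)
    exact ⟨d, by rw [abs_lt]; constructor <;> linarith⟩
  choose ψ hψ using hap
  let φ : ℕ → DyadicCode := fun j => if j < L.length then L.getD j (0, 0) else ψ j
  have hφ : ∀ k ≤ L.length, (List.range k).map φ = L.take k := by
    intro k hk
    refine List.ext_getElem (by simp [hk]) fun j h1 h2 => ?_
    have hj : j < L.length := by simp at h1; omega
    simp [φ, hj]
  refine ⟨φ, fun j => ?_, L.length, ?_, fun j hj => ?_⟩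
  · by_cases hj : j < L.length
    · simpa [φ, hj] using hx j hj
    · simpa [φ, hj] using hψ j
  · rw [hφ _ le_rfl, List.take_length, h.1]
  · rw [hφ _ hj.le, h.2 j hj]

theorem OracleMachine.Outputs.exists_halts {M : OracleMachine} {n : ℕ} {φ : ℕ → DyadicCode}
    {o : DyadicCode} (h : M.Outputs φ n o) {x : ℝ} (hx : IsOracle φ x) :
    ∃ L c d, M.Halts n L o ∧ Inside L c d ∧ dyadicVal c < x ∧ x < dyadicVal d := by
  obtain ⟨k, h1, h2⟩ := h
  let L := (List.range k).map φ
  have hlen : L.length = k := by simp [L]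
  have hget : ∀ j < k, L.getD j (0, 0) = φ j := by
    intro j hj
    simp [L, hj]
  have hev : ∀ᶠ y in 𝓝 x, ∀ j ∈ Finset.range k, |dyadicVal (φ j) - y| < (1 / 2 : ℝ) ^ j := by
    rw [Filter.eventually_all_finset]
    intro j _
    have hc : Tendsto (fun y => |dyadicVal (φ j) - y|) (𝓝 x) (𝓝 |dyadicVal (φ j) - x|) :=
      (Continuous.tendsto (by fun_prop) x)
    exact hc.eventually_lt_const (hx j)
  obtain ⟨ε, hε, hb⟩ := Metric.eventually_nhds_iff.1 hev
  obtain ⟨c, hc1, hc2⟩ := exists_dyadic_between (show x - ε < x by linarith)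
  obtain ⟨d, hd1, hd2⟩ := exists_dyadic_between (show x < x + ε by linarith)
  refine ⟨L, c, d, ⟨h1, fun j hj => ?_⟩, fun j hj => ?_, hc2, hd1⟩
  · rw [hlen] at hj
    rw [← h2 j hj, ← List.map_take, List.take_range, min_eq_left hj.le]
  · rw [hlen] at hj
    have e1 := abs_lt.1 (hb (y := dyadicVal c) (by rw [Real.dist_eq, abs_lt]; constructor <;> linarith)
      j (Finset.mem_range.2 hj))
    have e2 := abs_lt.1 (hb (y := dyadicVal d) (by rw [Real.dist_eq, abs_lt]; constructor <;> linarith)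
      j (Finset.mem_range.2 hj))
    simp only [dyadicVal_dAdd, dyadicVal_dNeg, dyadicVal_dEps, hget j hj]
    constructor <;> linarith

theorem OracleMachine.Outputs.unique {M : OracleMachine} {φ : ℕ → DyadicCode} {n : ℕ}
    {d d' : DyadicCode} (h : M.Outputs φ n d) (h' : M.Outputs φ n d') : d = d' := by
  obtain ⟨k, h1, h2⟩ := h
  obtain ⟨k', h1', h2'⟩ := h'
  rcases lt_trichotomy k k' with hk | rfl | hk
  · have := h2' k hk
    simp [h1] at this
  · simpa [h1] using h1'
  · have := h2 k' hk
    simp [h1'] at this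

theorem exists_isOracle (x : ℝ) : ∃ φ, IsOracle φ x := by
  have hap : ∀ n : ℕ, ∃ d, |dyadicVal d - x| < (1 / 2 : ℝ) ^ n := by
    intro n
    have hp : (0 : ℝ) < (1 / 2) ^ n := by positivity
    obtain ⟨d, h1, h2⟩ := exists_dyadic_between (show x < x + (1 / 2) ^ n by linarith)
    exact ⟨d, by rw [abs_lt]; constructor <;> linarith⟩
  choose ψ hψ using hap
  exact ⟨ψ, hψ⟩

/-- `E c d a b` certifies that `f` maps the part of `A` between the dyadic numbers `c` and `d`
into the interval between `a` and `b`. -/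
structure Enclosure (f : ℝ → ℝ) (A : Set ℝ)
    (E : DyadicCode → DyadicCode → DyadicCode → DyadicCode → Prop) : Prop where
  re : REPred fun x : (DyadicCode × DyadicCode) × DyadicCode × DyadicCode =>
    E x.1.1 x.1.2 x.2.1 x.2.2
  sound : ∀ x ∈ A, ∀ c d a b, E c d a b → dyadicVal c < x → x < dyadicVal d →
    dyadicVal a < f x ∧ f x < dyadicVal b
  complete : ∀ x ∈ A, ∀ a b, dyadicVal a < f x → f x < dyadicVal b →
    ∃ c d, E c d a b ∧ dyadicVal c < x ∧ x < dyadicVal d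

/-- `E c d a` certifies that `f` is greater than `a` on the part of `A` between the dyadic
numbers `c` and `d`. -/
structure LowerEnclosure (f : ℝ → ℝ) (A : Set ℝ)
    (E : DyadicCode → DyadicCode → DyadicCode → Prop) : Prop where
  re : REPred fun x : (DyadicCode × DyadicCode) × DyadicCode => E x.1.1 x.1.2 x.2
  sound : ∀ x ∈ A, ∀ c d a, E c d a → dyadicVal c < x → x < dyadicVal d → dyadicVal a < f x
  complete : ∀ x ∈ A, ∀ a, dyadicVal a < f x → ∃ c d, E c d a ∧ dyadicVal c < x ∧ x < dyadicVal d

theorem ComputableOn.exists_enclosure {f : ℝ → ℝ} {A : Set ℝ} (h : ComputableOn f A) :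
    ∃ E, Enclosure f A E := by
  obtain ⟨M, hM⟩ := h
  refine ⟨fun c d a b => ∃ y : (ℕ × List DyadicCode) × DyadicCode, M.Halts y.1.1 y.1.2 y.2 ∧
    Inside y.1.2 c d ∧ dyadicVal a ≤ dyadicVal (dAdd y.2 (dNeg (dEps y.1.1))) ∧
    dyadicVal (dAdd y.2 (dEps y.1.1)) ≤ dyadicVal b, ?_, ?_, ?_⟩
  · refine re_exists₂ (re_and (re_comp (re_halts M) Computable.snd) (PrimrecPred.rePred ?_))
    have h1 : Primrec fun x : ((DyadicCode × DyadicCode) × DyadicCode × DyadicCode) ×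
        (ℕ × List DyadicCode) × DyadicCode => x.2.2 := Primrec.snd.comp Primrec.snd
    have h2 : Primrec fun x : ((DyadicCode × DyadicCode) × DyadicCode × DyadicCode) ×
        (ℕ × List DyadicCode) × DyadicCode => dEps x.2.1.1 :=
      primrec_dEps.comp (Primrec.fst.comp (Primrec.fst.comp Primrec.snd))
    refine (primrec_inside.comp ((Primrec.snd.comp (Primrec.fst.comp Primrec.snd)).pair
      (Primrec.fst.comp Primrec.fst))).and (PrimrecPred.and ?_ ?_)
    · exact primrec_dLe.comp (Primrec.fst.comp (Primrec.snd.comp Primrec.fst))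
        (primrec_dAdd.comp h1 (primrec_dNeg.comp h2))
    · exact primrec_dLe.comp (primrec_dAdd.comp h1 h2)
        (Primrec.snd.comp (Primrec.snd.comp Primrec.fst))
  · rintro x hx c d a b ⟨⟨⟨n, L⟩, o⟩, hh, hi, ha, hb⟩ hc hd
    obtain ⟨φ, hφ, ho⟩ := hh.exists_outputs (hi.fits hc hd)
    obtain ⟨o', ho', hlt⟩ := hM x hx φ hφ n
    obtain rfl := ho.unique ho'
    simp only [dyadicVal_dAdd, dyadicVal_dNeg, dyadicVal_dEps] at ha hb
    rw [abs_lt] at hlt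
    constructor <;> linarith
  · intro x hx a b ha hb
    obtain ⟨n, hn⟩ := exists_pow_lt_of_lt_one
      (show 0 < min (f x - dyadicVal a) (dyadicVal b - f x) / 2 from
        half_pos (lt_min (by linarith) (by linarith))) (by norm_num : (1 / 2 : ℝ) < 1)
    obtain ⟨φ, hφ⟩ := exists_isOracle x
    obtain ⟨o, ho, hlt⟩ := hM x hx φ hφ n
    obtain ⟨L, c, d, h1, h2, h3, h4⟩ := ho.exists_halts hφ
    refine ⟨c, d, ⟨((n, L), o), h1, h2, ?_, ?_⟩, h3, h4⟩ <;>
      simp only [dyadicVal_dAdd, dyadicVal_dNeg, dyadicVal_dEps] <;>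
      rw [abs_lt] at hlt
    · linarith [min_le_left (f x - dyadicVal a) (dyadicVal b - f x)]
    · linarith [min_le_right (f x - dyadicVal a) (dyadicVal b - f x)]

theorem LeftComputableOn.exists_lowerEnclosure {f : ℝ → ℝ} {A : Set ℝ}
    (h : LeftComputableOn f A) : ∃ E, LowerEnclosure f A E := by
  obtain ⟨M, hM⟩ := h
  refine ⟨fun c d a => ∃ y : (ℕ × List DyadicCode) × DyadicCode, M.Halts y.1.1 y.1.2 y.2 ∧
    Inside y.1.2 c d ∧ dyadicVal a < dyadicVal y.2, ?_, ?_, ?_⟩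
  · refine re_exists₂ (re_and (re_comp (re_halts M) Computable.snd) (PrimrecPred.rePred ?_))
    exact (primrec_inside.comp ((Primrec.snd.comp (Primrec.fst.comp Primrec.snd)).pair
      (Primrec.fst.comp Primrec.fst))).and
      (primrec_dLt.comp (Primrec.snd.comp Primrec.fst) (Primrec.snd.comp Primrec.snd))
  · rintro x hx c d a ⟨⟨⟨n, L⟩, o⟩, hh, hi, ha⟩ hc hd
    obtain ⟨φ, hφ, ho⟩ := hh.exists_outputs (hi.fits hc hd)
    obtain ⟨s, hs, hmono, hlim⟩ := hM x hx φ hφ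
    obtain rfl := ho.unique (hs n)
    exact lt_of_lt_of_le ha (hmono.ge_of_tendsto hlim n)
  · intro x hx a ha
    obtain ⟨φ, hφ⟩ := exists_isOracle x
    obtain ⟨s, hs, hmono, hlim⟩ := hM x hx φ hφ
    obtain ⟨n, hn⟩ := (hlim.eventually_const_lt ha).exists
    obtain ⟨L, c, d, h1, h2, h3, h4⟩ := (hs n).exists_halts hφ
    exact ⟨c, d, ⟨((n, L), s n), h1, h2, hn⟩, h3, h4⟩

/-! ### Recursively enumerable Dedekind cuts -/

section Cuts

variable {α : Type*} [Primcodable α]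

/-- The lower Dedekind cuts of the numbers `f a` are recursively enumerable, uniformly in `a`. -/
def LowerRE (f : α → ℝ) : Prop := REPred fun x : α × DyadicCode => dyadicVal x.2 < f x.1

/-- The upper Dedekind cuts of the numbers `f a` are recursively enumerable, uniformly in `a`. -/
def UpperRE (f : α → ℝ) : Prop := REPred fun x : α × DyadicCode => f x.1 < dyadicVal x.2

theorem ComputableReal.lower {x : ℝ} (h : ComputableReal x) :
    REPred fun c => dyadicVal c < x := by
  obtain ⟨s, hs, hx⟩ := h
  have h1 : REPred fun c => ∃ y : ℕ × DyadicCode, s y.1 = y.2 ∧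
      dyadicVal (dAdd c (dEps y.1)) ≤ dyadicVal y.2 := by
    have e1 : REPred fun x : DyadicCode × ℕ × DyadicCode => s x.2.1 = x.2.2 :=
      re_comp (re_graph hs) (f := fun x : DyadicCode × ℕ × DyadicCode => x.2) Computable.snd
    have e2 : PrimrecPred fun x : DyadicCode × ℕ × DyadicCode =>
        dyadicVal (dAdd x.1 (dEps x.2.1)) ≤ dyadicVal x.2.2 :=
      primrec_dLe.comp (primrec_dAdd.comp Primrec.fst
        (primrec_dEps.comp (Primrec.fst.comp Primrec.snd))) (Primrec.snd.comp Primrec.snd)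
    exact re_exists₂ (re_and e1 e2.rePred)
  refine h1.of_eq fun c => ?_
  constructor
  · rintro ⟨⟨n, e⟩, he, h⟩
    obtain rfl : s n = e := he
    have := abs_lt.1 (hx n)
    simp only [dyadicVal_dAdd, dyadicVal_dEps] at h
    linarith
  · intro hc
    obtain ⟨n, hn⟩ := exists_pow_lt_of_lt_one (half_pos (sub_pos.2 hc))
      (by norm_num : (1 / 2 : ℝ) < 1)
    have h2 := abs_lt.1 (hx n)
    have h3 : dyadicVal (dAdd c (dEps n)) ≤ dyadicVal (s n) := by
      rw [dyadicVal_dAdd, dyadicVal_dEps]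
      linarith
    exact ⟨(n, s n), rfl, h3⟩

theorem ComputableReal.upper {x : ℝ} (h : ComputableReal x) :
    REPred fun c => x < dyadicVal c := by
  obtain ⟨s, hs, hx⟩ := h
  have h1 : ComputableReal (-x) := by
    refine ⟨fun n => dNeg (s n), primrec_dNeg.to_comp.comp hs, fun n => ?_⟩
    rw [dyadicVal_dNeg, ← abs_neg]
    simpa [add_comm, sub_eq_add_neg] using hx n
  refine (re_comp h1.lower primrec_dNeg.to_comp).of_eq fun c => ?_
  rw [dyadicVal_dNeg]
  exact neg_lt_neg_iff

theorem exists_dyadic_enclosure (x : ℝ) (n : ℕ) :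
    ∃ c d, dyadicVal c < x ∧ x < dyadicVal d ∧ dyadicVal d ≤ dyadicVal c + (1 / 2) ^ n := by
  have hp : (0 : ℝ) < (1 / 2) ^ n := by positivity
  obtain ⟨c, hc1, hc2⟩ := exists_dyadic_between (show x - (1 / 2) ^ n / 2 < x by linarith)
  obtain ⟨d, hd1, hd2⟩ := exists_dyadic_between (show x < x + (1 / 2) ^ n / 2 by linarith)
  exact ⟨c, d, hc2, hd1, by linarith⟩

/-- Recursively enumerable families of cuts give uniform dyadic approximations. -/
theorem exists_computable_approx {f : α → ℝ} (hl : LowerRE f) (hu : UpperRE f) :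
    ∃ s : α × ℕ → DyadicCode, Computable s ∧
      ∀ a n, |f a - dyadicVal (s (a, n))| < (1 / 2 : ℝ) ^ n := by
  let p : α × ℕ → DyadicCode → Prop := fun x c => ∃ d, (dyadicVal c < f x.1 ∧ f x.1 < dyadicVal d) ∧
    dyadicVal d ≤ dyadicVal (dAdd c (dEps x.2))
  have hp : REPred fun x : (α × ℕ) × DyadicCode => p x.1 x.2 := by
    refine re_exists₂ (re_and (re_and ?_ ?_) (PrimrecPred.rePred ?_))
    · exact re_comp hl (f := fun y : ((α × ℕ) × DyadicCode) × DyadicCode => (y.1.1.1, y.1.2))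
        (Primrec.to_comp ((Primrec.fst.comp (Primrec.fst.comp Primrec.fst)).pair
          (Primrec.snd.comp Primrec.fst)))
    · exact re_comp hu (f := fun y : ((α × ℕ) × DyadicCode) × DyadicCode => (y.1.1.1, y.2))
        (Primrec.to_comp ((Primrec.fst.comp (Primrec.fst.comp Primrec.fst)).pair Primrec.snd))
    · exact primrec_dLe.comp Primrec.snd (primrec_dAdd.comp (Primrec.snd.comp Primrec.fst)
        (primrec_dEps.comp (Primrec.snd.comp (Primrec.fst.comp Primrec.fst))))
  obtain ⟨s, hs, h⟩ := exists_computable_choice hp fun x => by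
    obtain ⟨c, d, h1, h2, h3⟩ := exists_dyadic_enclosure (f x.1) x.2
    exact ⟨c, d, ⟨h1, h2⟩, by simpa using h3⟩
  refine ⟨s, hs, fun a n => ?_⟩
  obtain ⟨d, ⟨h1, h2⟩, h3⟩ := h (a, n)
  simp only [dyadicVal_dAdd, dyadicVal_dEps] at h3
  rw [abs_lt]
  have hpos : (0 : ℝ) < (1 / 2) ^ n := by positivity
  dsimp only at h1 h2
  constructor <;> linarith

/-- One step of a running maximum over an enumerated set: if `m` codes a pair `(x, n)` where `n`
is a witness for `x` being in the set and `x` is larger than `s`, the new value is `x`. -/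
def improve {σ : Type*} [Primcodable σ] (p : σ × ℕ → Bool) (lt : σ × σ → Bool) (m : ℕ) (s : σ) :
    σ :=
  ((Encodable.decode (α := σ × ℕ) m).map
    fun x => bif p x && lt (s, x.1) then x.1 else s).getD s

theorem primrec_improve {σ : Type*} [Primcodable σ] {p : σ × ℕ → Bool} {lt : σ × σ → Bool}
    (hp : Primrec p) (hlt : Primrec lt) : Primrec₂ (improve p lt) := by
  have h1 : Primrec fun x : ℕ × σ => Encodable.decode (α := σ × ℕ) x.1 :=
    Primrec.decode.comp Primrec.fst
  have h2 : Primrec₂ fun (x : ℕ × σ) (y : σ × ℕ) => bif p y && lt (x.2, y.1) then y.1 else x.2 :=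
    Primrec.cond (Primrec.and.comp (hp.comp Primrec.snd)
      (hlt.comp ((Primrec.snd.comp Primrec.fst).pair (Primrec.fst.comp Primrec.snd))))
      (Primrec.fst.comp Primrec.snd) (Primrec.snd.comp Primrec.fst)
  exact Primrec.option_getD.comp (Primrec.option_map h1 h2) Primrec.snd

/-- A real number with a recursively enumerable lower cut is left-computable: take the running
maximum of an enumeration of the cut. -/
theorem leftComputableReal_of_lower {y : ℝ} (h : REPred fun c => dyadicVal c < y) :
    LeftComputableReal y := by
  obtain ⟨R, ⟨hd, hR⟩, h1⟩ := rePred_iff.1 h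
  obtain ⟨c₀, -, hc₀⟩ := exists_dyadic_between (show y - 1 < y by linarith)
  have hlt : PrimrecPred fun x : DyadicCode × DyadicCode => dyadicVal x.1 < dyadicVal x.2 :=
    primrec_dLt
  obtain ⟨hd', hlt⟩ := hlt
  let next : ℕ → DyadicCode → DyadicCode :=
    improve (fun x => decide (R x)) (fun x => decide (dyadicVal x.1 < dyadicVal x.2))
  have next_none : ∀ m s, Encodable.decode (α := DyadicCode × ℕ) m = none → next m s = s := by
    intro m s h
    simp only [next, improve, h, Option.map_none, Option.getD_none]
  have next_some : ∀ m s x, Encodable.decode (α := DyadicCode × ℕ) m = some x → next m s =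
      bif decide (R x) && decide (dyadicVal s < dyadicVal x.1) then x.1 else s := by
    intro m s x h
    simp only [next, improve, h, Option.map_some, Option.getD_some]
    congr
  let a : ℕ → DyadicCode := fun m => Nat.rec c₀ next m
  have ha : Primrec a := Primrec.nat_rec₁ c₀ (primrec_improve hR hlt)
  have hle : ∀ m s, dyadicVal s ≤ dyadicVal (next m s) := by
    intro m s
    cases hc : Encodable.decode (α := DyadicCode × ℕ) m with
    | none => rw [next_none m s hc]
    | some x =>
      rw [next_some m s x hc]
      by_cases hx : R x ∧ dyadicVal s < dyadicVal x.1
      · simp [hx.1, hx.2, hx.2.le]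
      · rw [not_and_or] at hx
        rcases hx with hx | hx <;> simp [hx]
  have hlty : ∀ m, dyadicVal (a m) < y := by
    intro m
    induction m with
    | zero => exact hc₀
    | succ m ih =>
      change dyadicVal (next m (a m)) < y
      cases hc : Encodable.decode (α := DyadicCode × ℕ) m with
      | none => rw [next_none m _ hc]; exact ih
      | some x =>
        rw [next_some m _ x hc]
        by_cases hx : R x
        · by_cases hx' : dyadicVal (a m) < dyadicVal x.1
          · simpa [hx, hx'] using (h1 x.1).2 ⟨x.2, hx⟩
          · simpa [hx'] using ih
        · simpa [hx] using ih
  have hmono : Monotone fun n => dyadicVal (a n) := monotone_nat_of_le_succ fun m => hle m (a m)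
  refine ⟨a, ha.to_comp, hmono, tendsto_order.2 ⟨fun b hb => ?_, fun b hb => ?_⟩⟩
  · obtain ⟨c, hc1, hc2⟩ := exists_dyadic_between hb
    obtain ⟨n, hn⟩ := (h1 c).1 hc2
    have hdec := Encodable.encodek (c, n)
    generalize Encodable.encode (c, n) = m₀ at hdec
    filter_upwards [eventually_ge_atTop (m₀ + 1)] with m hm
    refine hc1.trans_le (le_trans ?_ (hmono hm))
    change _ ≤ dyadicVal (next _ (a _))
    rw [next_some _ _ (c, n) hdec]
    by_cases hx' : dyadicVal (a m₀) < dyadicVal c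
    · simp [hn, hx']
    · rw [decide_eq_false hx']
      simpa using not_lt.1 hx'
  · exact Eventually.of_forall fun m => (hlty m).trans hb

end Cuts

namespace BranchedMap

variable {T : BranchedMap}

/-! ### Branches of the map -/

theorem mem_S {i : ℕ} {x : ℝ} (h : x ∈ T.J i) : x ∈ T.S := mem_iUnion.2 ⟨i, h⟩

theorem Lam.iterate {x : ℝ} (h : x ∈ T.Lam) (n : ℕ) : T.G^[n] x ∈ T.Lam := fun j => by
  rw [← Function.iterate_add_apply]; exact h _

theorem Lam.map {x : ℝ} (h : x ∈ T.Lam) : T.G x ∈ T.Lam := Lam.iterate h 1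

theorem isOpen_S : IsOpen T.S := isOpen_iUnion fun _ => isOpen_Ioo

namespace Admissible

variable (hT : T.Admissible)
include hT

theorem S_nonempty : T.S.Nonempty := by
  obtain ⟨x, hx⟩ := nonempty_Ioo.2 (hT.lt 0)
  exact ⟨x, mem_S (i := 0) hx⟩

theorem bddBelow : BddBelow T.S := ⟨0, fun _ hx => (hT.subset hx).1.le⟩

theorem bddAbove : BddAbove T.S := ⟨1, fun _ hx => (hT.subset hx).2.le⟩

theorem J_nonempty (i : ℕ) : (T.J i).Nonempty := nonempty_Ioo.2 (hT.lt i)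

theorem pos {x : ℝ} (hx : x ∈ T.S) : 0 < x := (hT.subset hx).1

theorem lt_one {x : ℝ} (hx : x ∈ T.S) : x < 1 := (hT.subset hx).2

theorem r_le_ℓ {i j : ℕ} (h : i < j) : T.r j ≤ T.ℓ i := by
  by_contra hlt
  rw [not_le] at hlt
  obtain ⟨x, hx1, hx2⟩ := exists_between (lt_min hlt (hT.lt i))
  rw [lt_min_iff] at hx2
  exact disjoint_left.1 (hT.disjoint h.ne) (show x ∈ T.J i from ⟨hx1, hx2.2⟩)
    ⟨(hT.anti h).trans hx1, hx2.1⟩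

theorem s₀_lt_of_mem {x : ℝ} (hx : x ∈ T.S) : T.s₀ < x := by
  obtain ⟨i, hi⟩ := mem_iUnion.1 hx
  obtain ⟨y, hy1, hy2⟩ := exists_between hi.1
  exact (csInf_le hT.bddBelow (mem_S (i := i) ⟨hy1, hy2.trans hi.2⟩)).trans_lt hy2

theorem lt_s₁_of_mem {x : ℝ} (hx : x ∈ T.S) : x < T.s₁ := by
  obtain ⟨i, hi⟩ := mem_iUnion.1 hx
  obtain ⟨y, hy1, hy2⟩ := exists_between hi.2
  exact hy1.trans_le (le_csSup hT.bddAbove (mem_S (i := i) ⟨hi.1.trans hy1, hy2⟩))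

theorem S_subset {x : ℝ} (hx : x ∈ T.S) : x ∈ Ioo T.s₀ T.s₁ :=
  ⟨hT.s₀_lt_of_mem hx, hT.lt_s₁_of_mem hx⟩

theorem s₀_nonneg : 0 ≤ T.s₀ := le_csInf hT.S_nonempty fun _ hx => (hT.pos hx).le

theorem s₀_lt_ℓ (i : ℕ) : T.s₀ < T.ℓ i := by
  obtain ⟨x, hx⟩ := hT.J_nonempty (i + 1)
  exact (hT.s₀_lt_of_mem (mem_S hx)).trans (hx.2.trans_le (hT.r_le_ℓ i.lt_succ_self))

theorem ℓ_pos (i : ℕ) : 0 < T.ℓ i := hT.s₀_nonneg.trans_lt (hT.s₀_lt_ℓ i)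

theorem s₁_eq : T.s₁ = T.r 0 := by
  refine csSup_eq_of_forall_le_of_forall_lt_exists_gt hT.S_nonempty (fun x hx => ?_) fun w hw => ?_
  · obtain ⟨i, hi⟩ := mem_iUnion.1 hx
    rcases Nat.eq_zero_or_pos i with rfl | h
    · exact hi.2.le
    · exact hi.2.le.trans ((hT.r_le_ℓ h).trans (hT.lt 0).le)
  · obtain ⟨y, hy1, hy2⟩ := exists_between (max_lt hw (hT.lt 0))
    rw [max_lt_iff] at hy1
    exact ⟨y, mem_S (i := 0) ⟨hy1.2, hy2⟩, hy1.1⟩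

theorem ℓ_lt_s₁ (i : ℕ) : T.ℓ i < T.s₁ := by
  obtain ⟨x, hx⟩ := hT.J_nonempty i
  exact hx.1.trans (hT.lt_s₁_of_mem (mem_S hx))

theorem exists_r_lt {e : ℝ} (he : T.s₀ < e) : ∃ N, ∀ i, N ≤ i → T.r i < e := by
  obtain ⟨x, hx, hxe⟩ := exists_lt_of_csInf_lt hT.S_nonempty he
  obtain ⟨i, hi⟩ := mem_iUnion.1 hx
  exact ⟨i + 1, fun j hj => (hT.r_le_ℓ (Nat.lt_of_succ_le hj)).trans_lt (hi.1.trans hxe)⟩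

theorem hasDerivAt {x : ℝ} (hx : x ∈ T.S) : HasDerivAt T.G (deriv T.G x) x :=
  ((hT.contDiff.differentiableOn (by norm_num)).differentiableAt
    (isOpen_S.mem_nhds hx)).hasDerivAt

theorem continuousOn_S : ContinuousOn T.G T.S := hT.contDiff.continuousOn

theorem continuousOn_J (i : ℕ) : ContinuousOn T.G (T.J i) :=
  hT.continuousOn_S.mono fun _ h => mem_S h

theorem map_mem {i : ℕ} {x : ℝ} (hx : x ∈ T.J i) : T.G x ∈ Ioo T.s₀ T.s₁ := by
  rw [← hT.image i]; exact mem_image_of_mem _ hx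

theorem exists_slope {i : ℕ} {x y : ℝ} (hx : x ∈ T.J i) (hy : y ∈ T.J i) :
    ∃ ξ ∈ T.J i, |T.G x - T.G y| = |deriv T.G ξ| * |x - y| := by
  wlog hxy : x ≤ y generalizing x y
  · obtain ⟨ξ, h1, h2⟩ := this hy hx (not_le.1 hxy).le
    exact ⟨ξ, h1, by rw [abs_sub_comm, h2, abs_sub_comm y]⟩
  rcases hxy.eq_or_lt with rfl | hlt
  · exact ⟨x, hx, by simp⟩
  · have hsub : Icc x y ⊆ T.J i := fun z hz => ⟨hx.1.trans_le hz.1, hz.2.trans_lt hy.2⟩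
    obtain ⟨ξ, h1, h2⟩ := exists_hasDerivAt_eq_slope T.G (deriv T.G) hlt
      ((hT.continuousOn_J i).mono hsub) fun z hz => hT.hasDerivAt (mem_S (hsub ⟨hz.1.le, hz.2.le⟩))
    refine ⟨ξ, hsub ⟨h1.1.le, h1.2.le⟩, ?_⟩
    rw [h2, abs_sub_comm, abs_sub_comm x, ← abs_mul, div_mul_cancel₀ _ (sub_pos.2 hlt).ne']

theorem abs_sub_le {i : ℕ} {x y : ℝ} (hx : x ∈ T.J i) (hy : y ∈ T.J i) :
    |x - y| ≤ |T.G x - T.G y| := by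
  obtain ⟨ξ, h1, h2⟩ := hT.exists_slope hx hy
  rw [h2]
  exact le_mul_of_one_le_left (abs_nonneg _) (hT.one_lt ξ (mem_S h1)).le

theorem injOn (i : ℕ) : InjOn T.G (T.J i) := by
  intro x hx y hy h
  have := hT.abs_sub_le hx hy
  rw [h, sub_self, abs_zero] at this
  exact sub_eq_zero.1 (abs_nonpos_iff.1 this)

theorem strictMonoOn_or_strictAntiOn (i : ℕ) :
    StrictMonoOn T.G (T.J i) ∨ StrictAntiOn T.G (T.J i) :=
  ContinuousOn.strictMonoOn_of_injOn_Ioo (hT.lt i) (hT.continuousOn_J i) (hT.injOn i)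

theorem inv_mem (i : ℕ) {z : ℝ} (hz : z ∈ Ioo T.s₀ T.s₁) : T.inv i z ∈ T.J i := by
  rw [← hT.image i] at hz
  exact Function.invFunOn_mem hz

theorem map_inv (i : ℕ) {z : ℝ} (hz : z ∈ Ioo T.s₀ T.s₁) : T.G (T.inv i z) = z := by
  rw [← hT.image i] at hz
  exact Function.invFunOn_eq hz

theorem eq_inv {i : ℕ} {x : ℝ} (hx : x ∈ T.J i) : x = T.inv i (T.G x) :=
  hT.injOn i hx (hT.inv_mem i (hT.map_mem hx)) (hT.map_inv i (hT.map_mem hx)).symm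

theorem abs_inv_sub_le (i : ℕ) {z w : ℝ} (hz : z ∈ Ioo T.s₀ T.s₁) (hw : w ∈ Ioo T.s₀ T.s₁) :
    |T.inv i z - T.inv i w| ≤ |z - w| := by
  have := hT.abs_sub_le (hT.inv_mem i hz) (hT.inv_mem i hw)
  rwa [hT.map_inv i hz, hT.map_inv i hw] at this

/-- The first branch has a fixed point. -/
theorem exists_fixedPoint : ∃ p ∈ T.J 0, T.G p = p := by
  obtain ⟨m, hm⟩ := hT.J_nonempty 0
  obtain ⟨c, hc, hcm⟩ : ∃ c ∈ T.J 0, T.G c = m :=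
    ⟨_, hT.inv_mem 0 (hT.S_subset (mem_S hm)), hT.map_inv 0 (hT.S_subset (mem_S hm))⟩
  -- one of `m`, `c` lies below its image, the other one above
  obtain ⟨a, b, ha, hb, h1, h2⟩ : ∃ a b, a ∈ T.J 0 ∧ b ∈ T.J 0 ∧ a ≤ T.G a ∧ T.G b ≤ b := by
    rcases le_total c m with h | h
    · exact ⟨c, m, hc, hm, by rwa [hcm], (hT.decreasing.antitoneOn hc hm h).trans (hcm.trans_le le_rfl)⟩
    · exact ⟨m, c, hm, hc, hcm.symm.le.trans (hT.decreasing.antitoneOn hm hc h), by rwa [hcm]⟩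
  obtain ⟨p, hp, h⟩ := isPreconnected_Ioo.intermediate_value₂ (s := T.J 0) ha hb continuousOn_id
    (hT.continuousOn_J 0) h1 h2
  exact ⟨p, hp, h.symm⟩

end Admissible

/-! ### Points with the same leading digits -/

/-- The expansions of `x` and `y` have the same first `n` digits. -/
def SameDigits (T : BranchedMap) (n : ℕ) (x y : ℝ) : Prop :=
  ∀ j < n, ∃ i, T.G^[j] x ∈ T.J i ∧ T.G^[j] y ∈ T.J i

theorem SameDigits.symm {n : ℕ} {x y : ℝ} (h : T.SameDigits n x y) : T.SameDigits n y x :=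
  fun j hj => let ⟨i, h1, h2⟩ := h j hj; ⟨i, h2, h1⟩

theorem SameDigits.mono {m n : ℕ} {x y : ℝ} (h : T.SameDigits n x y) (hmn : m ≤ n) :
    T.SameDigits m x y := fun j hj => h j (hj.trans_le hmn)

theorem SameDigits.iterate {m n k : ℕ} {x y : ℝ} (h : T.SameDigits n x y) (hk : k + m ≤ n) :
    T.SameDigits m (T.G^[k] x) (T.G^[k] y) := fun j hj => by
  rw [← Function.iterate_add_apply, ← Function.iterate_add_apply]
  exact h (j + k) (by omega)

theorem minExp_le {i k : ℕ} {x : ℝ} (hx : x ∈ T.iterDom i k) :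
    T.minExp i k ≤ |deriv T.G^[k] x| :=
  csInf_le ⟨0, by rintro _ ⟨y, _, rfl⟩; exact abs_nonneg _⟩ (mem_image_of_mem _ hx)

namespace Admissible

variable (hT : T.Admissible)
include hT

theorem mem_uIcc_map {i : ℕ} {x y z : ℝ} (hx : x ∈ T.J i) (hy : y ∈ T.J i) (hz : z ∈ uIcc x y) :
    z ∈ T.J i ∧ T.G z ∈ uIcc (T.G x) (T.G y) := by
  have hsub : uIcc x y ⊆ T.J i := ordConnected_Ioo.uIcc_subset hx hy
  have hzJ := hsub hz
  refine ⟨hzJ, ?_⟩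
  rcases hT.strictMonoOn_or_strictAntiOn i with h | h
  · rcases mem_uIcc.1 hz with ⟨h1, h2⟩ | ⟨h1, h2⟩
    · exact mem_uIcc.2 (.inl ⟨h.monotoneOn hx hzJ h1, h.monotoneOn hzJ hy h2⟩)
    · exact mem_uIcc.2 (.inr ⟨h.monotoneOn hy hzJ h1, h.monotoneOn hzJ hx h2⟩)
  · rcases mem_uIcc.1 hz with ⟨h1, h2⟩ | ⟨h1, h2⟩
    · exact mem_uIcc.2 (.inr ⟨h.antitoneOn hzJ hy h2, h.antitoneOn hx hzJ h1⟩)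
    · exact mem_uIcc.2 (.inl ⟨h.antitoneOn hzJ hx h2, h.antitoneOn hy hzJ h1⟩)

theorem mem_uIcc_iterate {n : ℕ} {x y z : ℝ} (h : T.SameDigits n x y) (hz : z ∈ uIcc x y) :
    ∀ j ≤ n, T.G^[j] z ∈ uIcc (T.G^[j] x) (T.G^[j] y) := by
  intro j hj
  induction j with
  | zero => exact hz
  | succ j ih =>
    obtain ⟨i, h1, h2⟩ := h j hj
    simp only [Function.iterate_succ_apply']
    exact (hT.mem_uIcc_map h1 h2 (ih (by omega))).2

theorem hasDerivAt_iterate {k : ℕ} {x : ℝ} (h : ∀ j < k, T.G^[j] x ∈ T.S) :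
    ∃ d, HasDerivAt T.G^[k] d x ∧ 1 ≤ |d| := by
  induction k with
  | zero => exact ⟨1, by simpa using hasDerivAt_id x, by simp⟩
  | succ k ih =>
    obtain ⟨d, h1, h2⟩ := ih fun j hj => h j (by omega)
    refine ⟨deriv T.G (T.G^[k] x) * d, ?_, ?_⟩
    · rw [Function.iterate_succ']
      exact (hT.hasDerivAt (h k (by omega))).comp x h1
    · rw [abs_mul]
      exact one_le_mul_of_one_le_of_one_le (hT.one_lt _ (h k (by omega))).le h2

theorem one_le_minExp {i k : ℕ} (hne : (T.iterDom i k).Nonempty) : 1 ≤ T.minExp i k := by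
  refine le_csInf (hne.image _) ?_
  rintro _ ⟨x, hx, rfl⟩
  obtain ⟨d, h1, h2⟩ := hT.hasDerivAt_iterate hx.2
  simpa only [h1.deriv] using h2

/-- The expansion hypothesis for one step, in the form of a contraction estimate. -/
theorem exists_abs_sub_le_ℓ : ∃ σ : ℝ, 0 < σ ∧ ∀ i, ∀ x ∈ T.J i, ∀ y ∈ T.J i,
    |x - y| ≤ T.ℓ i * σ * |T.G x - T.G y| := by
  obtain ⟨τ, σ, κ, hτ, hσ, hκ, h⟩ := hT.expansion
  refine ⟨σ, by linarith, fun i x hx y hy => ?_⟩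
  obtain ⟨ξ, h1, h2⟩ := hT.exists_slope hx hy
  have hξ : ξ ∈ T.iterDom i 1 := ⟨h1, fun j hj => by
    obtain rfl : j = 0 := by omega
    exact mem_S h1⟩
  have h3 := hT.one_le_minExp ⟨ξ, hξ⟩
  have h4 := minExp_le hξ
  rw [Function.iterate_one] at h4
  have h5 := (h i).1
  have h6 : 1 ≤ T.ℓ i * σ * |deriv T.G ξ| := by
    rw [inv_lt_iff_one_lt_mul₀ (by linarith)] at h5
    calc (1 : ℝ) ≤ T.minExp i 1 * (T.ℓ i * σ) := by linarith
      _ ≤ |deriv T.G ξ| * (T.ℓ i * σ) :=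
        mul_le_mul_of_nonneg_right h4 (mul_pos (hT.ℓ_pos i) (by linarith)).le
      _ = _ := by ring
  rw [h2, ← mul_assoc]
  exact le_mul_of_one_le_left (abs_nonneg _) h6

/-- Some iterate of the map expands by a definite factor on the cylinders where it is defined. -/
theorem exists_contraction : ∃ (θ : ℝ) (κ : ℕ), 0 < θ ∧ θ < 1 ∧ 1 ≤ κ ∧
    ∀ x y, T.SameDigits κ x y → |x - y| ≤ θ * |T.G^[κ] x - T.G^[κ] y| := by
  obtain ⟨τ, σ, κ, hτ, hσ, hκ, h⟩ := hT.expansion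
  refine ⟨τ⁻¹, κ, by positivity, inv_lt_one_of_one_lt₀ hτ, hκ, fun x y hxy => ?_⟩
  wlog hle : x ≤ y generalizing x y
  · have := this y x hxy.symm (not_le.1 hle).le
    rwa [abs_sub_comm, abs_sub_comm (T.G^[κ] x)]
  rcases hle.eq_or_lt with rfl | hlt
  · simp
  obtain ⟨i, hx, hy⟩ := hxy 0 hκ
  have hdom : ∀ z ∈ Icc x y, z ∈ T.iterDom i κ := by
    intro z hz
    rw [← uIcc_of_le hle] at hz
    refine ⟨(hT.mem_uIcc_map hx hy hz).1, fun j hj => ?_⟩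
    obtain ⟨i', h1, h2⟩ := hxy j hj
    exact mem_S (hT.mem_uIcc_map h1 h2 (hT.mem_uIcc_iterate hxy hz j hj.le)).1
  have hder : ∀ z ∈ Icc x y, HasDerivAt T.G^[κ] (deriv T.G^[κ] z) z := by
    intro z hz
    obtain ⟨d, h1, -⟩ := hT.hasDerivAt_iterate (hdom z hz).2
    rwa [h1.deriv]
  obtain ⟨ξ, h1, h2⟩ := exists_hasDerivAt_eq_slope T.G^[κ] (deriv T.G^[κ]) hlt
    (fun z hz => (hder z hz).continuousAt.continuousWithinAt)
    fun z hz => hder z ⟨hz.1.le, hz.2.le⟩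
  have hξ := hdom ξ ⟨h1.1.le, h1.2.le⟩
  have h3 := hT.one_le_minExp ⟨ξ, hξ⟩
  have h4 := minExp_le hξ
  have h5 := (h i).2
  have hℓ1 : T.ℓ i ≤ 1 := hx.1.le.trans (hT.lt_one (mem_S hx)).le
  have h6 : τ ≤ |deriv T.G^[κ] ξ| := by
    rw [inv_lt_iff_one_lt_mul₀ (by linarith), mul_right_comm, ← div_eq_mul_inv,
      one_lt_div (by linarith)] at h5
    have : T.ℓ i * T.minExp i κ ≤ T.minExp i κ := mul_le_of_le_one_left (by linarith) hℓ1
    linarith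
  have h7 : |T.G^[κ] x - T.G^[κ] y| = |deriv T.G^[κ] ξ| * |x - y| := by
    rw [h2, abs_sub_comm, abs_sub_comm x, ← abs_mul, div_mul_cancel₀ _ (sub_pos.2 hlt).ne']
  rw [h7, ← mul_assoc]
  refine le_mul_of_one_le_left (abs_nonneg _) ?_
  rw [inv_mul_eq_div, one_le_div (by linarith)]
  exact h6

theorem abs_iterate_sub_le_one {x y : ℝ} (hx : x ∈ T.Lam) (hy : y ∈ T.Lam) (j : ℕ) :
    |T.G^[j] x - T.G^[j] y| ≤ 1 := by
  have h1 := hT.pos (hx j)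
  have h2 := hT.lt_one (hx j)
  have h3 := hT.pos (hy j)
  have h4 := hT.lt_one (hy j)
  rw [abs_le]
  constructor <;> linarith

theorem abs_sub_le_pow {θ : ℝ} {κ : ℕ} (hθ : 0 < θ)
    (hc : ∀ x y, T.SameDigits κ x y → |x - y| ≤ θ * |T.G^[κ] x - T.G^[κ] y|) {x y : ℝ}
    (hx : x ∈ T.Lam) (hy : y ∈ T.Lam) {m : ℕ} (h : T.SameDigits (κ * m) x y) :
    |x - y| ≤ θ ^ m := by
  induction m generalizing x y with
  | zero => simpa using hT.abs_iterate_sub_le_one hx hy 0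
  | succ m ih =>
    have h1 := hc x y (h.mono (by rw [mul_add]; omega))
    have h2 := ih (Lam.iterate hx κ) (Lam.iterate hy κ) (h.iterate (by rw [mul_add]; omega))
    rw [pow_succ']
    exact h1.trans (mul_le_mul_of_nonneg_left h2 hθ.le)

/-- Points sharing more and more digits with `x` converge to `x`, together with all iterates. -/
theorem tendsto_iterate {ι : Type*} {l : Filter ι} {z : ι → ℝ} {n : ι → ℕ} {x : ℝ}
    (hx : x ∈ T.Lam) (hz : ∀ k, z k ∈ T.Lam) (hn : Tendsto n l atTop)
    (h : ∀ k, T.SameDigits (n k) x (z k)) (j : ℕ) :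
    Tendsto (fun k => T.G^[j] (z k)) l (𝓝 (T.G^[j] x)) := by
  obtain ⟨θ, κ, h0, h1, hκ, hc⟩ := hT.exists_contraction
  have hb : ∀ k, j ≤ n k → |T.G^[j] (z k) - T.G^[j] x| ≤ θ ^ ((n k - j) / κ) := by
    intro k hk
    refine hT.abs_sub_le_pow h0 hc (Lam.iterate (hz k) j) (Lam.iterate hx j)
      ((h k).symm.iterate ?_)
    have := Nat.mul_div_le (n k - j) κ
    omega
  have hlim : Tendsto (fun k => θ ^ ((n k - j) / κ)) l (𝓝 0) := by
    refine (tendsto_pow_atTop_nhds_zero_of_lt_one h0.le h1).comp ?_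
    refine (Nat.tendsto_div_const_atTop (by omega)).comp ?_
    exact (tendsto_sub_atTop_nat j).comp hn
  rw [tendsto_iff_dist_tendsto_zero]
  refine squeeze_zero' (Eventually.of_forall fun k => dist_nonneg) ?_ hlim
  filter_upwards [hn.eventually_ge_atTop j] with k hk
  exact hb k hk

end Admissible

theorem sum_le_of_contraction {e : ℕ → ℝ} {θ : ℝ} {κ m : ℕ} (hθ0 : 0 < θ) (hθ : θ < 1)
    (h0 : ∀ j, 0 ≤ e j) (h1 : ∀ j, e j ≤ 1) (hc : ∀ j, j + κ < m → e j ≤ θ * e (j + κ)) :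
    ∑ j ∈ Finset.range m, e j ≤ κ / (1 - θ) := by
  rw [le_div_iff₀ (by linarith)]
  have hcard : ∀ k (f : ℕ → ℕ), ∑ j ∈ Finset.range k, e (f j) ≤ k := fun k f =>
    (Finset.sum_le_sum fun j _ => h1 (f j)).trans (by simp)
  have hnn : 0 ≤ ∑ j ∈ Finset.range m, e j := Finset.sum_nonneg fun j _ => h0 j
  rcases le_total m κ with hm | hm
  · have h2 := hcard m id
    have h3 : (m : ℝ) ≤ κ := by exact_mod_cast hm
    simp only [id] at h2
    nlinarith
  · obtain ⟨d, rfl⟩ : ∃ d, m = d + κ := ⟨m - κ, by omega⟩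
    have h2 : ∑ j ∈ Finset.range (d + κ), e j =
        ∑ j ∈ Finset.range d, e j + ∑ j ∈ Finset.range κ, e (d + j) := Finset.sum_range_add _ _ _
    have h3 : ∑ j ∈ Finset.range d, e j ≤ θ * ∑ j ∈ Finset.range d, e (j + κ) := by
      rw [Finset.mul_sum]
      exact Finset.sum_le_sum fun j hj => hc j (by simpa using hj)
    have h4 : ∑ j ∈ Finset.range d, e (j + κ) ≤ ∑ j ∈ Finset.range (d + κ), e j := by
      rw [add_comm d κ, Finset.sum_range_add]
      simp only [add_comm κ]
      exact le_add_of_nonneg_left (Finset.sum_nonneg fun j _ => h0 j)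
    have h5 := hcard κ fun j => d + j
    have h6 := mul_le_mul_of_nonneg_left h4 hθ0.le
    linarith

/-- The product `x · G(x) ⋯ G^(n-1)(x)`. -/
noncomputable def orbitProd (T : BranchedMap) (n : ℕ) (x : ℝ) : ℝ := ∏ j ∈ Finset.range n, T.G^[j] x

theorem orbitProd_add (m n : ℕ) (x : ℝ) :
    T.orbitProd (m + n) x = T.orbitProd m x * T.orbitProd n (T.G^[m] x) := by
  rw [orbitProd, Finset.prod_range_add]
  congr 1
  refine Finset.prod_congr rfl fun j _ => ?_
  rw [← Function.iterate_add_apply, add_comm]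

theorem orbitProd_one (x : ℝ) : T.orbitProd 1 x = x := by simp [orbitProd]

namespace Admissible

variable (hT : T.Admissible)
include hT

theorem orbitProd_pos {x : ℝ} (hx : x ∈ T.Lam) (n : ℕ) : 0 < T.orbitProd n x :=
  Finset.prod_pos fun j _ => hT.pos (hx j)

/-- Bounded distortion: the orbit products of points with the same digits are comparable. The
ratio of the factors number `j` is at most `exp (σ * e j)`, where `e j` is the distance of the next
iterates, and the sum of the `e j` is bounded by contraction. -/
theorem exists_distortion : ∃ K : ℝ, 1 ≤ K ∧ ∀ x ∈ T.Lam, ∀ y ∈ T.Lam, ∀ n,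
    T.SameDigits n x y → T.orbitProd n y ≤ K * T.orbitProd n x := by
  obtain ⟨θ, κ, h0, h1, hκ, hc⟩ := hT.exists_contraction
  obtain ⟨σ, hσ, hℓ⟩ := hT.exists_abs_sub_le_ℓ
  have hK : 0 ≤ σ * (κ / (1 - θ)) := mul_nonneg hσ.le (div_nonneg (by positivity) (by linarith))
  refine ⟨Real.exp (σ * (κ / (1 - θ))), Real.one_le_exp hK, fun x hx y hy n h => ?_⟩
  let e : ℕ → ℝ := fun j => |T.G^[j + 1] x - T.G^[j + 1] y|
  have hsum : ∑ j ∈ Finset.range n, e j ≤ κ / (1 - θ) := by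
    refine sum_le_of_contraction h0 h1 (fun j => abs_nonneg _)
      (fun j => hT.abs_iterate_sub_le_one hx hy _) fun j hj => ?_
    have := hc _ _ (h.iterate (m := κ) (k := j + 1) (by omega))
    simp only [← Function.iterate_add_apply] at this
    rwa [show κ + (j + 1) = j + κ + 1 by ring] at this
  have hfac : ∀ j ∈ Finset.range n, T.G^[j] y ≤ Real.exp (σ * e j) * T.G^[j] x := by
    intro j hj
    obtain ⟨i, hxi, hyi⟩ := h j (Finset.mem_range.1 hj)
    have h2 := hℓ i _ hxi _ hyi
    rw [← Function.iterate_succ_apply' T.G, ← Function.iterate_succ_apply' T.G] at h2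
    have h3 : T.ℓ i * σ * e j ≤ T.G^[j] x * σ * e j := by
      have : 0 ≤ σ * e j := mul_nonneg hσ.le (abs_nonneg _)
      nlinarith [hxi.1]
    have h4 := Real.add_one_le_exp (σ * e j)
    have h5 := hT.pos (mem_S hxi)
    have h6 := neg_abs_le (T.G^[j] x - T.G^[j] y)
    have h7 : T.G^[j] x * (σ * e j + 1) ≤ T.G^[j] x * Real.exp (σ * e j) :=
      mul_le_mul_of_nonneg_left h4 h5.le
    change |T.G^[j] x - T.G^[j] y| ≤ T.ℓ i * σ * e j at h2
    linarith
  calc T.orbitProd n y ≤ ∏ j ∈ Finset.range n, Real.exp (σ * e j) * T.G^[j] x :=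
        Finset.prod_le_prod (fun j _ => (hT.pos (hy j)).le) hfac
    _ = Real.exp (σ * ∑ j ∈ Finset.range n, e j) * T.orbitProd n x := by
        rw [Finset.prod_mul_distrib, ← Real.exp_sum, ← Finset.mul_sum, orbitProd]
    _ ≤ _ := by
        refine mul_le_mul_of_nonneg_right (Real.exp_le_exp.2 ?_) (hT.orbitProd_pos hx n).le
        exact mul_le_mul_of_nonneg_left hsum hσ.le

/-- Since the first branch is decreasing, two successive points of an orbit cannot both be larger
than its fixed point. -/
theorem mul_map_le {p : ℝ} (hp : p ∈ T.J 0) (hpp : T.G p = p) {x : ℝ} (hx : x ∈ T.Lam) :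
    x * T.G x ≤ p := by
  have h0 := hT.pos (hx 0)
  have h1 := hT.lt_one (hx 0)
  have h2 := hT.pos (hx 1)
  have h3 := hT.lt_one (hx 1)
  simp only [Function.iterate_zero, id, Function.iterate_one] at h0 h1 h2 h3
  rcases le_total x p with h | h
  · nlinarith
  · have hxJ : x ∈ T.J 0 := ⟨hp.1.trans_le h, by rw [← hT.s₁_eq]; exact hT.lt_s₁_of_mem (hx 0)⟩
    have := hT.decreasing.antitoneOn hp hxJ h
    rw [hpp] at this
    nlinarith

/-- The orbit products decay exponentially, uniformly on `Λ`: two successive factors contribute at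
most the fixed point of the first branch. -/
theorem exists_orbitProd_le : ∃ q : ℝ, 0 < q ∧ q < 1 ∧ ∀ x ∈ T.Lam, ∀ n,
    T.orbitProd n x ≤ q⁻¹ * q ^ n := by
  obtain ⟨p, hp, hpp⟩ := hT.exists_fixedPoint
  have hp0 := hT.pos (mem_S hp)
  have hp1 := hT.lt_one (mem_S hp)
  have hq0 : 0 < √p := Real.sqrt_pos.2 hp0
  have hq1 : √p < 1 := by rw [Real.sqrt_lt' one_pos]; simpa using hp1
  have hqq : √p * √p = p := Real.mul_self_sqrt hp0.le
  refine ⟨√p, hq0, hq1, fun x hx n => ?_⟩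
  induction n using Nat.twoStepInduction generalizing x with
  | zero => simpa [orbitProd] using (one_le_inv₀ hq0).2 hq1.le
  | one =>
    rw [orbitProd_one, pow_one, inv_mul_cancel₀ hq0.ne']
    exact (hT.lt_one (hx 0)).le
  | more n ih _ =>
    have h2 : T.orbitProd 2 x = x * T.G x := by simp [orbitProd, Finset.prod_range_succ]
    rw [add_comm n 2, orbitProd_add, h2]
    have h3 := hT.mul_map_le hp hpp hx
    have h4 := ih _ (Lam.iterate hx 2)
    have h5 := hT.orbitProd_pos (Lam.iterate hx 2) n
    calc x * T.G x * T.orbitProd n (T.G^[2] x) ≤ p * T.orbitProd n (T.G^[2] x) :=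
          mul_le_mul_of_nonneg_right h3 h5.le
      _ ≤ p * ((√p)⁻¹ * √p ^ n) := mul_le_mul_of_nonneg_left h4 hp0.le
      _ = _ := by rw [pow_add, pow_two, hqq]; ring

end Admissible

/-! ### Points with finitely many prescribed digits -/

/-- The point whose expansion is the word `w` followed by the expansion of `p`. -/
noncomputable def pt (T : BranchedMap) (p : ℝ) : List ℕ → ℝ
  | [] => p
  | i :: w => T.inv i (pt T p w)

namespace Admissible

variable (hT : T.Admissible) {p : ℝ} (hp : p ∈ T.J 0)
include hT hp

theorem pt_mem_Ioo (w : List ℕ) : T.pt p w ∈ Ioo T.s₀ T.s₁ := by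
  induction w with
  | nil => exact hT.S_subset (mem_S hp)
  | cons i w ih => exact hT.S_subset (mem_S (hT.inv_mem i ih))

theorem pt_cons_mem (i : ℕ) (w : List ℕ) : T.pt p (i :: w) ∈ T.J i :=
  hT.inv_mem i (hT.pt_mem_Ioo hp w)

theorem map_pt_cons (i : ℕ) (w : List ℕ) : T.G (T.pt p (i :: w)) = T.pt p w :=
  hT.map_inv i (hT.pt_mem_Ioo hp w)

theorem pt_mem_S (w : List ℕ) : T.pt p w ∈ T.S := by
  cases w with
  | nil => exact mem_S hp
  | cons i w => exact mem_S (hT.pt_cons_mem hp i w)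

theorem iterate_pt_append (w v : List ℕ) : T.G^[w.length] (T.pt p (w ++ v)) = T.pt p v := by
  induction w with
  | nil => rfl
  | cons i w ih =>
    rw [List.length_cons, Function.iterate_succ_apply, List.cons_append, hT.map_pt_cons hp, ih]

theorem sameDigits_pt (w v v' : List ℕ) :
    T.SameDigits w.length (T.pt p (w ++ v)) (T.pt p (w ++ v')) := by
  induction w with
  | nil => exact fun j hj => absurd hj (Nat.not_lt_zero j)
  | cons i w ih =>
    intro j hj
    cases j with
    | zero => exact ⟨i, hT.pt_cons_mem hp i _, hT.pt_cons_mem hp i _⟩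
    | succ j =>
      simp only [List.cons_append, Function.iterate_succ_apply, hT.map_pt_cons hp]
      exact ih j (by simpa using hj)

variable (hpp : T.G p = p)
include hpp

theorem map_pt (w : List ℕ) : T.G (T.pt p w) = T.pt p w.tail := by
  cases w with
  | nil => exact hpp
  | cons i w => exact hT.map_pt_cons hp i w

theorem iterate_pt (n : ℕ) (w : List ℕ) : T.G^[n] (T.pt p w) = T.pt p (w.drop n) := by
  induction n generalizing w with
  | zero => simp
  | succ n ih => rw [Function.iterate_succ_apply, hT.map_pt hp hpp, ih, List.drop_tail]

theorem pt_mem_Lam (w : List ℕ) : T.pt p w ∈ T.Lam := fun n => by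
  rw [hT.iterate_pt hp hpp]; exact hT.pt_mem_S hp _

theorem pt_mem_eventuallyOnes (w : List ℕ) : T.pt p w ∈ T.EventuallyOnes := by
  refine ⟨hT.pt_mem_Lam hp hpp w, w.length, fun l hl => ?_⟩
  rw [hT.iterate_pt hp hpp, List.drop_eq_nil_of_le hl]
  exact hp

theorem pt_append_replicate (w : List ℕ) (m : ℕ) :
    T.pt p (w ++ List.replicate m 0) = T.pt p w := by
  induction w with
  | nil =>
    induction m with
    | zero => rfl
    | succ m ih =>
      rw [List.nil_append] at ih ⊢
      rw [List.replicate_succ]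
      change T.inv 0 (T.pt p _) = p
      rw [ih]
      change T.inv 0 p = p
      conv_lhs => rw [← hpp]
      exact (hT.eq_inv hp).symm
  | cons i w ih => exact congrArg (T.inv i) ih

end Admissible

/-! ### The weight -/

section Weight

variable (hT : T.Admissible) {u : ℝ → ℝ} (hu : T.Weight u)
include hu

theorem Weight.continuousAt {x : ℝ} (hx : x ∈ Ioo T.s₀ T.s₁) : ContinuousAt u x :=
  hu.contDiff.continuousOn.continuousAt (isOpen_Ioo.mem_nhds hx)

include hT

/-- The weight has bounded oscillation on the intervals of the map. -/
theorem Weight.exists_osc : ∃ B : ℝ, 0 < B ∧ ∀ i, ∀ x ∈ T.J i, ∀ y ∈ T.J i, |u x - u y| ≤ B := by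
  obtain ⟨C, hC, hCu⟩ := hu.deriv_lt
  obtain ⟨D, hD⟩ := hT.size
  have hD0 : 0 < D := by
    refine lt_of_le_of_lt ?_ (hD 0)
    exact div_nonneg (sub_nonneg.2 (hT.lt 0).le) (sq_nonneg _)
  refine ⟨C * D, mul_pos hC hD0, fun i x hx y hy => ?_⟩
  have hs : 0 < T.ℓ i - T.s₀ := sub_pos.2 (hT.s₀_lt_ℓ i)
  have h1 : ∀ z ∈ T.J i, ‖deriv u z‖ ≤ C / (T.ℓ i - T.s₀) ^ 2 := by
    intro z hz
    refine (hCu z (hT.S_subset (mem_S hz))).le.trans ?_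
    exact div_le_div_of_nonneg_left hC.le (by positivity)
      (pow_le_pow_left₀ hs.le (by linarith [hz.1]) 2)
  have h2 := Convex.norm_image_sub_le_of_norm_deriv_le
    (fun z hz => (hu.contDiff.differentiableOn (by norm_num)).differentiableAt
      (isOpen_Ioo.mem_nhds (hT.S_subset (mem_S hz)))) h1 (convex_Ioo (T.ℓ i) (T.r i)) hy hx
  have h3 : |x - y| ≤ D * (T.ℓ i - T.s₀) ^ 2 := by
    have h4 := hD i
    rw [div_lt_iff₀ (by positivity)] at h4
    refine le_trans ?_ h4.le
    rw [abs_le]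
    constructor <;> linarith [hx.1, hx.2, hy.1, hy.2]
  rw [Real.norm_eq_abs, Real.norm_eq_abs] at h2
  calc |u x - u y| ≤ C / (T.ℓ i - T.s₀) ^ 2 * |x - y| := h2
    _ ≤ C / (T.ℓ i - T.s₀) ^ 2 * (D * (T.ℓ i - T.s₀) ^ 2) :=
        mul_le_mul_of_nonneg_left h3 (by positivity)
    _ = C * D := by field_simp

theorem Weight.exists_large (M : ℝ) : ∃ N, ∀ x ∈ T.J N, M < u x := by
  have h := hu.tendsto.eventually_gt_atTop M
  rw [eventually_nhdsWithin_iff] at h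
  obtain ⟨ε, hε, hb⟩ := Metric.eventually_nhds_iff.1 h
  obtain ⟨N, hN⟩ := hT.exists_r_lt (show T.s₀ < T.s₀ + ε by linarith)
  refine ⟨N, fun x hx => hb ?_ (hT.s₀_lt_of_mem (mem_S hx))⟩
  rw [Real.dist_eq, abs_lt]
  constructor <;> linarith [hT.s₀_lt_of_mem (mem_S hx), hx.2, hN N le_rfl]

end Weight

/-! ### The generalized Brjuno function as a real series -/

/-- The term number `i` of the series that defines `Phi`. -/
noncomputable def term (T : BranchedMap) (u : ℝ → ℝ) (ν : ℝ) (i : ℕ) (x : ℝ) : ℝ :=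
  T.orbitProd i x ^ ν * u (T.G^[i] x)

/-- The sum of the series that defines `Phi` as a real number; it is `0` where the series
diverges. -/
noncomputable def realPhi (T : BranchedMap) (u : ℝ → ℝ) (ν : ℝ) (x : ℝ) : ℝ :=
  ∑' i, T.term u ν i x

/-- The series that defines `Phi` converges. -/
def Converges (T : BranchedMap) (u : ℝ → ℝ) (ν : ℝ) (x : ℝ) : Prop :=
  Summable fun i => T.term u ν i x

section Series

variable (hT : T.Admissible) {u : ℝ → ℝ} (hu : T.Weight u) {ν : ℝ}
include hT

theorem term_add {x : ℝ} (hx : x ∈ T.Lam) (n i : ℕ) :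
    T.term u ν (n + i) x = T.orbitProd n x ^ ν * T.term u ν i (T.G^[n] x) := by
  rw [term, term, orbitProd_add, Real.mul_rpow (hT.orbitProd_pos hx n).le
    (hT.orbitProd_pos (Lam.iterate hx n) i).le, ← Function.iterate_add_apply, add_comm i n, mul_assoc]

theorem converges_iff_iterate {x : ℝ} (hx : x ∈ T.Lam) (n : ℕ) :
    T.Converges u ν x ↔ T.Converges u ν (T.G^[n] x) := by
  have h0 : T.orbitProd n x ^ ν ≠ 0 := (Real.rpow_pos_of_pos (hT.orbitProd_pos hx n) ν).ne'
  rw [Converges, ← summable_nat_add_iff n]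
  simp only [add_comm _ n, term_add hT hx]
  exact summable_mul_left_iff h0

theorem realPhi_eq_sum_add {x : ℝ} (hx : x ∈ T.Lam) (h : T.Converges u ν x) (n : ℕ) :
    T.realPhi u ν x = ∑ i ∈ Finset.range n, T.term u ν i x +
      T.orbitProd n x ^ ν * T.realPhi u ν (T.G^[n] x) := by
  rw [realPhi, ← Summable.sum_add_tsum_nat_add n h]
  simp only [add_comm _ n, term_add hT hx]
  rw [tsum_mul_left, realPhi]

omit hT in
theorem term_zero (x : ℝ) : T.term u ν 0 x = u x := by simp [term, orbitProd]

theorem realPhi_eq {x : ℝ} (hx : x ∈ T.Lam) (h : T.Converges u ν x) :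
    T.realPhi u ν x = u x + x ^ ν * T.realPhi u ν (T.G x) := by
  simpa [orbitProd_one, term_zero] using realPhi_eq_sum_add hT hx h 1

include hu

theorem term_pos {x : ℝ} (hx : x ∈ T.Lam) (i : ℕ) : 0 < T.term u ν i x :=
  mul_pos (Real.rpow_pos_of_pos (hT.orbitProd_pos hx i) ν) (hu.pos _ (hT.S_subset (hx i)))

theorem realPhi_pos {x : ℝ} (hx : x ∈ T.Lam) (h : T.Converges u ν x) : 0 < T.realPhi u ν x :=
  h.tsum_pos (fun i => (term_pos hT hu hx i).le) 0 (term_pos hT hu hx 0)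

theorem sum_le_realPhi {x : ℝ} (hx : x ∈ T.Lam) (h : T.Converges u ν x) (n : ℕ) :
    ∑ i ∈ Finset.range n, T.term u ν i x ≤ T.realPhi u ν x :=
  h.sum_le_tsum _ fun i _ => (term_pos hT hu hx i).le

theorem phi_eq_ofReal {x : ℝ} (hx : x ∈ T.Lam) (h : T.Converges u ν x) :
    T.Phi u ν x = ENNReal.ofReal (T.realPhi u ν x) :=
  (ENNReal.ofReal_tsum_of_nonneg (fun i => (term_pos hT hu hx i).le) h).symm

theorem converges_iff {x : ℝ} (hx : x ∈ T.Lam) : T.Converges u ν x ↔ T.Phi u ν x < ∞ := by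
  constructor
  · intro h
    rw [phi_eq_ofReal hT hu hx h]
    exact ENNReal.ofReal_lt_top
  · intro h
    have := ENNReal.summable_toReal h.ne
    refine this.congr fun i => ?_
    exact ENNReal.toReal_ofReal (term_pos hT hu hx i).le

theorem toReal_phi {x : ℝ} (hx : x ∈ T.Lam) (h : T.Converges u ν x) :
    (T.Phi u ν x).toReal = T.realPhi u ν x := by
  rw [phi_eq_ofReal hT hu hx h, ENNReal.toReal_ofReal (realPhi_pos hT hu hx h).le]

omit hu in
theorem exists_rpow_orbitProd_le (hν : 0 < ν) : ∃ A ρ : ℝ, 0 < A ∧ 0 < ρ ∧ ρ < 1 ∧ ∀ x ∈ T.Lam, ∀ n,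
    T.orbitProd n x ^ ν ≤ A * ρ ^ n := by
  obtain ⟨q, h0, h1, h⟩ := hT.exists_orbitProd_le
  refine ⟨(q⁻¹) ^ ν, q ^ ν, by positivity, by positivity, Real.rpow_lt_one h0.le h1 hν,
    fun x hx n => ?_⟩
  calc T.orbitProd n x ^ ν ≤ (q⁻¹ * q ^ n) ^ ν :=
        Real.rpow_le_rpow (hT.orbitProd_pos hx n).le (h x hx n) hν.le
    _ = _ := by
        rw [Real.mul_rpow (by positivity) (by positivity), Real.rpow_pow_comm h0.le]

theorem tendsto_term (hν : 0 < ν) {ι : Type*} {l : Filter ι} {z : ι → ℝ} {n : ι → ℕ} {x : ℝ}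
    (hx : x ∈ T.Lam) (hz : ∀ k, z k ∈ T.Lam) (hn : Tendsto n l atTop)
    (h : ∀ k, T.SameDigits (n k) x (z k)) (i : ℕ) :
    Tendsto (fun k => T.term u ν i (z k)) l (𝓝 (T.term u ν i x)) := by
  have h1 := fun j => hT.tendsto_iterate hx hz hn h j
  refine Tendsto.mul ?_ ((hu.continuousAt (hT.S_subset (hx i))).tendsto.comp (h1 i))
  exact (tendsto_finsetProd _ fun j _ => h1 j).rpow_const (.inr hν.le)

/-- If `Phi` is finite at `x`, then the partial sums over the common digits of points sharing more
and more digits with `x` converge to its value at `x`. By bounded distortion and the bounded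
oscillation of the weight, the series for `x` dominates all these sums. -/
theorem tendsto_sum_term (hν : 0 < ν) {ι : Type*} {l : Filter ι} {z : ι → ℝ} {n : ι → ℕ} {x : ℝ}
    (hx : x ∈ T.Lam) (hz : ∀ k, z k ∈ T.Lam) (hn : Tendsto n l atTop)
    (h : ∀ k, T.SameDigits (n k) x (z k)) (hc : T.Converges u ν x) :
    Tendsto (fun k => ∑ i ∈ Finset.range (n k), T.term u ν i (z k)) l (𝓝 (T.realPhi u ν x)) := by
  obtain ⟨K, hK, hdist⟩ := hT.exists_distortion
  obtain ⟨B, hB, hosc⟩ := hu.exists_osc hT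
  obtain ⟨A, ρ, hA, hρ0, hρ1, hP⟩ := exists_rpow_orbitProd_le hT hν
  let f : ι → ℕ → ℝ := fun k i => if i < n k then T.term u ν i (z k) else 0
  have hf : ∀ k, ∑ i ∈ Finset.range (n k), T.term u ν i (z k) = ∑' i, f k i := by
    intro k
    rw [tsum_eq_sum (s := Finset.range (n k))]
    · exact Finset.sum_congr rfl fun i hi => (if_pos (Finset.mem_range.1 hi)).symm
    · exact fun i hi => if_neg fun h => hi (Finset.mem_range.2 h)
  simp only [hf]
  refine tendsto_tsum_of_dominated_convergence
    (bound := fun i => K ^ ν * (T.term u ν i x + B * (A * ρ ^ i))) ?_ (fun i => ?_) ?_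
  · refine (Summable.add hc ?_).mul_left _
    exact ((summable_geometric_of_lt_one hρ0.le hρ1).mul_left A).mul_left B
  · refine (tendsto_term hT hu hν hx hz hn h i).congr' ?_
    filter_upwards [hn.eventually_gt_atTop i] with k hk
    exact (if_pos hk).symm
  · refine Eventually.of_forall fun k i => ?_
    have hti := term_pos (ν := ν) hT hu hx i
    have hpos : 0 ≤ K ^ ν * (T.term u ν i x + B * (A * ρ ^ i)) := by positivity
    by_cases hi : i < n k
    · simp only [f, if_pos hi]
      rw [Real.norm_eq_abs, abs_of_pos (term_pos hT hu (hz k) i)]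
      have h1 := hdist x hx (z k) (hz k) i ((h k).mono hi.le)
      obtain ⟨d, hd1, hd2⟩ := h k i hi
      have h2 := (abs_le.1 (hosc d _ hd2 _ hd1)).2
      have h3 : T.orbitProd i (z k) ^ ν ≤ K ^ ν * T.orbitProd i x ^ ν := by
        rw [← Real.mul_rpow (by linarith) (hT.orbitProd_pos hx i).le]
        exact Real.rpow_le_rpow (hT.orbitProd_pos (hz k) i).le h1 hν.le
      have h4 : 0 < u (T.G^[i] x) := hu.pos _ (hT.S_subset (hx i))
      have h5 : 0 < u (T.G^[i] (z k)) := hu.pos _ (hT.S_subset (hz k i))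
      have h6 : 0 < K ^ ν * T.orbitProd i x ^ ν :=
        mul_pos (by positivity) (Real.rpow_pos_of_pos (hT.orbitProd_pos hx i) ν)
      calc T.term u ν i (z k) ≤ K ^ ν * T.orbitProd i x ^ ν * (u (T.G^[i] x) + B) :=
            mul_le_mul h3 (by linarith) h5.le h6.le
        _ = K ^ ν * (T.term u ν i x + B * T.orbitProd i x ^ ν) := by rw [term]; ring
        _ ≤ _ := by
            refine mul_le_mul_of_nonneg_left ?_ (by positivity)
            exact add_le_add le_rfl (mul_le_mul_of_nonneg_left (hP x hx i) hB.le)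
    · simpa only [f, if_neg hi, norm_zero] using hpos

end Series

/-! ### Approximation by points with finitely many prescribed digits -/

section Words

variable (hT : T.Admissible) {p : ℝ} (hp : p ∈ T.J 0) (hpp : T.G p = p)
include hT hp hpp

omit hpp in
theorem exists_word {x : ℝ} (hx : x ∈ T.Lam) (n : ℕ) :
    ∃ w : List ℕ, w.length = n ∧ T.SameDigits n x (T.pt p w) := by
  induction n generalizing x with
  | zero => exact ⟨[], rfl, fun j hj => absurd hj (Nat.not_lt_zero j)⟩
  | succ n ih =>
    obtain ⟨w, hw, h⟩ := ih (Lam.map hx)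
    obtain ⟨i, hi⟩ := mem_iUnion.1 (hx 0)
    refine ⟨i :: w, by simp [hw], fun j hj => ?_⟩
    cases j with
    | zero => exact ⟨i, hi, hT.pt_cons_mem hp i w⟩
    | succ j =>
      rw [Function.iterate_succ_apply, Function.iterate_succ_apply, hT.map_pt_cons hp]
      exact h j (by omega)

/-- An increasing sequence of words converges to the expansion of a point of `Λ`. The limits of
the iterates stay away from `s₁` because the first branch is decreasing. -/
theorem exists_limit {W : ℕ → List ℕ} (hW : ∀ k, W k <+: W (k + 1)) (hlen : ∀ k, k ≤ (W k).length) :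
    ∃ x ∈ T.Lam, ∀ k, T.SameDigits (W k).length x (T.pt p (W k)) := by
  obtain ⟨θ, κ, h0, h1, hκ, hc⟩ := hT.exists_contraction
  have hpre : ∀ k m, k ≤ m → W k <+: W m := by
    intro k m hkm
    induction m, hkm using Nat.le_induction with
    | base => exact List.prefix_rfl
    | succ m _ ih => exact ih.trans (hW m)
  have hL : ∀ k, T.pt p (W k) ∈ T.Lam := fun k => hT.pt_mem_Lam hp hpp _
  have hsame : ∀ k m, k ≤ m → T.SameDigits (W k).length (T.pt p (W k)) (T.pt p (W m)) := by
    intro k m hkm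
    obtain ⟨v, hv⟩ := hpre k m hkm
    have := hT.sameDigits_pt hp (W k) [] v
    rwa [List.append_nil, hv] at this
  have hsame' : ∀ N k m, N ≤ k → N ≤ m → T.SameDigits N (T.pt p (W k)) (T.pt p (W m)) := by
    intro N k m hk hm
    rcases le_total k m with h | h
    · exact (hsame k m h).mono (hk.trans (hlen k))
    · exact ((hsame m k h).mono (hm.trans (hlen m))).symm
  have hcau : ∀ j, ∃ L, Tendsto (fun k => T.G^[j] (T.pt p (W k))) atTop (𝓝 L) := by
    intro j
    refine cauchySeq_tendsto_of_complete (cauchySeq_of_le_tendsto_0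
      (fun N => θ ^ ((N - j) / κ)) (fun k m N hk hm => ?_) ?_)
    · rw [Real.dist_eq]
      rcases le_total j N with h | h
      · refine hT.abs_sub_le_pow h0 hc (Lam.iterate (hL k) j) (Lam.iterate (hL m) j)
          ((hsame' N k m hk hm).iterate ?_)
        have := Nat.mul_div_le (N - j) κ
        omega
      · rw [Nat.sub_eq_zero_of_le h, Nat.zero_div, pow_zero]
        exact hT.abs_iterate_sub_le_one (hL k) (hL m) j
    · refine (tendsto_pow_atTop_nhds_zero_of_lt_one h0.le h1).comp ?_
      exact (Nat.tendsto_div_const_atTop (by omega)).comp (tendsto_sub_atTop_nat j)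
  choose L hLim using hcau
  have hdig : ∀ j, ∃ i, ∀ k, j < k → T.G^[j] (T.pt p (W k)) ∈ T.J i := by
    intro j
    obtain ⟨i, hi⟩ := mem_iUnion.1 (hL (j + 1) j)
    refine ⟨i, fun k hk => ?_⟩
    obtain ⟨i', h2, h3⟩ := hsame' (j + 1) (j + 1) k le_rfl hk j (Nat.lt_succ_self j)
    have : i' = i := by
      by_contra hne
      exact disjoint_left.1 (hT.disjoint hne) h2 hi
    rwa [this] at h3
  choose a ha using hdig
  have hLs : ∀ j, L j ∈ Ioo T.s₀ T.s₁ := by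
    intro j
    have hge : T.ℓ (a j) ≤ L j := by
      refine ge_of_tendsto (hLim j) ?_
      filter_upwards [eventually_gt_atTop j] with k hk
      exact (ha j k hk).1.le
    have hle : L j ≤ T.r (a j) := by
      refine le_of_tendsto (hLim j) ?_
      filter_upwards [eventually_gt_atTop j] with k hk
      exact (ha j k hk).2.le
    refine ⟨(hT.s₀_lt_ℓ _).trans_le hge, ?_⟩
    rcases Nat.eq_zero_or_pos (a j) with hz | hpos
    · have he : T.ℓ (a (j + 1)) ∈ Ioo T.s₀ T.s₁ := ⟨hT.s₀_lt_ℓ _, hT.ℓ_lt_s₁ _⟩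
      have hcm := hT.inv_mem 0 he
      have hlt : L j ≤ T.inv 0 (T.ℓ (a (j + 1))) := by
        refine le_of_tendsto (hLim j) ?_
        filter_upwards [eventually_gt_atTop (j + 1)] with k hk
        have h2 := ha j k (by omega)
        have h3 := (ha (j + 1) k hk).1
        rw [Function.iterate_succ_apply'] at h3
        rw [hz] at h2
        refine (hT.decreasing.le_iff_ge hcm h2).1 ?_
        rw [hT.map_inv 0 he]
        exact h3.le
      rw [hT.s₁_eq]
      exact hlt.trans_lt hcm.2
    · exact hle.trans_lt ((hT.r_le_ℓ hpos).trans_lt (hT.ℓ_lt_s₁ 0))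
  have hinv : ∀ j, L j = T.inv (a j) (L (j + 1)) := by
    intro j
    refine tendsto_nhds_unique (hLim j) ?_
    rw [tendsto_iff_dist_tendsto_zero]
    refine squeeze_zero' (Eventually.of_forall fun k => dist_nonneg) ?_
      (tendsto_iff_dist_tendsto_zero.1 (hLim (j + 1)))
    filter_upwards [eventually_gt_atTop j] with k hk
    have h2 := ha j k hk
    rw [hT.eq_inv h2, Function.iterate_succ_apply', Real.dist_eq, Real.dist_eq]
    exact hT.abs_inv_sub_le _ (hT.map_mem h2) (hLs _)
  have hLJ : ∀ j, L j ∈ T.J (a j) := fun j => by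
    rw [hinv j]; exact hT.inv_mem _ (hLs _)
  have hit : ∀ j, T.G^[j] (L 0) = L j := by
    intro j
    induction j with
    | zero => rfl
    | succ j ih => rw [Function.iterate_succ_apply', ih, hinv j, hT.map_inv _ (hLs _)]
  refine ⟨L 0, fun j => by rw [hit]; exact mem_S (hLJ j), fun k j hj => ⟨a j, ?_, ?_⟩⟩
  · rw [hit]; exact hLJ j
  · obtain ⟨i, h2, h3⟩ := hsame k (max k (j + 1)) (le_max_left _ _) j hj
    have h4 := ha j (max k (j + 1)) (by omega)
    have : i = a j := by
      by_contra hne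
      exact disjoint_left.1 (hT.disjoint hne) h3 h4
    rwa [this] at h2

variable {u : ℝ → ℝ} (hu : T.Weight u) {ν : ℝ} (hν : 0 < ν)
include hu hν

omit hu in
theorem converges_fixedPoint : T.Converges u ν p := by
  have hL : p ∈ T.Lam := hT.pt_mem_Lam hp hpp []
  have h1 : ∀ j, T.G^[j] p = p := fun j => Function.iterate_fixed hpp j
  obtain ⟨A, ρ, hA, hρ0, hρ1, hP⟩ := exists_rpow_orbitProd_le hT hν
  have hs : Summable fun i => T.orbitProd i p ^ ν :=
    Summable.of_nonneg_of_le (fun i => Real.rpow_nonneg (hT.orbitProd_pos hL i).le ν) (hP p hL)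
      ((summable_geometric_of_lt_one hρ0.le hρ1).mul_left A)
  refine (hs.mul_right (u p)).congr fun i => ?_
  rw [term, h1]

omit hu in
theorem converges_pt (w : List ℕ) : T.Converges u ν (T.pt p w) := by
  rw [converges_iff_iterate hT (hT.pt_mem_Lam hp hpp w) w.length]
  have := hT.iterate_pt_append hp w []
  rw [List.append_nil] at this
  rw [this]
  exact converges_fixedPoint hT hp hpp hν

omit hu in
theorem realPhi_pt_append (w v : List ℕ) : T.realPhi u ν (T.pt p (w ++ v)) =
    ∑ i ∈ Finset.range w.length, T.term u ν i (T.pt p (w ++ v)) +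
      T.orbitProd w.length (T.pt p (w ++ v)) ^ ν * T.realPhi u ν (T.pt p v) := by
  rw [realPhi_eq_sum_add hT (hT.pt_mem_Lam hp hpp _) (converges_pt hT hp hpp hν _) w.length,
    hT.iterate_pt_append hp]

/-- Continuity of `Phi` along the points obtained by replacing all digits of `x` from some place
on by those of the fixed point. -/
theorem tendsto_realPhi_pt {ι : Type*} {l : Filter ι} {W : ι → List ℕ} {x : ℝ}
    (hx : x ∈ T.Lam) (hn : Tendsto (fun k => (W k).length) l atTop)
    (h : ∀ k, T.SameDigits (W k).length x (T.pt p (W k))) (hc : T.Converges u ν x) :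
    Tendsto (fun k => T.realPhi u ν (T.pt p (W k))) l (𝓝 (T.realPhi u ν x)) := by
  obtain ⟨A, ρ, hA, hρ0, hρ1, hP⟩ := exists_rpow_orbitProd_le hT hν
  have hL : ∀ k, T.pt p (W k) ∈ T.Lam := fun k => hT.pt_mem_Lam hp hpp _
  have h1 := tendsto_sum_term hT hu hν hx hL hn h hc
  have h2 : Tendsto (fun k => T.orbitProd (W k).length (T.pt p (W k)) ^ ν) l (𝓝 0) := by
    refine squeeze_zero (fun k => Real.rpow_nonneg (hT.orbitProd_pos (hL k) _).le ν)
      (fun k => hP _ (hL k) _) ?_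
    have h3 := ((tendsto_pow_atTop_nhds_zero_of_lt_one hρ0.le hρ1).comp hn).const_mul A
    rwa [mul_zero] at h3
  have h3 := h1.add (h2.mul_const (T.realPhi u ν p))
  rw [zero_mul, add_zero] at h3
  refine h3.congr fun k => ?_
  have := realPhi_pt_append (u := u) hT hp hpp hν (W k) []
  rw [List.append_nil] at this
  exact this.symm

/-- Inserting one large digit after many digits `0` increases `Phi` by an amount which can be
made smaller than any given bound `t` and larger than a fixed fraction of it: a change of the
number of digits `0` by one changes the new term by a bounded factor, and everything else is
negligible. -/
theorem exists_increment : ∃ c : ℝ, 0 < c ∧ ∀ (w : List ℕ) (t : ℝ), 0 < t → ∃ v : List ℕ,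
    T.realPhi u ν (T.pt p w) + c * t ≤ T.realPhi u ν (T.pt p (w ++ v)) ∧
    T.realPhi u ν (T.pt p (w ++ v)) < T.realPhi u ν (T.pt p w) + t := by
  obtain ⟨K, hK, hdist⟩ := hT.exists_distortion
  obtain ⟨A, ρ', hA, hρ'0, hρ'1, hP⟩ := exists_rpow_orbitProd_le hT hν
  have hp0 := hT.pos (mem_S hp)
  have hK0 : 0 < K := by linarith
  set κ : ℝ := K ^ ν with hκ
  have hκ1 : 1 ≤ κ := Real.one_le_rpow hK hν.le
  set ρ : ℝ := p ^ ν with hρ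
  have hρ0 : 0 < ρ := Real.rpow_pos_of_pos hp0 ν
  have hρ1 : ρ < 1 := Real.rpow_lt_one hp0.le (hT.lt_one (mem_S hp)) hν
  have hη : ρ / (4 * κ ^ 2) ≤ 1 / 4 := by
    rw [div_le_div_iff₀ (by positivity) (by norm_num)]
    nlinarith
  refine ⟨ρ / (4 * κ ^ 2), by positivity, fun w t ht => ?_⟩
  set η : ℝ := ρ / (4 * κ ^ 2) with hηdef
  have hη0 : 0 < η := by positivity
  set x := T.pt p w with hxdef
  have hx : x ∈ T.Lam := hT.pt_mem_Lam hp hpp w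
  let z : ℕ × ℕ → ℝ := fun k => T.pt p (w ++ List.replicate k.1 0 ++ [k.2])
  have hz : ∀ k, z k ∈ T.Lam := fun k => hT.pt_mem_Lam hp hpp _
  let n : ℕ × ℕ → ℕ := fun k => (w ++ List.replicate k.1 0).length
  have hn' : ∀ k, n k = w.length + k.1 := fun k => by simp [n]
  let l : Filter (ℕ × ℕ) := comap Prod.fst atTop
  have hn : Tendsto n l atTop := by
    rw [show n = fun k => w.length + k.1 from funext hn']
    exact tendsto_atTop_mono (fun k => Nat.le_add_left _ _) tendsto_comap
  have hsame : ∀ k, T.SameDigits (n k) x (z k) := by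
    intro k
    have := hT.sameDigits_pt hp (w ++ List.replicate k.1 0) [] [k.2]
    rwa [List.append_nil, hT.pt_append_replicate hp hpp] at this
  have hsum := tendsto_sum_term hT hu hν hx hz hn hsame (converges_pt hT hp hpp hν w)
  have hval : ∀ k, T.realPhi u ν (z k) = ∑ i ∈ Finset.range (n k), T.term u ν i (z k) +
      T.orbitProd (n k) (z k) ^ ν * (u (T.pt p [k.2]) +
        T.pt p [k.2] ^ ν * T.realPhi u ν p) := by
    intro k
    rw [realPhi_pt_append hT hp hpp hν, realPhi_eq hT (hT.pt_mem_Lam hp hpp _)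
      (converges_pt hT hp hpp hν _), hT.map_pt_cons hp]
    rfl
  have hC := realPhi_pos hT hu (hT.pt_mem_Lam hp hpp []) (converges_fixedPoint hT hp hpp hν)
  change 0 < T.realPhi u ν p at hC
  have htail : Tendsto (fun k => T.orbitProd (n k) (z k) ^ ν *
      (T.pt p [k.2] ^ ν * T.realPhi u ν p)) l (𝓝 0) := by
    have h3 := (((tendsto_pow_atTop_nhds_zero_of_lt_one hρ'0.le hρ'1).comp hn).const_mul A).mul_const
      (T.realPhi u ν p)
    rw [mul_zero, zero_mul] at h3
    refine squeeze_zero (fun k => ?_) (fun k => ?_) h3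
    · exact mul_nonneg (Real.rpow_nonneg (hT.orbitProd_pos (hz k) _).le ν)
        (mul_nonneg (Real.rpow_nonneg (hT.pos (hT.pt_mem_S hp _)).le ν) hC.le)
    · refine mul_le_mul (hP _ (hz k) _) ?_ ?_ (mul_nonneg hA.le (pow_nonneg hρ'0.le _))
      · refine mul_le_of_le_one_left hC.le (Real.rpow_le_one (hT.pos (hT.pt_mem_S hp _)).le
          (hT.lt_one (hT.pt_mem_S hp _)).le hν.le)
      · exact mul_nonneg (Real.rpow_nonneg (hT.pos (hT.pt_mem_S hp _)).le ν) hC.le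
  have hall := hsum.add htail
  rw [add_zero] at hall
  have hev := Metric.tendsto_nhds.1 hall (η * t) (by positivity)
  obtain ⟨M, hM⟩ := eventually_atTop.1 (eventually_comap.1 hev)
  -- the size of the orbit products at `x`
  have hprod : ∀ m, T.orbitProd (w.length + m) x ^ ν = T.orbitProd w.length x ^ ν * ρ ^ m := by
    intro m
    have h2 := hT.iterate_pt_append hp w []
    rw [List.append_nil] at h2
    have h3 : T.orbitProd m p = p ^ m := by
      simp [orbitProd, fun j => Function.iterate_fixed hpp j]
    rw [orbitProd_add, hxdef, h2]
    change (_ * T.orbitProd m p) ^ ν = _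
    rw [h3, Real.mul_rpow (hT.orbitProd_pos hx _).le (by positivity), hρ,
      Real.rpow_pow_comm hp0.le]
  set a : ℝ := T.orbitProd w.length x ^ ν with ha
  have ha0 : 0 < a := Real.rpow_pos_of_pos (hT.orbitProd_pos hx _) ν
  obtain ⟨N, hN⟩ := hu.exists_large hT (t / 2 / (κ * a * ρ ^ M))
  have hU := hN _ (hT.pt_cons_mem hp N [])
  set U : ℝ := u (T.pt p [N]) with hUdef
  have hU0 : 0 < U := lt_trans (by positivity) hU
  -- `m` is chosen such that the new term, up to the distortion constant, is just below `t / 2`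
  set X : ℝ := t / 2 / (κ * a * U) with hX
  have hX0 : 0 < X := by positivity
  have hXM : X < ρ ^ M := by
    rw [div_lt_iff₀ (by positivity)] at hU
    rw [hX, div_lt_iff₀ (by positivity)]
    linarith
  obtain ⟨m, hm1, hm2⟩ := exists_nat_pow_near_of_lt_one hX0
    (hXM.le.trans (pow_le_one₀ hρ0.le hρ1.le)) hρ0 hρ1
  have hMm : M ≤ m + 1 := by
    by_contra hlt
    have := pow_le_pow_of_le_one hρ0.le hρ1.le (show m + 1 ≤ M by omega)
    linarith
  have hfin := hM (m + 1) hMm (m + 1, N) rfl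
  have hQ1 : T.orbitProd (n (m + 1, N)) (z (m + 1, N)) ^ ν ≤ κ * (a * ρ ^ (m + 1)) := by
    rw [← hprod, ← hn' (m + 1, N), hκ, ← Real.mul_rpow hK0.le (hT.orbitProd_pos hx _).le]
    exact Real.rpow_le_rpow (hT.orbitProd_pos (hz _) _).le (hdist _ hx _ (hz _) _ (hsame _)) hν.le
  have hQ2 : a * ρ ^ (m + 1) ≤ κ * T.orbitProd (n (m + 1, N)) (z (m + 1, N)) ^ ν := by
    rw [← hprod, ← hn' (m + 1, N), hκ, ← Real.mul_rpow hK0.le (hT.orbitProd_pos (hz _) _).le]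
    exact Real.rpow_le_rpow (hT.orbitProd_pos hx _).le (hdist _ (hz _) _ hx _ (hsame _).symm) hν.le
  have hv := hval (m + 1, N)
  set Q : ℝ := T.orbitProd (n (m + 1, N)) (z (m + 1, N)) ^ ν with hQ
  have hXU : κ * a * X * U = t / 2 := by rw [hX]; field_simp
  have hup : Q * U ≤ t / 2 := by
    calc Q * U ≤ κ * (a * ρ ^ (m + 1)) * U := mul_le_mul_of_nonneg_right hQ1 hU0.le
      _ ≤ κ * (a * X) * U := by gcongr
      _ = t / 2 := by rw [← hXU]; ring
  have hlow : 2 * η * t ≤ Q * U := by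
    have h2 : a * (ρ * X) * U ≤ κ * Q * U := by
      refine mul_le_mul_of_nonneg_right (le_trans ?_ hQ2) hU0.le
      rw [pow_succ']
      gcongr
    have h3 : κ * (a * (ρ * X) * U) = ρ * (t / 2) := by rw [← hXU]; ring
    have h4 : 2 * η * t * κ ^ 2 = ρ * (t / 2) := by rw [hηdef]; field_simp; ring
    have h5 : κ * (a * (ρ * X) * U) ≤ κ * (κ * Q * U) :=
      mul_le_mul_of_nonneg_left h2 (by linarith)
    have h6 : 2 * η * t * κ ^ 2 ≤ Q * U * κ ^ 2 := by linarith
    exact le_of_mul_le_mul_right h6 (by positivity)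
  rw [Real.dist_eq, abs_lt] at hfin
  refine ⟨List.replicate (m + 1) 0 ++ [N], ?_⟩
  rw [← List.append_assoc]
  change _ ≤ T.realPhi u ν (z (m + 1, N)) ∧ T.realPhi u ν (z (m + 1, N)) < _
  rw [hv]
  have hηt : η * t ≤ 1 / 4 * t := mul_le_mul_of_nonneg_right hη ht.le
  dsimp only at hfin ⊢
  rw [← hUdef]
  constructor <;> linarith

/-- Every value above `Phi (pt w)` is approximated from below by the values of `Phi` at the points
obtained by prolonging the word `w`. -/
theorem exists_realPhi_between (w : List ℕ) {s t : ℝ} (hst : s < t)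
    (hw : T.realPhi u ν (T.pt p w) < t) : ∃ v : List ℕ,
    s < T.realPhi u ν (T.pt p (w ++ v)) ∧ T.realPhi u ν (T.pt p (w ++ v)) < t := by
  obtain ⟨c, hc, hinc⟩ := exists_increment hT hp hpp hu hν
  by_contra! hno
  let V : Set ℝ := {y | ∃ v, T.realPhi u ν (T.pt p (w ++ v)) = y ∧ y < t}
  have hne : V.Nonempty := ⟨_, [], rfl, by rwa [List.append_nil]⟩
  have hle : ∀ y ∈ V, y ≤ s := by
    rintro y ⟨v, rfl, hy⟩
    by_contra hlt
    exact absurd (hno v (not_le.1 hlt)) (not_le.2 hy)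
  have hb : BddAbove V := ⟨s, hle⟩
  obtain ⟨y, ⟨v, rfl, hy⟩, hys⟩ := exists_lt_of_lt_csSup hne
    (show sSup V - c * (t - s) < sSup V by nlinarith)
  obtain ⟨v', h1, h2⟩ := hinc (w ++ v) (t - T.realPhi u ν (T.pt p (w ++ v))) (by linarith)
  have h3 : T.realPhi u ν (T.pt p (w ++ v ++ v')) ∈ V :=
    ⟨v ++ v', by rw [List.append_assoc], by linarith⟩
  have h4 := le_csSup hb h3
  have h5 := hle _ ⟨v, rfl, hy⟩
  nlinarith

end Words

end BranchedMap

/-! ### Certified dyadic points of the intervals -/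

/-- Two dyadic numbers in a connected set covered by intervals from a family can be joined by a
chain of dyadic numbers in which any two neighbours lie in a common interval of the family. -/
theorem reflTransGen_of_cover {Q : DyadicCode → DyadicCode → Prop} {I : Set ℝ}
    (hI : IsPreconnected I)
    (hcov : ∀ x ∈ I, ∃ e f, Q e f ∧ x ∈ Ioo (dyadicVal e) (dyadicVal f)) {q d : DyadicCode}
    (hq : dyadicVal q ∈ I) (hd : dyadicVal d ∈ I) :
    Relation.ReflTransGen (fun c c' => ∃ e f, Q e f ∧ dyadicVal c ∈ Ioo (dyadicVal e) (dyadicVal f) ∧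
      dyadicVal c' ∈ Ioo (dyadicVal e) (dyadicVal f)) q d := by
  set step : DyadicCode → DyadicCode → Prop := fun c c' => ∃ e f, Q e f ∧
    dyadicVal c ∈ Ioo (dyadicVal e) (dyadicVal f) ∧
      dyadicVal c' ∈ Ioo (dyadicVal e) (dyadicVal f) with hstep
  let P : DyadicCode → DyadicCode → Prop := fun e f =>
    ∃ c, Relation.ReflTransGen step q c ∧ dyadicVal c ∈ Ioo (dyadicVal e) (dyadicVal f)
  let U : Set ℝ := ⋃ (e) (f) (_ : Q e f ∧ P e f), Ioo (dyadicVal e) (dyadicVal f)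
  let V : Set ℝ := ⋃ (e) (f) (_ : Q e f ∧ ¬ P e f), Ioo (dyadicVal e) (dyadicVal f)
  have hU : IsOpen U := isOpen_iUnion fun _ => isOpen_iUnion fun _ => isOpen_iUnion fun _ => isOpen_Ioo
  have hV : IsOpen V := isOpen_iUnion fun _ => isOpen_iUnion fun _ => isOpen_iUnion fun _ => isOpen_Ioo
  have hUV : I ⊆ U ∪ V := by
    intro x hx
    obtain ⟨e, f, h1, h2⟩ := hcov x hx
    by_cases h : P e f
    · exact .inl (mem_iUnion.2 ⟨e, mem_iUnion.2 ⟨f, mem_iUnion.2 ⟨⟨h1, h⟩, h2⟩⟩⟩)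
    · exact .inr (mem_iUnion.2 ⟨e, mem_iUnion.2 ⟨f, mem_iUnion.2 ⟨⟨h1, h⟩, h2⟩⟩⟩)
  have hqU : dyadicVal q ∈ U := by
    obtain ⟨e, f, h1, h2⟩ := hcov _ hq
    exact mem_iUnion.2 ⟨e, mem_iUnion.2 ⟨f, mem_iUnion.2 ⟨⟨h1, q, .refl, h2⟩, h2⟩⟩⟩
  rcases hUV hd with h | h
  · simp only [U, mem_iUnion] at h
    obtain ⟨e, f, ⟨h1, c, hc, h2⟩, h3⟩ := h
    exact hc.tail ⟨e, f, h1, h2, h3⟩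
  · obtain ⟨x, -, hx1, hx2⟩ := hI U V hU hV hUV ⟨_, hq, hqU⟩ ⟨_, hd, h⟩
    simp only [U, V, mem_iUnion] at hx1 hx2
    obtain ⟨e, f, ⟨h1, c, hc, h2⟩, h3⟩ := hx1
    obtain ⟨e', f', ⟨h1', hno⟩, h3'⟩ := hx2
    obtain ⟨d', hd1, hd2⟩ := exists_dyadic_between
      (show max (dyadicVal e) (dyadicVal e') < min (dyadicVal f) (dyadicVal f') from
        (max_lt h3.1 h3'.1).trans (lt_min h3.2 h3'.2))
    rw [max_lt_iff] at hd1
    rw [lt_min_iff] at hd2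
    exact absurd ⟨d', hc.tail ⟨e, f, h1, h2, ⟨hd1.1, hd2.1⟩⟩, hd1.2, hd2.2⟩ hno

namespace BranchedMap

variable {T : BranchedMap}

section Certificates

variable (hT : T.Admissible) {E : DyadicCode → DyadicCode → DyadicCode → DyadicCode → Prop}
  (hE : Enclosure T.G T.S E) {q : ℕ → DyadicCode} (hqc : Computable q)
  (hq : ∀ i, dyadicVal (q i) ∈ T.J i)
include hT hq

/-- Since the intervals accumulate at `s₀`, the points `q j` serve as certificates for being
greater than `s₀`. -/
theorem exists_lt_of_s₀_lt {e : ℝ} (he : T.s₀ < e) : ∃ j, dyadicVal (q j) < e := by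
  obtain ⟨N, hN⟩ := hT.exists_r_lt he
  exact ⟨N, (hq N).2.trans (hN N le_rfl)⟩

theorem s₀_lt_of_le {j : ℕ} {a : DyadicCode} (h : dyadicVal (q j) ≤ dyadicVal a) :
    T.s₀ < dyadicVal a := (hT.s₀_lt_of_mem (mem_S (hq j))).trans_le h

include hE

omit hq in
/-- An interval certified to have image bounded away from `s₀` does not reach from below `s₁` to
`s₁`, since on the first branch the map tends to `s₀` at `s₁`. -/
theorem lt_s₁_of_enclosure {e f a b c c' : DyadicCode} (h : E e f a b) (ha : T.s₀ < dyadicVal a)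
    (hc : dyadicVal c ∈ Ioo (dyadicVal e) (dyadicVal f)) (hcs : dyadicVal c < T.s₁)
    (hc' : dyadicVal c' ∈ Ioo (dyadicVal e) (dyadicVal f)) : dyadicVal c' < T.s₁ := by
  by_contra hlt
  rw [not_lt] at hlt
  obtain ⟨m, hm1, hm2⟩ := exists_between (max_lt hcs (hT.ℓ_lt_s₁ 0))
  rw [max_lt_iff] at hm1
  rw [hT.s₁_eq] at hm2
  have hm : m ∈ T.J 0 := ⟨hm1.2, hm2⟩
  obtain ⟨y, hy1, hy2⟩ := exists_between (lt_min ha (hT.map_mem hm).1)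
  rw [lt_min_iff] at hy2
  have hy : y ∈ Ioo T.s₀ T.s₁ := ⟨hy1, hy2.2.trans (hT.map_mem hm).2⟩
  have hx := hT.inv_mem 0 hy
  have hgt : m < T.inv 0 y := by
    refine (hT.decreasing.lt_iff_gt hx hm).1 ?_
    rw [hT.map_inv 0 hy]
    exact hy2.2
  have := (hE.sound _ (mem_S hx) e f a b h (hc.1.trans (hm1.1.trans hgt))
    ((hT.lt_s₁_of_mem (mem_S hx)).trans_le hlt |>.trans hc'.2)).1
  rw [hT.map_inv 0 hy] at this
  exact lt_asymm this hy2.1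

omit hq in
/-- An interval certified to have image bounded away from `s₀` and `s₁` does not contain an
endpoint of a branch. -/
theorem mem_J_of_enclosure {i : ℕ} {e f a b c c' : DyadicCode} (h : E e f a b)
    (ha : T.s₀ < dyadicVal a) (hb : dyadicVal b < T.s₁)
    (hc : dyadicVal c ∈ Ioo (dyadicVal e) (dyadicVal f)) (hcs : dyadicVal c ∈ T.J i)
    (hc' : dyadicVal c' ∈ Ioo (dyadicVal e) (dyadicVal f)) : dyadicVal c' ∈ T.J i := by
  have hGc := hT.map_mem hcs
  obtain ⟨y, hy1, hy2⟩ := exists_between (lt_min ha hGc.1)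
  obtain ⟨z, hz1, hz2⟩ := exists_between (max_lt hb hGc.2)
  rw [lt_min_iff] at hy2
  rw [max_lt_iff] at hz1
  have hy : y ∈ Ioo T.s₀ T.s₁ := ⟨hy1, hy2.2.trans hGc.2⟩
  have hz : z ∈ Ioo T.s₀ T.s₁ := ⟨hGc.1.trans hz1.2, hz2⟩
  have hyJ := hT.inv_mem i hy
  have hzJ := hT.inv_mem i hz
  have hy0 : ¬ (dyadicVal e < T.inv i y ∧ T.inv i y < dyadicVal f) := by
    rintro ⟨h1, h2⟩
    have := (hE.sound _ (mem_S hyJ) e f a b h h1 h2).1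
    rw [hT.map_inv i hy] at this
    exact lt_asymm this hy2.1
  have hz0 : ¬ (dyadicVal e < T.inv i z ∧ T.inv i z < dyadicVal f) := by
    rintro ⟨h1, h2⟩
    have := (hE.sound _ (mem_S hzJ) e f a b h h1 h2).2
    rw [hT.map_inv i hz] at this
    exact lt_asymm this hz1.1
  have hlt : T.G (T.inv i y) < T.G (dyadicVal c) := by rw [hT.map_inv i hy]; exact hy2.2
  have hgt : T.G (dyadicVal c) < T.G (T.inv i z) := by rw [hT.map_inv i hz]; exact hz1.2
  rcases hT.strictMonoOn_or_strictAntiOn i with hm | hm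
  · have h1 := (hm.lt_iff_lt hyJ hcs).1 hlt
    have h2 := (hm.lt_iff_lt hcs hzJ).1 hgt
    have h3 : T.inv i y ≤ dyadicVal e := not_lt.1 fun h => hy0 ⟨h, h1.trans hc.2⟩
    have h4 : dyadicVal f ≤ T.inv i z := not_lt.1 fun h => hz0 ⟨hc.1.trans h2, h⟩
    exact ⟨hyJ.1.trans_le h3 |>.trans hc'.1, hc'.2.trans (h4.trans_lt hzJ.2)⟩
  · have h1 := (hm.lt_iff_gt hyJ hcs).1 hlt
    have h2 := (hm.lt_iff_gt hcs hzJ).1 hgt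
    have h3 : T.inv i z ≤ dyadicVal e := not_lt.1 fun h => hz0 ⟨h, h2.trans hc.2⟩
    have h4 : dyadicVal f ≤ T.inv i y := not_lt.1 fun h => hy0 ⟨hc.1.trans h1, h⟩
    exact ⟨hzJ.1.trans_le h3 |>.trans hc'.1, hc'.2.trans (h4.trans_lt hyJ.2)⟩

include hqc

omit hT hE hq in
theorem re_exists_le {τ : Type*} [Primcodable τ] {g : τ → DyadicCode} (hg : Computable g) :
    REPred fun x => ∃ j : ℕ, dyadicVal (q j) ≤ dyadicVal (g x) := by
  refine re_exists₂ (re_dLe (f := fun x : τ × ℕ => q x.2)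
    (g := fun x : τ × ℕ => g x.1) ?_ ?_)
  exacts [hqc.comp Computable.snd, hg.comp Computable.fst]

omit hT hE hqc hq in
theorem re_mem_interval {τ : Type*} [Primcodable τ] {c e f : τ → DyadicCode} (hc : Computable c)
    (he : Computable e) (hf : Computable f) :
    REPred fun x => dyadicVal (c x) ∈ Ioo (dyadicVal (e x)) (dyadicVal (f x)) :=
  re_and (re_dLt he hc) (re_dLt hc hf)

/-- Every dyadic number between a given dyadic point of the first interval and `s₁` can be
certified to be less than `s₁`. -/
theorem exists_re_lt_s₁ : ∃ B : DyadicCode → Prop, REPred B ∧ (∀ c, B c → dyadicVal c < T.s₁) ∧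
    ∀ c, dyadicVal (q 0) ≤ dyadicVal c → dyadicVal c < T.s₁ → B c := by
  let Q : DyadicCode → DyadicCode → Prop := fun e f =>
    ∃ y : DyadicCode × DyadicCode, E e f y.1 y.2 ∧ ∃ j, dyadicVal (q j) ≤ dyadicVal y.1
  have hQ : REPred fun x : DyadicCode × DyadicCode => Q x.1 x.2 :=
    re_exists₂ (re_and hE.re (re_exists_le hqc (Computable.fst.comp Computable.snd)))
  let step : DyadicCode → DyadicCode → Prop := fun c c' => ∃ e f, Q e f ∧
    dyadicVal c ∈ Ioo (dyadicVal e) (dyadicVal f) ∧ dyadicVal c' ∈ Ioo (dyadicVal e) (dyadicVal f)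
  have hstep : REPred fun x : DyadicCode × DyadicCode => step x.1 x.2 := by
    have he : Computable fun x : ((DyadicCode × DyadicCode) × DyadicCode) × DyadicCode => x.1.2 :=
      Computable.snd.comp Computable.fst
    have hf : Computable fun x : ((DyadicCode × DyadicCode) × DyadicCode) × DyadicCode => x.2 :=
      Computable.snd
    have hc : Computable fun x : ((DyadicCode × DyadicCode) × DyadicCode) × DyadicCode => x.1.1.1 :=
      Computable.fst.comp (Computable.fst.comp Computable.fst)
    have hc' : Computable fun x : ((DyadicCode × DyadicCode) × DyadicCode) × DyadicCode => x.1.1.2 :=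
      Computable.snd.comp (Computable.fst.comp Computable.fst)
    exact re_exists₂ (re_exists₂ (re_and (re_comp₂ hQ he hf)
      (re_and (re_mem_interval hc he hf) (re_mem_interval hc' he hf))))
  have hinit : REPred fun c : DyadicCode => c = q 0 :=
    (Primrec.eq.comp Primrec.id (Primrec.const (q 0))).rePred
  refine ⟨_, re_reach hinit hstep, ?_, ?_⟩
  · rintro c ⟨_, rfl, hr⟩
    induction hr with
    | refl => exact hT.lt_s₁_of_mem (mem_S (hq 0))
    | tail _ hs ih =>
      obtain ⟨e, f, ⟨y, hEy, j, hj⟩, h1, h2⟩ := hs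
      exact lt_s₁_of_enclosure hT hE hEy (s₀_lt_of_le hT hq hj) h1 ih h2
  · intro c hc1 hc2
    refine ⟨q 0, rfl, reflTransGen_of_cover (I := Ico (dyadicVal (q 0)) T.s₁) isPreconnected_Ico ?_
      ⟨le_rfl, hT.lt_s₁_of_mem (mem_S (hq 0))⟩ ⟨hc1, hc2⟩⟩
    intro x hx
    have hxJ : x ∈ T.J 0 := ⟨(hq 0).1.trans_le hx.1, by rw [← hT.s₁_eq]; exact hx.2⟩
    obtain ⟨j, hj⟩ := exists_lt_of_s₀_lt hT hq (hT.map_mem hxJ).1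
    obtain ⟨a, ha1, ha2⟩ := exists_dyadic_between hj
    obtain ⟨b, hb1, -⟩ := exists_dyadic_between (show T.G x < T.G x + 1 by linarith)
    obtain ⟨e, f, h1, h2, h3⟩ := hE.complete x (mem_S hxJ) a b ha2 hb1
    exact ⟨e, f, ⟨(a, b), h1, j, ha1.le⟩, h2, h3⟩

/-- Membership of dyadic numbers in the intervals of the map is semidecidable. The number `c` lies
in `J i` iff it is joined to the known point `q i` of `J i` by a chain of overlapping intervals
whose images are certified to stay away from `s₀` and `s₁`. -/
theorem re_mem_J_of_enclosure : REPred fun x : ℕ × DyadicCode => dyadicVal x.2 ∈ T.J x.1 := by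
  obtain ⟨B, hBre, hB1, hB2⟩ := exists_re_lt_s₁ hT hE hqc hq
  let Q : DyadicCode → DyadicCode → Prop := fun e f =>
    ∃ y : DyadicCode × DyadicCode, E e f y.1 y.2 ∧ (∃ j, dyadicVal (q j) ≤ dyadicVal y.1) ∧ B y.2
  have hQ : REPred fun x : DyadicCode × DyadicCode => Q x.1 x.2 :=
    re_exists₂ (re_and hE.re (re_and (re_exists_le hqc (Computable.fst.comp Computable.snd))
      (re_comp hBre (Computable.snd.comp Computable.snd))))
  let step : ℕ × DyadicCode → ℕ × DyadicCode → Prop := fun s s' => ∃ e f, s.1 = s'.1 ∧ Q e f ∧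
    dyadicVal s.2 ∈ Ioo (dyadicVal e) (dyadicVal f) ∧
      dyadicVal s'.2 ∈ Ioo (dyadicVal e) (dyadicVal f)
  have hstep : REPred fun x : (ℕ × DyadicCode) × (ℕ × DyadicCode) => step x.1 x.2 := by
    have he : Computable fun x : (((ℕ × DyadicCode) × (ℕ × DyadicCode)) × DyadicCode) × DyadicCode =>
      x.1.2 := Computable.snd.comp Computable.fst
    have hf : Computable fun x : (((ℕ × DyadicCode) × (ℕ × DyadicCode)) × DyadicCode) × DyadicCode =>
      x.2 := Computable.snd
    have hc : Computable fun x : (((ℕ × DyadicCode) × (ℕ × DyadicCode)) × DyadicCode) × DyadicCode =>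
      x.1.1.1 := Computable.fst.comp (Computable.fst.comp Computable.fst)
    have hc' : Computable fun x : (((ℕ × DyadicCode) × (ℕ × DyadicCode)) × DyadicCode) × DyadicCode =>
      x.1.1.2 := Computable.snd.comp (Computable.fst.comp Computable.fst)
    have heq : REPred fun x : (((ℕ × DyadicCode) × (ℕ × DyadicCode)) × DyadicCode) × DyadicCode =>
        x.1.1.1.1 = x.1.1.2.1 :=
      re_comp₂ (r := Eq) (PrimrecPred.rePred (Primrec.eq (α := ℕ)))
        (Computable.fst.comp hc) (Computable.fst.comp hc')
    exact re_exists₂ (re_exists₂ (re_and heq (re_and (re_comp₂ hQ he hf)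
      (re_and (re_mem_interval (Computable.snd.comp hc) he hf)
        (re_mem_interval (Computable.snd.comp hc') he hf)))))
  refine (re_reach (re_graph hqc) hstep).of_eq fun x => ?_
  constructor
  · rintro ⟨⟨i, c⟩, h0, hr⟩
    induction hr with
    | refl =>
      have := hq i
      rwa [show q i = c from h0] at this
    | tail _ hs ih =>
      obtain ⟨e, f, he, ⟨y, hEy, ⟨j, hj⟩, hy⟩, h1, h2⟩ := hs
      rw [← he]
      exact mem_J_of_enclosure hT hE hEy (s₀_lt_of_le hT hq hj) (hB1 _ hy) h1 ih h2
  · intro hx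
    refine ⟨(x.1, q x.1), rfl, ?_⟩
    have hch := reflTransGen_of_cover (Q := Q) (I := T.J x.1) (q := q x.1) (d := x.2)
      isPreconnected_Ioo ?_ (hq x.1) hx
    · refine Relation.ReflTransGen.lift (fun c => (x.1, c)) (fun c c' h => ?_) _ _ hch
      obtain ⟨e, f, h⟩ := h
      exact ⟨e, f, rfl, h⟩
    · intro z hz
      have hGz := hT.map_mem hz
      obtain ⟨j, hj⟩ := exists_lt_of_s₀_lt hT hq hGz.1
      obtain ⟨a, ha1, ha2⟩ := exists_dyadic_between hj
      obtain ⟨b, hb1, hb2⟩ := exists_dyadic_between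
        (max_lt hGz.2 (hT.lt_s₁_of_mem (mem_S (hq 0))))
      rw [max_lt_iff] at hb1
      obtain ⟨e, f, h1, h2, h3⟩ := hE.complete z (mem_S hz) a b ha2 hb1.1
      exact ⟨e, f, ⟨(a, b), h1, ⟨j, ha1.le⟩, hB2 b hb1.2.le hb2⟩, h2, h3⟩

end Certificates

theorem Admissible.re_mem_J (hT : T.Admissible) :
    REPred fun x : ℕ × DyadicCode => dyadicVal x.2 ∈ T.J x.1 := by
  obtain ⟨E, hE⟩ := hT.computable.exists_enclosure
  obtain ⟨q, hqc, hq⟩ := hT.effective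
  exact re_mem_J_of_enclosure hT hE hqc hq

end BranchedMap

/-! ### Evaluation of functions on families of computable points -/

section Eval

variable {α τ : Type*} [Primcodable α] [Primcodable τ]

theorem LowerRE.re {z : α → ℝ} (h : LowerRE z) {g : τ → α} {c : τ → DyadicCode}
    (hg : Computable g) (hc : Computable c) : REPred fun t => dyadicVal (c t) < z (g t) :=
  re_comp h (f := fun t => (g t, c t)) (hg.pair hc)

theorem UpperRE.re {z : α → ℝ} (h : UpperRE z) {g : τ → α} {c : τ → DyadicCode}
    (hg : Computable g) (hc : Computable c) : REPred fun t => z (g t) < dyadicVal (c t) :=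
  re_comp h (f := fun t => (g t, c t)) (hg.pair hc)

theorem lowerRE_dyadicVal : LowerRE dyadicVal := re_dLt Computable.snd Computable.fst

theorem upperRE_dyadicVal : UpperRE dyadicVal := re_dLt Computable.fst Computable.snd

variable {f : ℝ → ℝ} {A : Set ℝ}

theorem Enclosure.re_comp {E : DyadicCode → DyadicCode → DyadicCode → DyadicCode → Prop}
    (hE : Enclosure f A E) {c d a b : τ → DyadicCode} (hc : Computable c) (hd : Computable d)
    (ha : Computable a) (hb : Computable b) : REPred fun t => E (c t) (d t) (a t) (b t) :=
  Brjuno.re_comp hE.re (f := fun t => ((c t, d t), (a t, b t))) ((hc.pair hd).pair (ha.pair hb))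

theorem LowerEnclosure.lowerRE {E : DyadicCode → DyadicCode → DyadicCode → Prop}
    (hE : LowerEnclosure f A E) {z : α → ℝ} (hz : ∀ a, z a ∈ A) (hl : LowerRE z)
    (hu : UpperRE z) : LowerRE fun a => f (z a) := by
  have h : REPred fun x : α × DyadicCode => ∃ y : DyadicCode × DyadicCode, E y.1 y.2 x.2 ∧
      dyadicVal y.1 < z x.1 ∧ z x.1 < dyadicVal y.2 :=
    re_exists₂ (re_and
      (re_comp hE.re (f := fun x : (α × DyadicCode) × DyadicCode × DyadicCode => (x.2, x.1.2))
        (Computable.snd.pair (Computable.snd.comp Computable.fst)))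
      (re_and (hl.re (Computable.fst.comp Computable.fst) (Computable.fst.comp Computable.snd))
        (hu.re (Computable.fst.comp Computable.fst) (Computable.snd.comp Computable.snd))))
  refine h.of_eq fun x => ⟨?_, fun hx => ?_⟩
  · rintro ⟨y, h1, h2, h3⟩
    exact hE.sound _ (hz _) _ _ _ h1 h2 h3
  · obtain ⟨c, d, h1, h2, h3⟩ := hE.complete _ (hz _) _ hx
    exact ⟨(c, d), h1, h2, h3⟩

/-- The semidecision procedure for `a < f (z t)` that comes from an enclosure is correct at those
`t` for which `z t` lies in the domain of `f`. -/
theorem Enclosure.exists_lower {E : DyadicCode → DyadicCode → DyadicCode → DyadicCode → Prop}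
    (hE : Enclosure f A E) {z : α → ℝ} (hl : LowerRE z) (hu : UpperRE z) :
    ∃ R : α → DyadicCode → Prop, REPred (fun x : α × DyadicCode => R x.1 x.2) ∧
      ∀ t, z t ∈ A → ∀ a, R t a ↔ dyadicVal a < f (z t) := by
  refine ⟨fun t a => ∃ y : (DyadicCode × DyadicCode) × DyadicCode, E y.1.1 y.1.2 a y.2 ∧
    dyadicVal y.1.1 < z t ∧ z t < dyadicVal y.1.2, ?_, fun t ht a => ⟨?_, fun h => ?_⟩⟩
  · have hc : Computable fun x : (α × DyadicCode) × (DyadicCode × DyadicCode) × DyadicCode =>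
        x.2.1.1 := Computable.fst.comp (Computable.fst.comp Computable.snd)
    have hd : Computable fun x : (α × DyadicCode) × (DyadicCode × DyadicCode) × DyadicCode =>
        x.2.1.2 := Computable.snd.comp (Computable.fst.comp Computable.snd)
    have ht : Computable fun x : (α × DyadicCode) × (DyadicCode × DyadicCode) × DyadicCode =>
        x.1.1 := Computable.fst.comp Computable.fst
    exact re_exists₂ (re_and (hE.re_comp hc hd (Computable.snd.comp Computable.fst)
      (Computable.snd.comp Computable.snd)) (re_and (hl.re ht hc) (hu.re ht hd)))
  · rintro ⟨y, h1, h2, h3⟩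
    exact (hE.sound _ ht _ _ _ _ h1 h2 h3).1
  · obtain ⟨b, hb, -⟩ := exists_dyadic_between (show f (z t) < f (z t) + 1 by linarith)
    obtain ⟨c, d, h1, h2, h3⟩ := hE.complete _ ht a b h hb
    exact ⟨((c, d), b), h1, h2, h3⟩

theorem Enclosure.exists_upper {E : DyadicCode → DyadicCode → DyadicCode → DyadicCode → Prop}
    (hE : Enclosure f A E) {z : α → ℝ} (hl : LowerRE z) (hu : UpperRE z) :
    ∃ R : α → DyadicCode → Prop, REPred (fun x : α × DyadicCode => R x.1 x.2) ∧
      ∀ t, z t ∈ A → ∀ b, R t b ↔ f (z t) < dyadicVal b := by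
  refine ⟨fun t b => ∃ y : (DyadicCode × DyadicCode) × DyadicCode, E y.1.1 y.1.2 y.2 b ∧
    dyadicVal y.1.1 < z t ∧ z t < dyadicVal y.1.2, ?_, fun t ht b => ⟨?_, fun h => ?_⟩⟩
  · have hc : Computable fun x : (α × DyadicCode) × (DyadicCode × DyadicCode) × DyadicCode =>
        x.2.1.1 := Computable.fst.comp (Computable.fst.comp Computable.snd)
    have hd : Computable fun x : (α × DyadicCode) × (DyadicCode × DyadicCode) × DyadicCode =>
        x.2.1.2 := Computable.snd.comp (Computable.fst.comp Computable.snd)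
    have ht : Computable fun x : (α × DyadicCode) × (DyadicCode × DyadicCode) × DyadicCode =>
        x.1.1 := Computable.fst.comp Computable.fst
    exact re_exists₂ (re_and (hE.re_comp hc hd (Computable.snd.comp Computable.snd)
      (Computable.snd.comp Computable.fst)) (re_and (hl.re ht hc) (hu.re ht hd)))
  · rintro ⟨y, h1, h2, h3⟩
    exact (hE.sound _ ht _ _ _ _ h1 h2 h3).2
  · obtain ⟨a, -, ha⟩ := exists_dyadic_between (show f (z t) - 1 < f (z t) by linarith)
    obtain ⟨c, d, h1, h2, h3⟩ := hE.complete _ ht a b ha h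
    exact ⟨((c, d), a), h1, h2, h3⟩

theorem Enclosure.lowerRE {E : DyadicCode → DyadicCode → DyadicCode → DyadicCode → Prop}
    (hE : Enclosure f A E) {z : α → ℝ} (hz : ∀ a, z a ∈ A) (hl : LowerRE z) (hu : UpperRE z) :
    LowerRE fun a => f (z a) := by
  obtain ⟨R, hR, h⟩ := hE.exists_lower hl hu
  exact hR.of_eq fun x => h _ (hz _) _

theorem Enclosure.upperRE {E : DyadicCode → DyadicCode → DyadicCode → DyadicCode → Prop}
    (hE : Enclosure f A E) {z : α → ℝ} (hz : ∀ a, z a ∈ A) (hl : LowerRE z) (hu : UpperRE z) :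
    UpperRE fun a => f (z a) := by
  obtain ⟨R, hR, h⟩ := hE.exists_upper hl hu
  exact hR.of_eq fun x => h _ (hz _) _

/-- A family of numbers is given by recursively enumerable cuts if arbitrarily tight enclosures of
its members can be enumerated. -/
theorem lowerRE_upperRE_of_enclosures {z : α → ℝ} {R : α × DyadicCode × DyadicCode → Prop}
    (hR : REPred R) (hs : ∀ a c d, R (a, c, d) → dyadicVal c < z a ∧ z a < dyadicVal d)
    (hc : ∀ a (x y : ℝ), x < z a → z a < y →
      ∃ c d, R (a, c, d) ∧ x ≤ dyadicVal c ∧ dyadicVal d ≤ y) : LowerRE z ∧ UpperRE z := by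
  have hbase : REPred fun x : (α × DyadicCode) × DyadicCode × DyadicCode => R (x.1.1, x.2) :=
    re_comp hR (f := fun x : (α × DyadicCode) × DyadicCode × DyadicCode => (x.1.1, x.2))
      ((Computable.fst.comp Computable.fst).pair Computable.snd)
  constructor
  · have h : REPred fun x : α × DyadicCode => ∃ y : DyadicCode × DyadicCode, R (x.1, y) ∧
        dyadicVal x.2 ≤ dyadicVal y.1 :=
      re_exists₂ (re_and hbase (re_dLe (Computable.snd.comp Computable.fst)
        (Computable.fst.comp Computable.snd)))
    refine h.of_eq fun x => ⟨?_, fun hx => ?_⟩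
    · rintro ⟨⟨c, d⟩, h1, h2⟩
      exact h2.trans_lt (hs _ _ _ h1).1
    · obtain ⟨c, d, h1, h2, -⟩ := hc x.1 _ (z x.1 + 1) hx (by linarith)
      exact ⟨(c, d), h1, h2⟩
  · have h : REPred fun x : α × DyadicCode => ∃ y : DyadicCode × DyadicCode, R (x.1, y) ∧
        dyadicVal y.2 ≤ dyadicVal x.2 :=
      re_exists₂ (re_and hbase (re_dLe (Computable.snd.comp Computable.snd)
        (Computable.snd.comp Computable.fst)))
    refine h.of_eq fun x => ⟨?_, fun hx => ?_⟩
    · rintro ⟨⟨c, d⟩, h1, h2⟩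
      exact (hs _ _ _ h1).2.trans_le h2
    · obtain ⟨c, d, h1, -, h2⟩ := hc x.1 (z x.1 - 1) _ (by linarith) hx
      exact ⟨(c, d), h1, h2⟩

end Eval

namespace BranchedMap

variable {T : BranchedMap}

/-! ### Computation of points from their digits and of orbits -/

/-- The points with finitely many prescribed digits are computable, uniformly in the digits: an
enclosure of the fixed point is certified by the direction in which the decreasing first branch
moves its ends, and enclosures are pulled back along the monotone branches. -/
theorem Admissible.re_pt (hT : T.Admissible) {p : ℝ} (hp : p ∈ T.J 0) (hpp : T.G p = p) :
    LowerRE (T.pt p) ∧ UpperRE (T.pt p) := by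
  obtain ⟨E, hE⟩ := hT.computable.exists_enclosure
  obtain ⟨lo, h_lo, h_lo'⟩ := hE.exists_lower lowerRE_dyadicVal upperRE_dyadicVal
  obtain ⟨up, h_up, h_up'⟩ := hE.exists_upper lowerRE_dyadicVal upperRE_dyadicVal
  have hJ : ∀ {τ : Type} [Primcodable τ] {i : τ → ℕ} {c : τ → DyadicCode}, Computable i →
      Computable c → REPred fun t => dyadicVal (c t) ∈ T.J (i t) := fun hi hc =>
    re_comp₂ (r := fun i (c : DyadicCode) => dyadicVal c ∈ T.J i) hT.re_mem_J hi hc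
  -- a state `(w, c, d)` asserts `c < pt w < d`
  let init : List ℕ × DyadicCode × DyadicCode → Prop := fun s => s.1 = [] ∧
    dyadicVal s.2.1 ∈ T.J 0 ∧ dyadicVal s.2.2 ∈ T.J 0 ∧ lo s.2.1 s.2.1 ∧ up s.2.2 s.2.2
  let step : List ℕ × DyadicCode × DyadicCode → List ℕ × DyadicCode × DyadicCode → Prop :=
    fun s s' => ∃ i, s'.1 = i :: s.1 ∧ dyadicVal s'.2.1 ∈ T.J i ∧ dyadicVal s'.2.2 ∈ T.J i ∧
      dyadicVal s'.2.1 < dyadicVal s'.2.2 ∧ ((up s'.2.1 s.2.1 ∧ lo s'.2.2 s.2.2) ∨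
        (up s'.2.2 s.2.1 ∧ lo s'.2.1 s.2.2))
  have hinit : REPred init := by
    have h1 : Computable fun s : List ℕ × DyadicCode × DyadicCode => s.2.1 :=
      Computable.fst.comp Computable.snd
    have h2 : Computable fun s : List ℕ × DyadicCode × DyadicCode => s.2.2 :=
      Computable.snd.comp Computable.snd
    exact re_and (Primrec.eq.comp Primrec.fst (Primrec.const [])).rePred
      (re_and (hJ (Computable.const 0) h1) (re_and (hJ (Computable.const 0) h2)
        (re_and (re_comp₂ h_lo h1 h1) (re_comp₂ h_up h2 h2))))
  have hstep : REPred fun x : (List ℕ × DyadicCode × DyadicCode) ×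
      (List ℕ × DyadicCode × DyadicCode) => step x.1 x.2 := by
    have hc : Computable fun x : ((List ℕ × DyadicCode × DyadicCode) ×
        (List ℕ × DyadicCode × DyadicCode)) × ℕ => x.1.1.2.1 :=
      Computable.fst.comp (Computable.snd.comp (Computable.fst.comp Computable.fst))
    have hd : Computable fun x : ((List ℕ × DyadicCode × DyadicCode) ×
        (List ℕ × DyadicCode × DyadicCode)) × ℕ => x.1.1.2.2 :=
      Computable.snd.comp (Computable.snd.comp (Computable.fst.comp Computable.fst))
    have hc' : Computable fun x : ((List ℕ × DyadicCode × DyadicCode) ×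
        (List ℕ × DyadicCode × DyadicCode)) × ℕ => x.1.2.2.1 :=
      Computable.fst.comp (Computable.snd.comp (Computable.snd.comp Computable.fst))
    have hd' : Computable fun x : ((List ℕ × DyadicCode × DyadicCode) ×
        (List ℕ × DyadicCode × DyadicCode)) × ℕ => x.1.2.2.2 :=
      Computable.snd.comp (Computable.snd.comp (Computable.snd.comp Computable.fst))
    have hw : PrimrecPred fun x : ((List ℕ × DyadicCode × DyadicCode) ×
        (List ℕ × DyadicCode × DyadicCode)) × ℕ => x.1.2.1 = x.2 :: x.1.1.1 :=
      Primrec.eq.comp (Primrec.fst.comp (Primrec.snd.comp Primrec.fst))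
        (Primrec.list_cons.comp Primrec.snd (Primrec.fst.comp (Primrec.fst.comp Primrec.fst)))
    exact re_exists₂ (re_and hw.rePred (re_and (hJ Computable.snd hc')
      (re_and (hJ Computable.snd hd') (re_and (re_dLt hc' hd')
        (re_or (re_and (re_comp₂ h_up hc' hc) (re_comp₂ h_lo hd' hd))
          (re_and (re_comp₂ h_up hd' hc) (re_comp₂ h_lo hc' hd)))))))
  refine lowerRE_upperRE_of_enclosures (re_reach hinit hstep) ?_ ?_
  · rintro w c d ⟨s₀, h0, hr⟩
    have key : ∀ s, Relation.ReflTransGen step s₀ s →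
        dyadicVal s.2.1 < T.pt p s.1 ∧ T.pt p s.1 < dyadicVal s.2.2 := by
      intro s hr
      induction hr with
      | refl =>
        obtain ⟨hw, hc, hd, h1, h2⟩ := h0
        rw [h_lo' _ (mem_S hc)] at h1
        rw [h_up' _ (mem_S hd)] at h2
        rw [hw]
        constructor
        · by_contra hlt
          have := hT.decreasing.antitoneOn hp hc (not_lt.1 hlt)
          rw [hpp] at this
          exact hlt (h1.trans_le this)
        · by_contra hlt
          have := hT.decreasing.antitoneOn hd hp (not_lt.1 hlt)
          rw [hpp] at this
          exact hlt (this.trans_lt h2)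
      | @tail s s' _ hs ih =>
        obtain ⟨i, hw, hc, hd, hcd, h⟩ := hs
        have hx := hT.pt_cons_mem hp i s.1
        have hGx := hT.map_pt_cons hp i s.1
        rw [hw]
        rw [h_up' _ (mem_S hc), h_lo' _ (mem_S hd), h_up' _ (mem_S hd), h_lo' _ (mem_S hc)] at h
        rcases hT.strictMonoOn_or_strictAntiOn i with hm | hm
        · rcases h with ⟨h1, h2⟩ | ⟨h1, h2⟩
          · exact ⟨(hm.lt_iff_lt hc hx).1 (by rw [hGx]; exact h1.trans ih.1),
              (hm.lt_iff_lt hx hd).1 (by rw [hGx]; exact ih.2.trans h2)⟩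
          · have := hm hc hd hcd
            linarith
        · rcases h with ⟨h1, h2⟩ | ⟨h1, h2⟩
          · have := hm hc hd hcd
            linarith
          · exact ⟨(hm.lt_iff_gt hx hc).1 (by rw [hGx]; exact ih.2.trans h2),
              (hm.lt_iff_gt hd hx).1 (by rw [hGx]; exact h1.trans ih.1)⟩
    exact key _ hr
  · intro w
    induction w with
    | nil =>
      intro x y hx hy
      change x < p at hx
      change p < y at hy
      obtain ⟨c, hc1, hc2⟩ := exists_dyadic_between (max_lt hx hp.1)
      obtain ⟨d, hd1, hd2⟩ := exists_dyadic_between (lt_min hy hp.2)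
      rw [max_lt_iff] at hc1
      rw [lt_min_iff] at hd2
      have hc : dyadicVal c ∈ T.J 0 := ⟨hc1.2, hc2.trans hp.2⟩
      have hd : dyadicVal d ∈ T.J 0 := ⟨hp.1.trans hd1, hd2.2⟩
      refine ⟨c, d, ⟨([], c, d), ⟨rfl, hc, hd, ?_, ?_⟩, .refl⟩, hc1.1.le, hd2.1.le⟩
      · rw [h_lo' _ (mem_S hc)]
        have := hT.decreasing hc hp hc2
        rw [hpp] at this
        exact hc2.trans this
      · rw [h_up' _ (mem_S hd)]
        have := hT.decreasing hp hd hd1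
        rw [hpp] at this
        exact this.trans hd1
    | cons i w ih =>
      intro x y hx hy
      have hmem := hT.pt_cons_mem hp i w
      have hGx := hT.map_pt_cons hp i w
      obtain ⟨c, hc1, hc2⟩ := exists_dyadic_between (max_lt hx hmem.1)
      obtain ⟨d, hd1, hd2⟩ := exists_dyadic_between (lt_min hy hmem.2)
      rw [max_lt_iff] at hc1
      rw [lt_min_iff] at hd2
      have hc : dyadicVal c ∈ T.J i := ⟨hc1.2, hc2.trans hmem.2⟩
      have hd : dyadicVal d ∈ T.J i := ⟨hmem.1.trans hd1, hd2.2⟩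
      rcases hT.strictMonoOn_or_strictAntiOn i with hm | hm
      · have h1 := hm hc hmem hc2
        have h2 := hm hmem hd hd1
        rw [hGx] at h1 h2
        obtain ⟨e, e1, e2⟩ := exists_dyadic_between h1
        obtain ⟨f, f1, f2⟩ := exists_dyadic_between h2
        obtain ⟨c₀, d₀, ⟨s₀, h0, hr⟩, h3, h4⟩ := ih (dyadicVal e) (dyadicVal f) e2 f1
        refine ⟨c, d, ⟨s₀, h0, hr.tail ⟨i, rfl, hc, hd, hc2.trans hd1, .inl ⟨?_, ?_⟩⟩⟩,
          hc1.1.le, hd2.1.le⟩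
        · rw [h_up' _ (mem_S hc)]; exact e1.trans_le h3
        · rw [h_lo' _ (mem_S hd)]; exact h4.trans_lt f2
      · have h1 := hm hc hmem hc2
        have h2 := hm hmem hd hd1
        rw [hGx] at h1 h2
        obtain ⟨c₀, d₀, ⟨s₀, h0, hr⟩, h3, h4⟩ := ih _ _
          (exists_dyadic_between h2).choose_spec.2 (exists_dyadic_between h1).choose_spec.1
        refine ⟨c, d, ⟨s₀, h0, hr.tail ⟨i, rfl, hc, hd, hc2.trans hd1, .inr ⟨?_, ?_⟩⟩⟩,
          hc1.1.le, hd2.1.le⟩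
        · rw [h_up' _ (mem_S hd)]
          exact (exists_dyadic_between h2).choose_spec.1.trans_le h3
        · rw [h_lo' _ (mem_S hc)]
          exact h4.trans_lt (exists_dyadic_between h1).choose_spec.2

/-- The orbit of a computable point is computable. -/
theorem Admissible.re_iterate (hT : T.Admissible) {x : ℝ} (hx : x ∈ T.Lam)
    (hxc : ComputableReal x) : LowerRE (fun j => T.G^[j] x) ∧ UpperRE (fun j => T.G^[j] x) := by
  obtain ⟨E, hE⟩ := hT.computable.exists_enclosure
  -- a state `(j, c, d)` asserts `c < G^[j] x < d`
  let init : ℕ × DyadicCode × DyadicCode → Prop := fun s => s.1 = 0 ∧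
    dyadicVal s.2.1 < x ∧ x < dyadicVal s.2.2
  let step : ℕ × DyadicCode × DyadicCode → ℕ × DyadicCode × DyadicCode → Prop :=
    fun s s' => s'.1 = s.1 + 1 ∧ ∃ e : DyadicCode × DyadicCode, dyadicVal e.1 ≤ dyadicVal s.2.1 ∧
      dyadicVal s.2.2 ≤ dyadicVal e.2 ∧ E e.1 e.2 s'.2.1 s'.2.2
  have hinit : REPred init :=
    re_and (Primrec.eq.comp Primrec.fst (Primrec.const 0)).rePred
      (re_and (re_comp hxc.lower (f := fun s : ℕ × DyadicCode × DyadicCode => s.2.1)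
        (Computable.fst.comp Computable.snd))
      (re_comp hxc.upper (f := fun s : ℕ × DyadicCode × DyadicCode => s.2.2)
        (Computable.snd.comp Computable.snd)))
  have hstep : REPred fun y : (ℕ × DyadicCode × DyadicCode) × (ℕ × DyadicCode × DyadicCode) =>
      step y.1 y.2 :=
    re_and (Primrec.eq.comp (Primrec.fst.comp Primrec.snd)
        (Primrec.succ.comp (Primrec.fst.comp Primrec.fst))).rePred
      (re_exists₂ (by
        have h1 : Computable fun y : ((ℕ × DyadicCode × DyadicCode) × (ℕ × DyadicCode ×
            DyadicCode)) × DyadicCode × DyadicCode => y.2.1 := Computable.fst.comp Computable.snd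
        have h2 : Computable fun y : ((ℕ × DyadicCode × DyadicCode) × (ℕ × DyadicCode ×
            DyadicCode)) × DyadicCode × DyadicCode => y.2.2 := Computable.snd.comp Computable.snd
        have h3 : Computable fun y : ((ℕ × DyadicCode × DyadicCode) × (ℕ × DyadicCode ×
            DyadicCode)) × DyadicCode × DyadicCode => y.1.1.2.1 :=
          Computable.fst.comp (Computable.snd.comp (Computable.fst.comp Computable.fst))
        have h4 : Computable fun y : ((ℕ × DyadicCode × DyadicCode) × (ℕ × DyadicCode ×
            DyadicCode)) × DyadicCode × DyadicCode => y.1.1.2.2 :=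
          Computable.snd.comp (Computable.snd.comp (Computable.fst.comp Computable.fst))
        have h5 : Computable fun y : ((ℕ × DyadicCode × DyadicCode) × (ℕ × DyadicCode ×
            DyadicCode)) × DyadicCode × DyadicCode => y.1.2.2.1 :=
          Computable.fst.comp (Computable.snd.comp (Computable.snd.comp Computable.fst))
        have h6 : Computable fun y : ((ℕ × DyadicCode × DyadicCode) × (ℕ × DyadicCode ×
            DyadicCode)) × DyadicCode × DyadicCode => y.1.2.2.2 :=
          Computable.snd.comp (Computable.snd.comp (Computable.snd.comp Computable.fst))
        exact re_and (re_dLe h1 h3) (re_and (re_dLe h4 h2) (hE.re_comp h1 h2 h5 h6))))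
  refine lowerRE_upperRE_of_enclosures (re_reach hinit hstep) ?_ ?_
  · rintro j c d ⟨s₀, h0, hr⟩
    have key : ∀ s, Relation.ReflTransGen step s₀ s →
        dyadicVal s.2.1 < T.G^[s.1] x ∧ T.G^[s.1] x < dyadicVal s.2.2 := by
      intro s hr
      induction hr with
      | refl =>
        obtain ⟨hw, hc, hd⟩ := h0
        rw [hw]
        exact ⟨hc, hd⟩
      | @tail s s' _ hs ih =>
        obtain ⟨hw, e, h1, h2, h⟩ := hs
        rw [hw, Function.iterate_succ_apply']
        exact hE.sound _ (hx s.1) _ _ _ _ h (h1.trans_lt ih.1) (ih.2.trans_le h2)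
    exact key _ hr
  · intro j
    induction j with
    | zero =>
      intro a b ha hb
      obtain ⟨c, hc1, hc2⟩ := exists_dyadic_between ha
      obtain ⟨d, hd1, hd2⟩ := exists_dyadic_between hb
      exact ⟨c, d, ⟨(0, c, d), ⟨rfl, hc2, hd1⟩, .refl⟩, hc1.le, hd2.le⟩
    | succ j ih =>
      intro a b ha hb
      rw [Function.iterate_succ_apply'] at ha hb
      obtain ⟨c, hc1, hc2⟩ := exists_dyadic_between ha
      obtain ⟨d, hd1, hd2⟩ := exists_dyadic_between hb
      obtain ⟨e, f, h1, h2, h3⟩ := hE.complete _ (hx j) c d hc2 hd1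
      obtain ⟨e', f', ⟨s₀, h0, hr⟩, h4, h5⟩ := ih _ _ h2 h3
      exact ⟨c, d, ⟨s₀, h0, hr.tail ⟨rfl, (e, f), h4, h5, h1⟩⟩, hc1.le, hd2.le⟩

end BranchedMap

/-! ### Powers with a computable exponent -/

section Power

variable {α : Type*} [Primcodable α]

theorem primrec_nat_two_pow : Primrec fun n : ℕ => (2 ^ n : ℕ) := by
  refine (Primrec.nat_rec₁ (f := fun _ b => 2 * b) 1
    (Primrec.nat_double.comp Primrec.snd).to₂).of_eq fun n => ?_
  induction n with
  | zero => rfl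
  | succ n ih => simp only [ih, pow_succ]; ring

theorem primrec_natCast_pair : Primrec fun x : ℕ × ℕ => (((x.1 : ℤ), x.2) : DyadicCode) :=
  ((primrec_natCast_sub.comp Primrec.fst (Primrec.const 0)).of_eq fun x => by simp).pair Primrec.snd

theorem pow_two_pow_eq {c : ℝ} (hc : 0 < c) (k l : ℕ) :
    (c ^ dyadicVal ((k : ℤ), l)) ^ (2 ^ l) = c ^ k := by
  rw [← Real.rpow_natCast, ← Real.rpow_mul hc.le, ← Real.rpow_natCast]
  congr 1
  simp [dyadicVal]

theorem exists_natCast_dyadic_between {x y : ℝ} (hx : 0 ≤ x) (h : x < y) :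
    ∃ k l : ℕ, x < dyadicVal ((k : ℤ), l) ∧ dyadicVal ((k : ℤ), l) < y := by
  obtain ⟨⟨s, l⟩, h1, h2⟩ := exists_dyadic_between h
  have hs : 0 ≤ s := by
    by_contra hlt
    have : dyadicVal (s, l) ≤ 0 := div_nonpos_of_nonpos_of_nonneg
      (by exact_mod_cast (not_le.1 hlt).le) (by positivity)
    linarith
  lift s to ℕ using hs
  exact ⟨s, l, h1, h2⟩

variable {f : α → ℝ} {ν : ℝ}

/-- To certify `b < f a ^ ν`, find a dyadic number `c < f a` and a dyadic exponent `k / 2 ^ l > ν`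
with `b ^ (2 ^ l) < c ^ k`; a larger exponent makes powers of numbers in `(0, 1)` smaller. -/
theorem LowerRE.rpow (hf : LowerRE f) (h0 : ∀ a, 0 < f a) (h1 : ∀ a, f a < 1) (hν : 0 < ν)
    (hνc : ComputableReal ν) : LowerRE fun a => f a ^ ν := by
  have hz : dyadicVal (0, 0) = 0 := by simp [dyadicVal]
  have h : REPred fun x : α × DyadicCode => dyadicVal x.2 < dyadicVal (0, 0) ∨
      ∃ y : DyadicCode × ℕ × ℕ, dyadicVal y.1 < f x.1 ∧ ν < dyadicVal ((y.2.1 : ℤ), y.2.2) ∧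
        dyadicVal (0, 0) < dyadicVal y.1 ∧
        dyadicVal (dPow x.2 (2 ^ y.2.2)) < dyadicVal (dPow y.1 y.2.1) := by
    refine re_or (re_dLt Computable.snd (Computable.const _)) (re_exists₂ ?_)
    have hb : Computable fun x : (α × DyadicCode) × DyadicCode × ℕ × ℕ => x.1.2 :=
      Computable.snd.comp Computable.fst
    have hc : Computable fun x : (α × DyadicCode) × DyadicCode × ℕ × ℕ => x.2.1 :=
      Computable.fst.comp Computable.snd
    have hk : Computable fun x : (α × DyadicCode) × DyadicCode × ℕ × ℕ => x.2.2.1 :=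
      Computable.fst.comp (Computable.snd.comp Computable.snd)
    have hl : Computable fun x : (α × DyadicCode) × DyadicCode × ℕ × ℕ => x.2.2.2 :=
      Computable.snd.comp (Computable.snd.comp Computable.snd)
    exact re_and (hf.re (Computable.fst.comp Computable.fst) hc)
      (re_and (re_comp hνc.upper (f := fun x : (α × DyadicCode) × DyadicCode × ℕ × ℕ =>
        (((x.2.2.1 : ℤ), x.2.2.2) : DyadicCode)) (primrec_natCast_pair.to_comp.comp (hk.pair hl)))
      (re_and (re_dLt (Computable.const _) hc)
        (re_dLt (primrec_dPow.to_comp.comp hb (primrec_nat_two_pow.to_comp.comp hl))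
          (primrec_dPow.to_comp.comp hc hk))))
  refine h.of_eq fun x => ?_
  simp only [hz, dyadicVal_dPow]
  constructor
  · rintro (hx | ⟨⟨c, k, l⟩, h2, h3, h4, h5⟩)
    · exact hx.trans (Real.rpow_pos_of_pos (h0 _) ν)
    · dsimp only at h2 h3 h4 h5
      rw [← pow_two_pow_eq h4] at h5
      calc dyadicVal x.2 < dyadicVal c ^ dyadicVal ((k : ℤ), l) :=
            lt_of_pow_lt_pow_left₀ _ (Real.rpow_nonneg h4.le _) h5
        _ ≤ dyadicVal c ^ ν :=
            Real.rpow_le_rpow_of_exponent_ge h4 (h2.trans (h1 _)).le h3.le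
        _ ≤ f x.1 ^ ν := Real.rpow_le_rpow h4.le h2.le hν.le
  · intro hx
    rcases lt_or_ge (dyadicVal x.2) 0 with hb | hb
    · exact .inl hb
    · right
      have e1 : ∀ᶠ c in 𝓝[<] f x.1, dyadicVal x.2 < c ^ ν :=
        ((Real.continuousAt_rpow_const _ _ (.inl (h0 _).ne')).eventually_const_lt hx).filter_mono
          nhdsWithin_le_nhds
      obtain ⟨c₀, hc₀, hc₁, hc₂⟩ :=
        (e1.and (Ioo_mem_nhdsLT (h0 x.1))).exists
      obtain ⟨c, hc3, hc4⟩ := exists_dyadic_between hc₂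
      have hcp := hc₁.trans hc3
      have hcν : dyadicVal x.2 < dyadicVal c ^ ν :=
        hc₀.trans (Real.rpow_lt_rpow hc₁.le hc3 hν)
      have e2 : ∀ᶠ s in 𝓝[>] ν, dyadicVal x.2 < dyadicVal c ^ s :=
        ((Real.continuousAt_const_rpow hcp.ne').eventually_const_lt hcν).filter_mono
          nhdsWithin_le_nhds
      obtain ⟨s, hs1, hs2⟩ := (e2.and self_mem_nhdsWithin).exists
      obtain ⟨k, l, hk1, hk2⟩ := exists_natCast_dyadic_between hν.le hs2
      refine ⟨(c, k, l), hc4, hk1, hcp, ?_⟩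
      dsimp only
      rw [← pow_two_pow_eq hcp]
      exact pow_lt_pow_left₀ (hs1.trans_le (Real.rpow_le_rpow_of_exponent_ge hcp
        (hc4.trans (h1 _)).le hk2.le)) hb (by positivity)

theorem UpperRE.rpow (hf : UpperRE f) (h0 : ∀ a, 0 < f a) (h1 : ∀ a, f a < 1) (hν : 0 < ν)
    (hνc : ComputableReal ν) : UpperRE fun a => f a ^ ν := by
  have hz : dyadicVal (0, 0) = 0 := by simp [dyadicVal]
  have h : REPred fun x : α × DyadicCode =>
      ∃ y : DyadicCode × ℕ × ℕ, f x.1 < dyadicVal y.1 ∧ dyadicVal ((y.2.1 : ℤ), y.2.2) < ν ∧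
        dyadicVal (0, 0) < dyadicVal x.2 ∧
        dyadicVal (dPow y.1 y.2.1) < dyadicVal (dPow x.2 (2 ^ y.2.2)) := by
    refine re_exists₂ ?_
    have hb : Computable fun x : (α × DyadicCode) × DyadicCode × ℕ × ℕ => x.1.2 :=
      Computable.snd.comp Computable.fst
    have hc : Computable fun x : (α × DyadicCode) × DyadicCode × ℕ × ℕ => x.2.1 :=
      Computable.fst.comp Computable.snd
    have hk : Computable fun x : (α × DyadicCode) × DyadicCode × ℕ × ℕ => x.2.2.1 :=
      Computable.fst.comp (Computable.snd.comp Computable.snd)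
    have hl : Computable fun x : (α × DyadicCode) × DyadicCode × ℕ × ℕ => x.2.2.2 :=
      Computable.snd.comp (Computable.snd.comp Computable.snd)
    exact re_and (hf.re (Computable.fst.comp Computable.fst) hc)
      (re_and (re_comp hνc.lower (f := fun x : (α × DyadicCode) × DyadicCode × ℕ × ℕ =>
        (((x.2.2.1 : ℤ), x.2.2.2) : DyadicCode)) (primrec_natCast_pair.to_comp.comp (hk.pair hl)))
      (re_and (re_dLt (Computable.const _) hb)
        (re_dLt (primrec_dPow.to_comp.comp hc hk)
          (primrec_dPow.to_comp.comp hb (primrec_nat_two_pow.to_comp.comp hl)))))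
  refine h.of_eq fun x => ?_
  simp only [hz, dyadicVal_dPow]
  constructor
  · rintro ⟨⟨c, k, l⟩, h2, h3, h4, h5⟩
    dsimp only at h2 h3 h4 h5
    have hc := (h0 x.1).trans h2
    rw [← pow_two_pow_eq hc] at h5
    have hs : 0 ≤ dyadicVal ((k : ℤ), l) := by
      simp only [dyadicVal]
      positivity
    calc f x.1 ^ ν ≤ f x.1 ^ dyadicVal ((k : ℤ), l) :=
          Real.rpow_le_rpow_of_exponent_ge (h0 _) (h1 _).le h3.le
      _ ≤ dyadicVal c ^ dyadicVal ((k : ℤ), l) := Real.rpow_le_rpow (h0 _).le h2.le hs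
      _ < dyadicVal x.2 := lt_of_pow_lt_pow_left₀ _ h4.le h5
  · intro hx
    have hb := (Real.rpow_pos_of_pos (h0 x.1) ν).trans hx
    have e2 : ∀ᶠ s in 𝓝[<] ν, f x.1 ^ s < dyadicVal x.2 :=
      ((Real.continuousAt_const_rpow (h0 x.1).ne').eventually_lt_const hx).filter_mono
        nhdsWithin_le_nhds
    obtain ⟨s, hs1, hs0, hs2⟩ := (e2.and (Ioo_mem_nhdsLT hν)).exists
    obtain ⟨k, l, hk1, hk2⟩ := exists_natCast_dyadic_between hs0.le hs2
    have hfk : f x.1 ^ dyadicVal ((k : ℤ), l) < dyadicVal x.2 :=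
      (Real.rpow_le_rpow_of_exponent_ge (h0 _) (h1 _).le hk1.le).trans_lt hs1
    have e1 : ∀ᶠ c in 𝓝[>] f x.1, c ^ dyadicVal ((k : ℤ), l) < dyadicVal x.2 :=
      ((Real.continuousAt_rpow_const _ _ (.inl (h0 _).ne')).eventually_lt_const hfk).filter_mono
        nhdsWithin_le_nhds
    obtain ⟨c₀, hc₀, hc₂⟩ := (e1.and self_mem_nhdsWithin).exists
    obtain ⟨c, hc3, hc4⟩ := exists_dyadic_between hc₂
    have hcp := (h0 x.1).trans hc3
    refine ⟨(c, k, l), hc3, hk2, hb, ?_⟩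
    dsimp only
    rw [← pow_two_pow_eq hcp]
    exact pow_lt_pow_left₀ ((Real.rpow_le_rpow hcp.le hc4.le (hs0.trans hk1).le).trans_lt hc₀)
      (Real.rpow_nonneg hcp.le _) (by positivity)

end Power

/-! ### Effectivity of the generalized Brjuno function -/

theorem exists_dyadic_add_mul_ge {U V W t : ℝ} (hV : 0 < V) (hW : 0 < W) (h : t < U + V * W) :
    ∃ b c w : DyadicCode, dyadicVal b < U ∧ 0 < dyadicVal c ∧ dyadicVal c < V ∧
      0 < dyadicVal w ∧ dyadicVal w < W ∧ t ≤ dyadicVal b + dyadicVal c * dyadicVal w := by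
  have hc : ContinuousAt (fun s : ℝ => (U - s) + (V - s) * (W - s)) 0 := by fun_prop
  have h1 : ∀ᶠ s : ℝ in 𝓝[>] 0, t < (U - s) + (V - s) * (W - s) :=
    (hc.eventually_const_lt (by simpa using h)).filter_mono nhdsWithin_le_nhds
  obtain ⟨s, hs, hs0, hs1⟩ := (h1.and (Ioo_mem_nhdsGT (lt_min hV hW))).exists
  rw [lt_min_iff] at hs1
  obtain ⟨b, hb1, hb2⟩ := exists_dyadic_between (show U - s < U by linarith)
  obtain ⟨c, hc1, hc2⟩ := exists_dyadic_between (show V - s < V by linarith)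
  obtain ⟨w, hw1, hw2⟩ := exists_dyadic_between (show W - s < W by linarith)
  refine ⟨b, c, w, hb2, by linarith, hc2, by linarith, hw2, ?_⟩
  have := mul_le_mul hc1.le hw1.le (by linarith) (by linarith)
  linarith

theorem exists_dyadic_add_mul_le {U V W t : ℝ} (hV : 0 < V) (hW : 0 < W) (h : U + V * W < t) :
    ∃ b c w : DyadicCode, U < dyadicVal b ∧ V < dyadicVal c ∧ W < dyadicVal w ∧
      dyadicVal b + dyadicVal c * dyadicVal w ≤ t := by
  have hc : ContinuousAt (fun s : ℝ => (U + s) + (V + s) * (W + s)) 0 := by fun_prop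
  have h1 : ∀ᶠ s : ℝ in 𝓝[>] 0, (U + s) + (V + s) * (W + s) < t :=
    (hc.eventually_lt_const (by simpa using h)).filter_mono nhdsWithin_le_nhds
  obtain ⟨s, hs, hs0⟩ := (h1.and self_mem_nhdsWithin).exists
  obtain ⟨b, hb1, hb2⟩ := exists_dyadic_between (show U < U + s by linarith)
  obtain ⟨c, hc1, hc2⟩ := exists_dyadic_between (show V < V + s by linarith)
  obtain ⟨w, hw1, hw2⟩ := exists_dyadic_between (show W < W + s by linarith)
  refine ⟨b, c, w, hb1, hc1, hw1, ?_⟩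
  have := mul_le_mul hc2.le hw2.le (by linarith) (by linarith)
  linarith

namespace BranchedMap

variable {T : BranchedMap}

section LowerCut

variable {α : Type*} [Primcodable α]

/-- If `Φ` is finite along a computable family of points stable under the map, the values of `Φ`
have enumerable lower cuts: all terms are positive, so finitely many of them certify a lower
bound, which the functional equation of `Φ` assembles. -/
theorem lowerRE_realPhi (hT : T.Admissible) {u : ℝ → ℝ} (hu : T.Weight u) {ν : ℝ} {z : α → ℝ}
    {next : α → α} (hnext : Computable next) (hz : ∀ a, z a ∈ T.Lam)
    (hG : ∀ a, T.G (z a) = z (next a)) (hconv : ∀ a, T.Converges u ν (z a))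
    (hl : LowerRE fun a => z a ^ ν) (hul : LowerRE fun a => u (z a)) :
    LowerRE fun a => T.realPhi u ν (z a) := by
  have hzero : dyadicVal (0, 0) = 0 := by simp [dyadicVal]
  have hpow : ∀ a, 0 < z a ^ ν := fun a => Real.rpow_pos_of_pos (hT.pos (hz a 0)) ν
  have hΦ : ∀ a, T.realPhi u ν (z a) = u (z a) + z a ^ ν * T.realPhi u ν (z (next a)) := by
    intro a
    rw [realPhi_eq hT (hz a) (hconv a), hG]
  -- a state `(a, e)` asserts `e < Φ (z a)`
  let step : α × DyadicCode → α × DyadicCode → Prop := fun s s' => next s'.1 = s.1 ∧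
    ∃ y : DyadicCode × DyadicCode, dyadicVal y.1 < u (z s'.1) ∧ dyadicVal y.2 < z s'.1 ^ ν ∧
      dyadicVal (0, 0) < dyadicVal y.2 ∧ dyadicVal s'.2 ≤ dyadicVal (dAdd y.1 (dMul y.2 s.2))
  have hstep : REPred fun x : (α × DyadicCode) × (α × DyadicCode) => step x.1 x.2 := by
    refine re_and (re_comp (re_graph hnext) (f := fun x : (α × DyadicCode) × (α × DyadicCode) =>
      (x.2.1, x.1.1)) ((Computable.fst.comp Computable.snd).pair
        (Computable.fst.comp Computable.fst))) (re_exists₂ ?_)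
    have h1 : Computable fun x : ((α × DyadicCode) × (α × DyadicCode)) × DyadicCode × DyadicCode =>
        x.2.1 := Computable.fst.comp Computable.snd
    have h2 : Computable fun x : ((α × DyadicCode) × (α × DyadicCode)) × DyadicCode × DyadicCode =>
        x.2.2 := Computable.snd.comp Computable.snd
    have h3 : Computable fun x : ((α × DyadicCode) × (α × DyadicCode)) × DyadicCode × DyadicCode =>
        x.1.2.1 := Computable.fst.comp (Computable.snd.comp Computable.fst)
    have h4 : Computable fun x : ((α × DyadicCode) × (α × DyadicCode)) × DyadicCode × DyadicCode =>
        x.1.2.2 := Computable.snd.comp (Computable.snd.comp Computable.fst)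
    have h5 : Computable fun x : ((α × DyadicCode) × (α × DyadicCode)) × DyadicCode × DyadicCode =>
        x.1.1.2 := Computable.snd.comp (Computable.fst.comp Computable.fst)
    exact re_and (hul.re h3 h1) (re_and (hl.re h3 h2) (re_and (re_dLt (Computable.const _) h2)
      (re_dLe h4 (primrec_dAdd.to_comp.comp h1 (primrec_dMul.to_comp.comp h2 h5)))))
  refine (re_reach hul hstep).of_eq fun s => ⟨?_, ?_⟩
  · rintro ⟨s₀, h0, hr⟩
    induction hr with
    | refl =>
      dsimp only at h0 ⊢
      rw [hΦ]
      have := mul_pos (hpow s₀.1) (realPhi_pos hT hu (hz (next s₀.1)) (hconv _))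
      linarith
    | @tail s s' _ hs ih =>
      obtain ⟨hw, y, h1, h2, h3, h4⟩ := hs
      rw [dyadicVal_dAdd, dyadicVal_dMul] at h4
      rw [hzero] at h3
      dsimp only at ih ⊢
      rw [hΦ, hw]
      have hpos := realPhi_pos hT hu (hz s.1) (hconv _)
      have := mul_le_mul_of_nonneg_left ih.le h3.le
      have := mul_le_mul_of_nonneg_right h2.le hpos.le
      linarith
  · have key : ∀ (n : ℕ) (s : α × DyadicCode),
        dyadicVal s.2 < ∑ i ∈ Finset.range (n + 1), T.term u ν i (z s.1) →
        ∃ s₀, dyadicVal s₀.2 < u (z s₀.1) ∧ Relation.ReflTransGen step s₀ s := by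
      intro n
      induction n with
      | zero =>
        intro s hs
        rw [Finset.sum_range_one, term_zero] at hs
        exact ⟨s, hs, .refl⟩
      | succ n ih =>
        intro s hs
        have e : ∑ i ∈ Finset.range (n + 1 + 1), T.term u ν i (z s.1) = u (z s.1) +
            z s.1 ^ ν * ∑ i ∈ Finset.range (n + 1), T.term u ν i (z (next s.1)) := by
          rw [Finset.sum_range_succ', term_zero, add_comm, Finset.mul_sum]
          congr 1
          refine Finset.sum_congr rfl fun i _ => ?_
          have := term_add (u := u) (ν := ν) hT (hz s.1) 1 i
          rw [orbitProd_one, Function.iterate_one, hG] at this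
          rw [add_comm, this]
        rw [e] at hs
        obtain ⟨b, c, w, h1, h2, h3, -, h5, h6⟩ := exists_dyadic_add_mul_ge (hpow s.1)
          (Finset.sum_pos (fun i _ => term_pos hT hu (hz (next s.1)) i) (by simp)) hs
        obtain ⟨s₀, h0, hr⟩ := ih (next s.1, w) h5
        refine ⟨s₀, h0, hr.tail ⟨rfl, (b, c), h1, h3, by rwa [hzero], ?_⟩⟩
        rwa [dyadicVal_dAdd, dyadicVal_dMul]
    intro hs
    have hlim := (hconv s.1).hasSum.tendsto_sum_nat.comp (tendsto_add_atTop_nat 1)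
    obtain ⟨n, hn⟩ := (hlim.eventually_const_lt hs).exists
    exact key n s hn

end LowerCut

/-- `Φ` has enumerable upper cuts on the points with finitely many prescribed digits. The value
at the fixed point is bounded through its functional equation: `u p + p ^ ν * e < e` forces
`Φ p < e`. -/
theorem upperRE_realPhi_pt (hT : T.Admissible) {p : ℝ} (hp : p ∈ T.J 0) (hpp : T.G p = p)
    {u : ℝ → ℝ} (hu : T.Weight u) {ν : ℝ} (hν : 0 < ν)
    (hl : UpperRE fun w => T.pt p w ^ ν) (hul : UpperRE fun w => u (T.pt p w)) :
    UpperRE fun w => T.realPhi u ν (T.pt p w) := by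
  have hz : ∀ w, T.pt p w ∈ T.Lam := hT.pt_mem_Lam hp hpp
  have hconv : ∀ w, T.Converges u ν (T.pt p w) := converges_pt hT hp hpp hν
  have hpow : ∀ w, 0 < T.pt p w ^ ν := fun w => Real.rpow_pos_of_pos (hT.pos (hz w 0)) ν
  have hpos : ∀ w, 0 < T.realPhi u ν (T.pt p w) := fun w => realPhi_pos hT hu (hz w) (hconv w)
  have hΦ : ∀ w, T.realPhi u ν (T.pt p w) =
      u (T.pt p w) + T.pt p w ^ ν * T.realPhi u ν (T.pt p w.tail) := by
    intro w
    rw [realPhi_eq hT (hz w) (hconv w), hT.map_pt hp hpp]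
  have hzero : dyadicVal (0, 0) = 0 := by simp [dyadicVal]
  let above : List ℕ → DyadicCode → DyadicCode → Prop := fun w e e' =>
    ∃ y : DyadicCode × DyadicCode, u (T.pt p w) < dyadicVal y.1 ∧ T.pt p w ^ ν < dyadicVal y.2 ∧
      dyadicVal (dAdd y.1 (dMul y.2 e)) ≤ dyadicVal e'
  have habove : REPred fun x : (List ℕ × DyadicCode) × DyadicCode => above x.1.1 x.1.2 x.2 := by
    refine re_exists₂ ?_
    have h1 : Computable fun x : ((List ℕ × DyadicCode) × DyadicCode) × DyadicCode × DyadicCode =>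
        x.2.1 := Computable.fst.comp Computable.snd
    have h2 : Computable fun x : ((List ℕ × DyadicCode) × DyadicCode) × DyadicCode × DyadicCode =>
        x.2.2 := Computable.snd.comp Computable.snd
    have h3 : Computable fun x : ((List ℕ × DyadicCode) × DyadicCode) × DyadicCode × DyadicCode =>
        x.1.1.1 := Computable.fst.comp (Computable.fst.comp Computable.fst)
    have h4 : Computable fun x : ((List ℕ × DyadicCode) × DyadicCode) × DyadicCode × DyadicCode =>
        x.1.1.2 := Computable.snd.comp (Computable.fst.comp Computable.fst)
    have h5 : Computable fun x : ((List ℕ × DyadicCode) × DyadicCode) × DyadicCode × DyadicCode =>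
        x.1.2 := Computable.snd.comp Computable.fst
    exact re_and (hul.re h3 h1) (re_and (hl.re h3 h2)
      (re_dLe (primrec_dAdd.to_comp.comp h1 (primrec_dMul.to_comp.comp h2 h4)) h5))
  have habove_lt : ∀ w e e', 0 < dyadicVal e → above w e e' →
      u (T.pt p w) + T.pt p w ^ ν * dyadicVal e < dyadicVal e' := by
    rintro w e e' he ⟨y, h1, h2, h3⟩
    rw [dyadicVal_dAdd, dyadicVal_dMul] at h3
    have := mul_le_mul_of_nonneg_right h2.le he.le
    linarith
  have hle_above : ∀ w (W : ℝ) e', 0 < W → u (T.pt p w) + T.pt p w ^ ν * W < dyadicVal e' →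
      ∃ e, W < dyadicVal e ∧ above w e e' := by
    intro w W e' hW h
    obtain ⟨b, c, e, h1, h2, h3, h4⟩ := exists_dyadic_add_mul_le (hpow w) hW h
    exact ⟨e, h3, (b, c), h1, h2, by rwa [dyadicVal_dAdd, dyadicVal_dMul]⟩
  -- a state `(w, e)` asserts `Φ (pt w) < e`
  let init : List ℕ × DyadicCode → Prop := fun s => s.1 = [] ∧
    dyadicVal (0, 0) < dyadicVal s.2 ∧ above s.1 s.2 s.2
  let step : List ℕ × DyadicCode → List ℕ × DyadicCode → Prop := fun s s' =>
    s'.1 ≠ [] ∧ s'.1.tail = s.1 ∧ above s'.1 s.2 s'.2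
  have hinit : REPred init := by
    refine re_and (Primrec.eq.comp Primrec.fst (Primrec.const [])).rePred
      (re_and (re_dLt (Computable.const _) Computable.snd) ?_)
    exact re_comp habove (f := fun s : List ℕ × DyadicCode => ((s.1, s.2), s.2))
      (Computable.id.pair Computable.snd)
  have hstep : REPred fun x : (List ℕ × DyadicCode) × (List ℕ × DyadicCode) => step x.1 x.2 := by
    have h1 : Primrec fun x : (List ℕ × DyadicCode) × (List ℕ × DyadicCode) => x.2.1 :=
      Primrec.fst.comp Primrec.snd
    refine re_and (Primrec.eq.comp h1 (Primrec.const [])).not.rePred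
      (re_and (Primrec.eq.comp (Primrec.list_tail.comp h1)
        (Primrec.fst.comp Primrec.fst)).rePred ?_)
    exact re_comp habove (f := fun x : (List ℕ × DyadicCode) × (List ℕ × DyadicCode) =>
      ((x.2.1, x.1.2), x.2.2)) ((h1.to_comp.pair (Computable.snd.comp Computable.fst)).pair
        (Computable.snd.comp Computable.snd))
  refine (re_reach hinit hstep).of_eq fun s => ⟨?_, ?_⟩
  · rintro ⟨s₀, ⟨hw, h0, h1⟩, hr⟩
    induction hr with
    | refl =>
      rw [hzero] at h0
      have h2 := habove_lt _ _ _ h0 h1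
      have h3 := hΦ s₀.1
      rw [hw] at h2 h3 ⊢
      rw [List.tail_nil] at h3
      have h4 : T.pt p [] ^ ν < 1 :=
        Real.rpow_lt_one (hT.pos (hz [] 0)).le (hT.lt_one (hz [] 0)) hν
      by_contra hlt
      have := mul_le_mul_of_nonneg_left (not_lt.1 hlt) (sub_pos.2 h4).le
      linarith
    | @tail s s' _ hs ih =>
      obtain ⟨-, hw', h⟩ := hs
      have h2 := habove_lt _ _ _ ((hpos _).trans ih) h
      dsimp only at ih ⊢
      rw [hΦ, hw']
      have := mul_le_mul_of_nonneg_left ih.le (hpow s'.1).le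
      linarith
  · obtain ⟨w, e⟩ := s
    induction w generalizing e with
    | nil =>
      intro h
      dsimp only at h
      have h3 := hΦ []
      rw [List.tail_nil] at h3
      have h4 : T.pt p [] ^ ν < 1 :=
        Real.rpow_lt_one (hT.pos (hz [] 0)).le (hT.lt_one (hz [] 0)) hν
      have he := (hpos []).trans h
      obtain ⟨e', h5, y, h6, h7, h8⟩ := hle_above [] (dyadicVal e) e he (by nlinarith)
      refine ⟨([], e), ⟨rfl, by rwa [hzero], y, h6, h7, le_trans ?_ h8⟩, .refl⟩
      simp only [dyadicVal_dAdd, dyadicVal_dMul]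
      have := mul_le_mul_of_nonneg_left h5.le ((hpow []).trans h7).le
      linarith
    | cons i w ih =>
      intro h
      dsimp only at h
      rw [hΦ, List.tail_cons] at h
      obtain ⟨e', h5, h6⟩ := hle_above _ _ e (hpos w) h
      obtain ⟨s₀, h0, hr⟩ := ih e' h5
      exact ⟨s₀, h0, hr.tail ⟨List.cons_ne_nil _ _, rfl, h6⟩⟩

end BranchedMap

/-! ### A left-computable number that is not computable -/

/-- Above every bound there is a left-computable number that is not computable. If `χ n s` says
that the machine number `n` halts before stage `s`, take the limit of the numbers
`m + ∑_(n < s, χ n s) 2 ^ (-n)`; good upper bounds for it would certify that a machine does not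
halt. -/
theorem exists_leftComputableReal_not_computableReal (M : ℝ) :
    ∃ y, M ≤ y ∧ LeftComputableReal y ∧ ¬ ComputableReal y := by
  obtain ⟨R, hR, hK⟩ := rePred_iff.1 (re_comp (ComputablePred.halting_problem_re 0)
    (f := fun n : ℕ => Denumerable.ofNat Nat.Partrec.Code n) (Primrec.ofNat _).to_comp)
  let χ : ℕ → ℕ → Prop := fun n s => ∃ t < s, R (n, t)
  have hχ : PrimrecPred fun x : ℕ × ℕ => χ x.1 x.2 := by
    have h : PrimrecRel fun (t : ℕ) (n : ℕ) => R (n, t) :=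
      hR.comp (Primrec.snd.pair Primrec.fst)
    exact ((h.exists_mem_list.comp (Primrec.list_range.comp Primrec.snd) Primrec.fst)).of_eq
      fun x => by simp [χ]
  have hχmono : ∀ n s t, s ≤ t → χ n s → χ n t := fun n s t h ⟨j, hj, hr⟩ => ⟨j, hj.trans_le h, hr⟩
  have hχK : ∀ n, ((Denumerable.ofNat Nat.Partrec.Code n).eval 0).Dom ↔ ∃ s, χ n s := by
    intro n
    rw [hK]
    exact ⟨fun ⟨t, ht⟩ => ⟨t + 1, t, t.lt_succ_self, ht⟩, fun ⟨_, t, _, ht⟩ => ⟨t, ht⟩⟩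
  obtain ⟨hd, hχd⟩ := hχ
  let hdec : ∀ n s, Decidable (χ n s) := fun n s => hd (n, s)
  obtain ⟨m, hm⟩ := exists_nat_ge M
  let b : ℕ → ℕ → DyadicCode := fun s k => Nat.rec (((m : ℤ), 0) : DyadicCode)
    (fun n e => bif decide (χ n s) then dAdd e (dEps n) else e) k
  let a : ℕ → DyadicCode := fun s => b s s
  have ha : Primrec a := by
    refine Primrec.nat_rec' Primrec.id (Primrec.const _)
      (h := fun s (x : ℕ × DyadicCode) => bif decide (χ x.1 s) then dAdd x.2 (dEps x.1) else x.2) ?_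
    have h1 : Primrec fun x : ℕ × ℕ × DyadicCode => x.2.1 := Primrec.fst.comp Primrec.snd
    have h2 : Primrec fun x : ℕ × ℕ × DyadicCode => x.2.2 := Primrec.snd.comp Primrec.snd
    exact Primrec.cond (hχd.comp (h1.pair Primrec.fst))
      (primrec_dAdd.comp h2 (primrec_dEps.comp h1)) h2
  let g : ℕ → ℕ → ℝ := fun s n => if χ n s then (1 / 2 : ℝ) ^ n else 0
  have hb : ∀ s k, dyadicVal (b s k) = m + ∑ n ∈ Finset.range k, g s n := by
    intro s k
    induction k with
    | zero => simp [b, dyadicVal]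
    | succ k ih =>
      have e : b s (k + 1) = bif decide (χ k s) then dAdd (b s k) (dEps k) else b s k := rfl
      rw [e, Finset.sum_range_succ, ← add_assoc, ← ih]
      by_cases hc : χ k s <;> simp [hc, g]
  have hg0 : ∀ s n, 0 ≤ g s n := by
    intro s n
    by_cases hc : χ n s <;> simp [g, hc]
  have hgle : ∀ s t n, s ≤ t → g s n ≤ g t n := by
    intro s t n hst
    by_cases hc : χ n s
    · simp [g, hc, hχmono n s t hst hc]
    · simpa [g, hc] using hg0 t n
  have hmono : Monotone fun s => dyadicVal (a s) := by
    intro s t hst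
    simp only [a, hb]
    refine add_le_add le_rfl ?_
    calc ∑ n ∈ Finset.range s, g s n ≤ ∑ n ∈ Finset.range s, g t n :=
          Finset.sum_le_sum fun n _ => hgle s t n hst
      _ ≤ _ := Finset.sum_le_sum_of_subset_of_nonneg (Finset.range_mono hst) fun n _ _ => hg0 t n
  have hbdd : BddAbove (range fun s => dyadicVal (a s)) := by
    refine ⟨m + 2, ?_⟩
    rintro _ ⟨s, rfl⟩
    simp only [a, hb]
    gcongr
    calc ∑ n ∈ Finset.range s, g s n ≤ ∑ n ∈ Finset.range s, (1 / 2 : ℝ) ^ n := by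
          refine Finset.sum_le_sum fun n _ => ?_
          by_cases hc : χ n s <;> simp [g, hc]
      _ ≤ 2 := sum_geometric_two_le s
  have hlim := tendsto_atTop_ciSup hmono hbdd
  refine ⟨⨆ s, dyadicVal (a s), ?_, ⟨a, ha.to_comp, hmono, hlim⟩, fun hy => ?_⟩
  · refine hm.trans (le_trans ?_ (le_ciSup hbdd 0))
    simp [a, hb]
  · have hre : REPred fun n : ℕ => ∃ s : ℕ, (⨆ s, dyadicVal (a s)) <
        dyadicVal (dAdd (a s) (dEps n)) ∧ ¬ χ n s := by
      refine re_exists₂ (re_and (re_comp hy.upper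
        (f := fun x : ℕ × ℕ => dAdd (a x.2) (dEps x.1)) ?_) ?_)
      · exact primrec_dAdd.to_comp.comp (ha.to_comp.comp Computable.snd)
          (primrec_dEps.to_comp.comp Computable.fst)
      · exact (PrimrecPred.not ⟨_, hχd⟩).rePred
    refine ComputablePred.halting_problem_not_re 0
      ((re_comp hre (f := fun c : Nat.Partrec.Code => Encodable.encode c)
        Primrec.encode.to_comp).of_eq fun c => ?_)
    have hc := hχK (Encodable.encode c)
    rw [Denumerable.ofNat_encode] at hc
    rw [hc]
    generalize Encodable.encode c = n
    constructor
    · rintro ⟨s, h1, h2⟩ ⟨t, ht⟩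
      -- when the machine number `n` halts later, the approximations increase by `2 ^ (-n)`
      refine absurd h1 (not_lt.2 (le_trans ?_ (le_ciSup hbdd (max (max s t) (n + 1)))))
      have hχn := hχmono n t (max (max s t) (n + 1))
        ((le_max_right s t).trans (le_max_left _ _)) ht
      have hs : s ≤ max (max s t) (n + 1) := (le_max_left s t).trans (le_max_left _ _)
      have hn : n < max (max s t) (n + 1) := lt_max_of_lt_right n.lt_succ_self
      generalize max (max s t) (n + 1) = N at *
      rw [dyadicVal_dAdd, dyadicVal_dEps]
      simp only [a, hb]
      have e1 : ∑ j ∈ Finset.range s, g s j ≤ ∑ j ∈ (Finset.range N).erase n, g N j := by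
        calc ∑ j ∈ Finset.range s, g s j ≤ ∑ j ∈ Finset.range N, g s j :=
              Finset.sum_le_sum_of_subset_of_nonneg (Finset.range_mono hs) fun j _ _ => hg0 s j
          _ = ∑ j ∈ (Finset.range N).erase n, g s j := by
              refine (Finset.sum_erase _ ?_).symm
              simp [g, h2]
          _ ≤ _ := Finset.sum_le_sum fun j _ => hgle s N j hs
      have e2 := Finset.sum_erase_add (Finset.range N) (g N) (Finset.mem_range.2 hn)
      have e3 : g N n = (1 / 2) ^ n := if_pos hχn
      linarith
    · intro hno
      have hpos : (0 : ℝ) < (1 / 2) ^ n := by positivity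
      obtain ⟨s, hs⟩ := (hlim.eventually_const_lt
        (show (⨆ s, dyadicVal (a s)) - (1 / 2) ^ n < ⨆ s, dyadicVal (a s) by linarith)).exists
      refine ⟨s, ?_, fun h => hno ⟨s, h⟩⟩
      rw [dyadicVal_dAdd, dyadicVal_dEps]
      linarith

namespace BranchedMap

variable {T : BranchedMap}

/-! ### Points with prescribed values of the generalized Brjuno function -/

/-- The limit of a computable increasing sequence of words is a computable point. -/
theorem Admissible.computableReal_of_words (hT : T.Admissible) {p : ℝ} (hp : p ∈ T.J 0)
    (hpp : T.G p = p) {W : ℕ → List ℕ} (hW : Computable W) (hlen : ∀ k, k ≤ (W k).length) {x : ℝ}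
    (hx : x ∈ T.Lam) (h : ∀ k, T.SameDigits (W k).length x (T.pt p (W k))) :
    ComputableReal x := by
  obtain ⟨θ, κ, h0, h1, -, hc⟩ := hT.exists_contraction
  obtain ⟨s, hs, hsx⟩ := exists_computable_approx (hT.re_pt hp hpp).1 (hT.re_pt hp hpp).2
  obtain ⟨c, hc2⟩ := exists_pow_lt_of_lt_one (by norm_num : (0 : ℝ) < 1 / 2) h1
  refine ⟨fun n => s (W (κ * (c * (n + 1))), n + 1), ?_, fun n => ?_⟩
  · have h2 : Primrec fun n : ℕ => κ * (c * (n + 1)) :=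
      Primrec.nat_mul.comp (Primrec.const κ) (Primrec.nat_mul.comp (Primrec.const c) Primrec.succ)
    exact hs.comp ((hW.comp h2.to_comp).pair Computable.succ)
  · have h2 := hsx (W (κ * (c * (n + 1)))) (n + 1)
    have h3 := hT.abs_sub_le_pow h0 hc hx (hT.pt_mem_Lam hp hpp _)
      ((h (κ * (c * (n + 1)))).mono (hlen _))
    rw [pow_mul] at h3
    have h4 : (θ ^ c) ^ (n + 1) ≤ (1 / 2) ^ (n + 1) :=
      pow_le_pow_left₀ (by positivity) hc2.le _
    have h5 : (1 / 2 : ℝ) ^ n = (1 / 2) ^ (n + 1) + (1 / 2) ^ (n + 1) := by ring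
    calc _ ≤ |x - T.pt p (W (κ * (c * (n + 1))))| + |T.pt p (W (κ * (c * (n + 1)))) -
          dyadicVal (s (W (κ * (c * (n + 1))), n + 1))| := _root_.abs_sub_le _ _ _
      _ < _ := by linarith

/-- Every left-computable number `y` above a value of `Φ` at a point with finitely many prescribed
digits is a value of `Φ` at a computable point. The point is the limit of words found by search:
each prolongs the one before it and brings the value of `Φ` just below a member of the sequence
that increases to `y`. -/
theorem exists_computableReal_realPhi_eq (hT : T.Admissible) {p : ℝ} (hp : p ∈ T.J 0)
    (hpp : T.G p = p) {u : ℝ → ℝ} (hu : T.Weight u) {ν : ℝ} (hν : 0 < ν)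
    (hνc : ComputableReal ν) {y : ℝ} (hy : LeftComputableReal y) {w₀ : List ℕ}
    (hw₀ : T.realPhi u ν (T.pt p w₀) < y) :
    ∃ x ∈ T.Lam, ComputableReal x ∧ T.Converges u ν x ∧ T.realPhi u ν x = y := by
  obtain ⟨a, ha, hmono, hlim⟩ := hy
  have hz : ∀ w, T.pt p w ∈ T.Lam := hT.pt_mem_Lam hp hpp
  have hconv : ∀ w, T.Converges u ν (T.pt p w) := converges_pt hT hp hpp hν
  have h0 : ∀ w, 0 < T.pt p w := fun w => hT.pos (hz w 0)
  have h1 : ∀ w, T.pt p w < 1 := fun w => hT.lt_one (hz w 0)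
  obtain ⟨hl, hup⟩ := hT.re_pt hp hpp
  obtain ⟨E, hE⟩ := hu.computable.exists_enclosure
  have hE1 := hT.pt_mem_eventuallyOnes hp hpp
  have hL : LowerRE fun w => T.realPhi u ν (T.pt p w) :=
    lowerRE_realPhi hT hu (next := List.tail) Primrec.list_tail.to_comp hz (hT.map_pt hp hpp) hconv
      (hl.rpow h0 h1 hν hνc) (hE.lowerRE hE1 hl hup)
  have hU : UpperRE fun w => T.realPhi u ν (T.pt p w) :=
    upperRE_realPhi_pt hT hp hpp hu hν (hup.rpow h0 h1 hν hνc) (hE.upperRE hE1 hl hup)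
  let step : ℕ → List ℕ → List ℕ → Prop := fun k w v => (∃ v', w ++ v' = v) ∧
    w.length < v.length ∧ ∃ n : ℕ, k ≤ n ∧ T.realPhi u ν (T.pt p v) < dyadicVal (a n) ∧
      dyadicVal (dAdd (a n) (dNeg (dEps k))) < T.realPhi u ν (T.pt p v)
  have hstep : REPred fun x : (ℕ × List ℕ) × List ℕ => step x.1.1 x.1.2 x.2 := by
    refine re_and (re_exists₂ ?_) (re_and ?_ (re_exists₂ ?_))
    · exact (Primrec.eq.comp (Primrec.list_append.comp
        (Primrec.snd.comp (Primrec.fst.comp Primrec.fst)) Primrec.snd)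
        (Primrec.snd.comp Primrec.fst)).rePred
    · exact (Primrec.nat_lt.comp (Primrec.list_length.comp (Primrec.snd.comp Primrec.fst))
        (Primrec.list_length.comp Primrec.snd)).rePred
    · have hk : Primrec fun x : ((ℕ × List ℕ) × List ℕ) × ℕ => x.1.1.1 :=
        Primrec.fst.comp (Primrec.fst.comp Primrec.fst)
      have hv : Computable fun x : ((ℕ × List ℕ) × List ℕ) × ℕ => x.1.2 :=
        Computable.snd.comp Computable.fst
      have hn : Computable fun x : ((ℕ × List ℕ) × List ℕ) × ℕ => a x.2 :=
        ha.comp Computable.snd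
      exact re_and (Primrec.nat_le.comp hk Primrec.snd).rePred (re_and (hU.re hv hn)
        (hL.re hv (primrec_dAdd.to_comp.comp hn
          (primrec_dNeg.to_comp.comp (primrec_dEps.to_comp.comp hk.to_comp)))))
  obtain ⟨W, hW, -, hWk⟩ := exists_computable_seq hstep
    (fun w => T.realPhi u ν (T.pt p w) < y) w₀ hw₀ (fun k w hw => by
      obtain ⟨n, hn, hkn⟩ :=
        ((hlim.eventually_const_lt hw).and (eventually_ge_atTop k)).exists
      have hpos : (0 : ℝ) < (1 / 2) ^ k := by positivity
      obtain ⟨v, h2, h3⟩ := exists_realPhi_between hT hp hpp hu hν w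
        (show dyadicVal (a n) - (1 / 2) ^ k < dyadicVal (a n) by linarith) hn
      -- one more digit `0` leaves the point unchanged and makes the word longer
      have hpad := hT.pt_append_replicate hp hpp (w ++ v) 1
      refine ⟨w ++ v ++ List.replicate 1 0, ⟨v ++ List.replicate 1 0, by simp⟩, by simp,
        n, hkn, ?_, ?_⟩
      · rwa [hpad]
      · rw [hpad, dyadicVal_dAdd, dyadicVal_dNeg, dyadicVal_dEps]
        linarith)
    (fun k w v _ hs => by
      obtain ⟨-, -, n, -, h2, -⟩ := hs
      exact h2.trans_le (hmono.ge_of_tendsto hlim n))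
  have hlen : ∀ k, k ≤ (W k).length := by
    intro k
    induction k with
    | zero => exact Nat.zero_le _
    | succ k ih => exact Nat.succ_le_of_lt (ih.trans_lt (hWk k).2.2.1)
  obtain ⟨x, hx, hsame⟩ := exists_limit hT hp hpp (fun k => (hWk k).2.1) hlen
  have hlen' : Tendsto (fun k => (W k).length) atTop atTop := tendsto_atTop_mono hlen tendsto_id
  -- the partial sums at `x` are limits of partial sums at the approximations, hence at most `y`
  have hcx : T.Converges u ν x := by
    refine summable_of_sum_range_le (c := y) (fun i => (term_pos hT hu hx i).le) fun N => ?_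
    refine le_of_tendsto' (tendsto_finsetSum (Finset.range N) fun i _ =>
      tendsto_term hT hu hν hx (fun k => hz (W k)) hlen' hsame i) fun k => ?_
    exact (sum_le_realPhi hT hu (hz _) (hconv _) N).trans (hWk k).1.le
  refine ⟨x, hx, hT.computableReal_of_words hp hpp hW hlen hx hsame, hcx, ?_⟩
  have hlim1 := (tendsto_realPhi_pt hT hp hpp hu hν hx hlen' hsame hcx).comp
    (tendsto_add_atTop_nat 1)
  refine tendsto_nhds_unique hlim1 (tendsto_of_tendsto_of_tendsto_of_le_of_le'
    (g := fun k => dyadicVal (a k) - (1 / 2) ^ k) (h := fun _ => y) ?_ tendsto_const_nhds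
    (Eventually.of_forall fun k => ?_) (Eventually.of_forall fun k => (hWk (k + 1)).1.le))
  · simpa using hlim.sub (tendsto_pow_atTop_nhds_zero_of_lt_one
      (by norm_num : (0 : ℝ) ≤ 1 / 2) (by norm_num))
  · obtain ⟨-, -, -, n, hkn, -, h2⟩ := hWk k
    rw [dyadicVal_dAdd, dyadicVal_dNeg, dyadicVal_dEps] at h2
    have h3 := hmono hkn
    dsimp only [Function.comp] at h3 ⊢
    linarith

/-- At computable points where it is finite, `Φ` takes left-computable values. -/
theorem leftComputableReal_realPhi (hT : T.Admissible) {u : ℝ → ℝ} (hu : T.Weight u) {ν : ℝ}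
    (hν : 0 < ν) (hνc : ComputableReal ν) {x : ℝ} (hx : x ∈ T.Lam) (hxc : ComputableReal x)
    (h : T.Converges u ν x) : LeftComputableReal (T.realPhi u ν x) := by
  obtain ⟨hl, hup⟩ := hT.re_iterate hx hxc
  obtain ⟨E, hE⟩ := hu.leftComputable.exists_lowerEnclosure
  have hz : ∀ j, T.G^[j] x ∈ T.Lam := Lam.iterate hx
  have hL : LowerRE fun j => T.realPhi u ν (T.G^[j] x) :=
    lowerRE_realPhi hT hu (next := Nat.succ) Computable.succ hz
      (fun j => (Function.iterate_succ_apply' T.G j x).symm)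
      (fun j => (converges_iff_iterate hT hx j).1 h)
      (hl.rpow (fun j => hT.pos (hx j)) (fun j => hT.lt_one (hx j)) hν hνc)
      (hE.lowerRE hz hl hup)
  exact leftComputableReal_of_lower (re_comp hL (f := fun c : DyadicCode => ((0 : ℕ), c))
    ((Computable.const 0).pair Computable.id))

/-- Every left-computable number above a finite value of `Φ` is a value of `Φ` at a computable
point. -/
theorem exists_phi_eq_ofReal (hT : T.Admissible) {u : ℝ → ℝ} (hu : T.Weight u) {ν : ℝ}
    (hν : 0 < ν) (hνc : ComputableReal ν) {xs : ℝ} (hxs : xs ∈ T.Lam) (hxsc : ComputableReal xs)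
    (hfin : T.Phi u ν xs < ∞) {y : ℝ} (hy : (T.Phi u ν xs).toReal ≤ y)
    (hyl : LeftComputableReal y) :
    ∃ x ∈ T.Lam, ComputableReal x ∧ T.Phi u ν x = ENNReal.ofReal y := by
  rcases hy.eq_or_lt with rfl | hlt
  · exact ⟨xs, hxs, hxsc, (ENNReal.ofReal_toReal hfin.ne).symm⟩
  · obtain ⟨p, hp, hpp⟩ := hT.exists_fixedPoint
    have hc := (converges_iff hT hu hxs).2 hfin
    rw [toReal_phi hT hu hxs hc] at hlt
    choose W hlen hW using fun n => exists_word hT hp hxs n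
    have hlim := tendsto_realPhi_pt (l := atTop) (W := W) hT hp hpp hu hν hxs
      (by simp only [hlen]; exact tendsto_id) (fun k => by rw [hlen]; exact hW k) hc
    obtain ⟨n, hn⟩ := (hlim.eventually_lt_const hlt).exists
    obtain ⟨x, hx, hxc, hcx, rfl⟩ :=
      exists_computableReal_realPhi_eq hT hp hpp hu hν hνc hyl hn
    exact ⟨x, hx, hxc, phi_eq_ofReal hT hu hx hcx⟩

end BranchedMap

end Brjuno

theorem mainTheorem2 (T : Brjuno.BranchedMap) (hT : T.Admissible)
    (u : ℝ → ℝ) (hu : T.Weight u)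
    (ν : ℝ) (hν : 0 < ν) (hνc : Brjuno.ComputableReal ν)
    (xs : ℝ) (hxs : xs ∈ T.Lam) (hxsc : Brjuno.ComputableReal xs)
    (hfin : T.Phi u ν xs < ∞) :
    (∀ y : ℝ, (T.Phi u ν xs).toReal ≤ y → Brjuno.LeftComputableReal y →
      ∃ x ∈ T.Lam, Brjuno.ComputableReal x ∧ T.Phi u ν x = ENNReal.ofReal y) ∧
    (∀ x ∈ T.Lam, Brjuno.ComputableReal x → T.Phi u ν x < ∞ →
      Brjuno.LeftComputableReal (T.Phi u ν x).toReal) ∧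
    (∃ x ∈ T.Lam, Brjuno.ComputableReal x ∧ T.Phi u ν xs ≤ T.Phi u ν x ∧
      T.Phi u ν x < ∞ ∧ ¬ Brjuno.ComputableReal (T.Phi u ν x).toReal) := by
  refine ⟨fun y hy hyl => Brjuno.BranchedMap.exists_phi_eq_ofReal hT hu hν hνc hxs hxsc hfin hy hyl,
    fun x hx hxc hx' => ?_, ?_⟩
  · have hc := (Brjuno.BranchedMap.converges_iff hT hu hx).2 hx'
    rw [Brjuno.BranchedMap.toReal_phi hT hu hx hc]
    exact Brjuno.BranchedMap.leftComputableReal_realPhi hT hu hν hνc hx hxc hc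
  · obtain ⟨y, hy, hyl, hyc⟩ :=
      Brjuno.exists_leftComputableReal_not_computableReal (T.Phi u ν xs).toReal
    obtain ⟨x, hx, hxc, he⟩ :=
      Brjuno.BranchedMap.exists_phi_eq_ofReal hT hu hν hνc hxs hxsc hfin hy hyl
    refine ⟨x, hx, hxc, ?_, by rw [he]; exact ENNReal.ofReal_lt_top, ?_⟩
    · rw [he, ← ENNReal.ofReal_toReal hfin.ne]
      exact ENNReal.ofReal_le_ofReal hy
    · rwa [he, ENNReal.toReal_ofReal (ENNReal.toReal_nonneg.trans hy)]
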